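/- **Setting.** A datalog program $\Pi$ is a finite set of rules $q(\bar s)\leftarrow p_1(\bar s_1),\dots,p_\mu(\bar s_\mu)$ whose arguments are variables or constants; $|\Pi|$ is its number of rules. A predicate is an IDB predicate if it is the head predicate of a rule with non-empty body, and an EDB predicate otherwise. All rules are safe (every head variable occurs in the body), and head predicates are IDB predicates. A database $D$ gives a finite relation for every EDB predicate; the value of an IDB predicate $q$ is the set of tuples $\bar t$ such that $q(\bar t)$ is in the least fixpoint of the immediate consequence operator started with $D$. The program $\Pi$ is *adornment groundable* if for every rule (1) every EDB body atom either contains a variable that occurs in the head and in no other body atom, or has all its variables in the head; and (2) every variable of an IDB body atom occurs in the head or in some EDB body atom. **Adornments.** An adornment of an IDB predicate $q$ is a rule $\rho$ with head predicate $q$ whose body is a set of EDB atoms with variables and wildcards "$\_$" (each a fresh variable) as arguments. The adorned program $\Pi'$ is the smallest set of rules closed under the following step. Take a rule $R$ of $\Pi$ with IDB body atoms $p_i(\bar s_i)$, $i\le\lambda$, and remaining EDB body atoms $\mathcal E$; choose rules of $\Pi'$ with heads ${p_i}_{\rho_i}(\bar v_i)$; rename these heads, together with their adornments, apart from $R$ and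 from each other into $p_i(\bar v_i')\leftarrow\mathcal B_i$; let $\sigma$ be a simultaneous most general unifier of the pairs $(\bar s_i,\bar v_i')$ (if there is none, nothing is added); let $\rho$ be obtained from $q(\sigma(\bar s))\leftarrow\bigwedge_i\sigma(\mathcal B_i)\wedge\sigma(\mathcal E)$ by replacing in the body every argument that is not a head variable by $\_$, and then removing each body atom that consists of wildcards only or arises from another body atom by replacing arguments by $\_$; add the rule $q_\rho(\sigma(\bar s))\leftarrow\bigwedge_i {p_i}_{\rho_i}(\sigma(\bar s_i))\wedge\sigma(\mathcal E)$. Rules and adornments are identified up to renaming of variables. Let $f(\Pi)$ be the maximum over the IDB predicates $q$ of $\Pi$ of the number of adornments $\rho$ for which $q_\rho$ is a head predicate of $\Pi'$. The (fractional) edge-cover width $\mathrm{ew}(\rho)$ is the minimum of $\sum_e x_e$ over weights $0\le x_e\le1$ on the hyperedges $e$ (the variable sets of the body atoms of $\rho$) such that $\sum_{e\ni v}x_e\ge1$ for every head variable $v$ of $\rho$; and $\mathrm{ew}(\Pi)$ is the maximum of $\mathrm{ew}(\rho)$ over all these adornments (0 if there are none). **Theorem.** Let $\Pi$ be an adornment-groundable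 datalog program. There is a machine program, depending on $\Pi$ but not on the database, which, for every $N\ge1$ and every database instance $D$ with at most $N$ tuples in each EDB relation of $\Pi$, computes (lists without repetition) all IDB relations of $\Pi$ over $D$ in time $$O\bigl(f(\Pi)\cdot|\Pi|\cdot N^{\mathrm{ew}(\Pi)}\bigr),$$ where the constant hidden in $O(\cdot)$ depends only on the maximal number of body atoms of a rule of $\Pi$ and on the maximal arity of a predicate of $\Pi$. The machine is a random access machine with unit-cost assignments and tests (equality of values, order of numbers) and the successor and predecessor operations on numbers, whose memory is a dictionary addressed by tuples of numbers, predicate symbols and constants, an access costing one plus the length of the address. Each EDB relation is given by its size, a duplicate-free array of its tuples, and a membership table; the IDB relations are returned in the same form. -/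

import Mathlib

universe u v

namespace Datalog

/-! ### Programs and their semantics -/

/-- Terms over the set `K` of constants; variables are natural numbers. -/
inductive Term (K : Type v) where
  | var (x : ℕ) : Term K
  | const (c : K) : Term K

/-- Atoms over predicate symbols `P` with arities `ar`. -/
structure Atom {P : Type u} (ar : P → ℕ) (K : Type v) where
  pred : P
  args : Fin (ar pred) → Term K

/-- A rule; the body is the conjunction of the listed atoms. -/
structure Rule {P : Type u} (ar : P → ℕ) (K : Type v) where
  head : Atom ar K
  body : List (Atom ar K)

/-- A program is a finite set of rules. -/
abbrev Program {P : Type u} (ar : P → ℕ) (K : Type v) := Finset (Rule ar K)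

/-- Ground atoms. -/
abbrev Fact {P : Type u} (ar : P → ℕ) (K : Type v) := (p : P) × (Fin (ar p) → K)

def Term.vars {K : Type v} : Term K → Finset ℕ
  | .var x => {x}
  | .const _ => ∅

def Term.subst {K : Type v} (σ : ℕ → Term K) : Term K → Term K
  | .var x => σ x
  | .const c => .const c

def Term.ground {K : Type v} (τ : ℕ → K) : Term K → K
  | .var x => τ x
  | .const c => c

section

variable {P : Type u} {ar : P → ℕ} {K : Type v}

def Atom.vars (A : Atom ar K) : Finset ℕ := Finset.univ.biUnion fun i => (A.args i).vars

def Atom.subst (σ : ℕ → Term K) (A : Atom ar K) : Atom ar K :=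
  ⟨A.pred, fun i => (A.args i).subst σ⟩

def Atom.ground (τ : ℕ → K) (A : Atom ar K) : Fact ar K :=
  ⟨A.pred, fun i => (A.args i).ground τ⟩

/-- `x` occurs in the rule. -/
def Rule.HasVar (R : Rule ar K) (x : ℕ) : Prop := x ∈ R.head.vars ∨ ∃ B ∈ R.body, x ∈ B.vars

/-- A rule is safe if every head variable occurs in the body. -/
def Rule.Safe (R : Rule ar K) : Prop := ∀ x ∈ R.head.vars, ∃ B ∈ R.body, x ∈ B.vars

/-- Intensional predicates: heads of rules with a non-empty body. All others are extensional. -/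
def IsIDB (prog : Program ar K) (p : P) : Prop :=
  ∃ R ∈ prog, R.head.pred = p ∧ R.body ≠ []

/-- Extensional predicates that occur in the program. -/
def IsEDBOf (prog : Program ar K) (p : P) : Prop :=
  ¬ IsIDB prog p ∧ ∃ R ∈ prog, ∃ B ∈ R.body, B.pred = p

/-- Well-formed programs: all rules are safe, and no rule has an extensional head predicate
(extensional facts belong to the database). -/
structure WellFormed (prog : Program ar K) : Prop where
  safe : ∀ R ∈ prog, R.Safe
  head_idb : ∀ R ∈ prog, IsIDB prog R.head.pred

/-- A database: for every predicate a duplicate-free listing of a finite relation. Only the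
relations of the extensional predicates of a program are ever used. -/
structure Database {P : Type u} (ar : P → ℕ) (K : Type v) where
  rel : (p : P) → List (Fin (ar p) → K)
  nodup : ∀ p, (rel p).Nodup

/-- The least fixpoint of the immediate consequence operator, started with the extensional
relations of `D`. -/
inductive Holds (prog : Program ar K) (D : Database ar K) : Fact ar K → Prop
  | edb (p : P) (t : Fin (ar p) → K) (hp : ¬ IsIDB prog p) (ht : t ∈ D.rel p) :
      Holds prog D ⟨p, t⟩
  | rule (R : Rule ar K) (hR : R ∈ prog) (τ : ℕ → K)
      (h : ∀ B ∈ R.body, Holds prog D (B.ground τ)) : Holds prog D (R.head.ground τ)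

/-- Adornment-groundable programs. -/
def AdornmentGroundable (prog : Program ar K) : Prop :=
  ∀ R ∈ prog,
    (∀ A ∈ R.body, ¬ IsIDB prog A.pred →
      (∃ x ∈ A.vars, x ∈ R.head.vars ∧ ∀ B ∈ R.body, B ≠ A → x ∉ B.vars) ∨
        A.vars ⊆ R.head.vars) ∧
    (∀ A ∈ R.body, IsIDB prog A.pred → ∀ x ∈ A.vars,
      x ∈ R.head.vars ∨ ∃ B ∈ R.body, ¬ IsIDB prog B.pred ∧ x ∈ B.vars)

/-- Maximal number of body atoms of a rule. -/
def maxBody (prog : Program ar K) : ℕ := prog.sup fun R => R.body.length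

/-- Maximal arity of a predicate occurring in the program. -/
def maxArity (prog : Program ar K) : ℕ :=
  prog.sup fun R => (R.head :: R.body).foldr (fun A m => max (ar A.pred) m) 0

/-! ### Adornments and the program they are computed by -/

/-- Atoms with wildcards: `none` is the wildcard, a fresh existentially quantified variable. -/
structure WAtom {P : Type u} (ar : P → ℕ) (K : Type v) where
  pred : P
  args : Fin (ar pred) → Option (Term K)

def WAtom.vars (B : WAtom ar K) : Finset ℕ :=
  Finset.univ.biUnion fun i => ((B.args i).map Term.vars).getD ∅

def WAtom.subst (σ : ℕ → Term K) (B : WAtom ar K) : WAtom ar K :=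
  ⟨B.pred, fun i => (B.args i).map (Term.subst σ)⟩

def Atom.toWAtom (A : Atom ar K) : WAtom ar K := ⟨A.pred, fun i => some (A.args i)⟩

open Classical in
/-- Replace every argument that is not one of the variables in `W` by the wildcard. -/
noncomputable def WAtom.hide (W : Finset ℕ) (B : WAtom ar K) : WAtom ar K :=
  ⟨B.pred, fun i => if ∃ x ∈ W, B.args i = some (.var x) then B.args i else none⟩

/-- `B` imposes at most the restrictions of `C`: the same predicate, and every argument of `B`
is a wildcard or the corresponding argument of `C`. -/
def WAtom.LessRestrictive (B C : WAtom ar K) : Prop :=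
  ∃ h : B.pred = C.pred, ∀ i, B.args i = none ∨ B.args i = C.args (Fin.cast (congrArg ar h) i)

/-- A rule whose body is a finite set of atoms with wildcards. -/
structure Adornment {P : Type u} (ar : P → ℕ) (K : Type v) where
  head : Atom ar K
  body : Finset (WAtom ar K)

open Classical in
noncomputable def Adornment.subst (σ : ℕ → Term K) (ρ : Adornment ar K) : Adornment ar K :=
  ⟨ρ.head.subst σ, ρ.body.image (WAtom.subst σ)⟩

/-- Renaming of variables. -/
noncomputable def Adornment.rename (π : Equiv.Perm ℕ) (ρ : Adornment ar K) : Adornment ar K :=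
  ρ.subst fun x => .var (π x)

open Classical in
/-- The relaxation to the output variables: hide everything except the head variables, then
drop every body atom that is all wildcards or less restrictive than another body atom. -/
noncomputable def Adornment.gOut (ρ : Adornment ar K) : Adornment ar K :=
  ⟨ρ.head, (ρ.body.image (WAtom.hide ρ.head.vars)).filter fun B =>
    (∃ i, B.args i ≠ none) ∧
      ∀ C ∈ ρ.body.image (WAtom.hide ρ.head.vars), B.LessRestrictive C → C = B⟩

/-- `σ` makes the two components of every pair in `S` equal. -/
def Unifies (σ : ℕ → Term K) (S : Set (Atom ar K × Atom ar K)) : Prop :=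
  ∀ q ∈ S, q.1.subst σ = q.2.subst σ

/-- `σ` is a simultaneous most general unifier of `S`. -/
def IsMGU (σ : ℕ → Term K) (S : Set (Atom ar K × Atom ar K)) : Prop :=
  Unifies σ S ∧ ∀ τ : ℕ → Term K, Unifies τ S → ∃ θ : ℕ → Term K, ∀ x, τ x = (σ x).subst θ

/-- A rule of the adorned program. Its head is the head atom of the adornment `ρ`, with predicate
adorned by `ρ`; extensional body atoms carry no adornment. -/
structure AdornedRule {P : Type u} (ar : P → ℕ) (K : Type v) where
  ρ : Adornment ar K
  body : List (Option (Adornment ar K) × Atom ar K)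

/-- For a rule `R` and adornments `ρ i` for its intensional body atoms, already
renamed apart: the pairs of atoms to be unified. -/
def unificationPairs (prog : Program ar K) (R : Rule ar K)
    (ρ : Fin R.body.length → Adornment ar K) : Set (Atom ar K × Atom ar K) :=
  {q | ∃ i, IsIDB prog (R.body.get i).pred ∧ q = (R.body.get i, (ρ i).head)}

open Classical in
/-- Inline the adornments `ρ i` into `R` under the unifier `σ`. -/
noncomputable def inline (prog : Program ar K) (R : Rule ar K)
    (ρ : Fin R.body.length → Adornment ar K) (σ : ℕ → Term K) : Adornment ar K :=
  ⟨R.head.subst σ, Finset.univ.biUnion fun i =>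
    if IsIDB prog (R.body.get i).pred then ((ρ i).subst σ).body
    else {((R.body.get i).subst σ).toWAtom}⟩

open Classical in
/-- The rules of the adorned program computed from `prog`: the rules generated from a rule
`R` of `prog` and a choice `R' i` of rules generated before, one for each intensional body
atom of `R`, by renaming the heads of the `R' i` apart (`π`), unifying them with the body atoms
(`σ`), inlining their adornments and relaxing the result. All choices of the
renamings and of the most general unifier are admitted; they differ only by a renaming
of variables. -/
inductive AdornedProgram (prog : Program ar K) : AdornedRule ar K → Prop
  | propagate (R : Rule ar K) (hR : R ∈ prog)
      (R' : Fin R.body.length → AdornedRule ar K)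
      (hR' : ∀ i, IsIDB prog (R.body.get i).pred → AdornedProgram prog (R' i))
      (π : Fin R.body.length → Equiv.Perm ℕ)
      (apart : ∀ i, IsIDB prog (R.body.get i).pred →
        ∀ x ∈ ((R' i).ρ.rename (π i)).head.vars, ¬ R.HasVar x)
      (apart' : ∀ i j, IsIDB prog (R.body.get i).pred → IsIDB prog (R.body.get j).pred → i ≠ j →
        Disjoint ((R' i).ρ.rename (π i)).head.vars ((R' j).ρ.rename (π j)).head.vars)
      (σ : ℕ → Term K)
      (hσ : IsMGU σ (unificationPairs prog R fun i => (R' i).ρ.rename (π i))) :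
      AdornedProgram prog
        { ρ := (inline prog R (fun i => (R' i).ρ.rename (π i)) σ).gOut
          body := List.ofFn fun i =>
            (if IsIDB prog (R.body.get i).pred then some (R' i).ρ else none,
              (R.body.get i).subst σ) }

/-- The adornments of the adorned intensional predicates. -/
def adornments (prog : Program ar K) : Set (Adornment ar K) :=
  {ρ | ∃ R, AdornedProgram prog R ∧ R.ρ = ρ}

/-- The class of an adornment up to renaming of variables. -/
def Adornment.renamings (ρ : Adornment ar K) : Set (Adornment ar K) :=
  Set.range fun π : Equiv.Perm ℕ => ρ.rename π

/-- The number of adornments of the predicate `q`, up to renaming of variables. -/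
noncomputable def numAdornments (prog : Program ar K) (q : P) : ℕ :=
  Set.ncard {O : Set (Adornment ar K) |
    ∃ ρ ∈ adornments prog, ρ.head.pred = q ∧ O = ρ.renamings}

/-- The coefficient `f`: the maximal number of adornments of an intensional predicate. -/
noncomputable def adornmentCoeff (prog : Program ar K) : ℕ :=
  prog.sup fun R => numAdornments prog R.head.pred

/-! ### Edge-cover width -/

open Classical in
/-- The hyperedges of the hypergraph of an adornment. Wildcards are vertices that lie in one
hyperedge only and need not be covered, so they are left out. -/
noncomputable def Adornment.edges (ρ : Adornment ar K) : Finset (Finset ℕ) :=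
  ρ.body.image WAtom.vars

/-- Fractional edge covers of the output variables. -/
def Adornment.IsFractionalCover (ρ : Adornment ar K) (w : Finset ℕ → ℝ) : Prop :=
  (∀ e ∈ ρ.edges, 0 ≤ w e ∧ w e ≤ 1) ∧
    ∀ x ∈ ρ.head.vars, 1 ≤ ∑ e ∈ ρ.edges with x ∈ e, w e

/-- The fractional edge-cover width of an adornment. -/
noncomputable def Adornment.width (ρ : Adornment ar K) : ℝ :=
  sInf {s | ∃ w, ρ.IsFractionalCover w ∧ s = ∑ e ∈ ρ.edges, w e}

/-- The fractional edge-cover width of a program. -/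
noncomputable def edgeCoverWidth (prog : Program ar K) : ℝ :=
  sSup (Adornment.width '' adornments prog)

end

/-! ### Machines

A random access machine with unit-cost tests and assignments whose memory is a dictionary
addressed by tuples of values. Constants of the database are atomic: they can be copied, compared
for equality and used in addresses. -/

/-- Values of registers and memory cells. -/
inductive Val (P : Type u) (K : Type v) where
  | nat (n : ℕ) : Val P K
  | pred (p : P) : Val P K
  | const (c : K) : Val P K

def Val.toNat {P : Type u} {K : Type v} : Val P K → ℕ
  | .nat n => n
  | _ => 0

structure State (P : Type u) (K : Type v) where
  reg : ℕ → Val P K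
  mem : List (Val P K) → Val P K

/-- Tests: equality, and order of numbers. -/
inductive Test where
  | eq (r s : ℕ) : Test
  | lt (r s : ℕ) : Test

def Test.Holds {P : Type u} {K : Type v} (S : State P K) : Test → Prop
  | .eq r s => S.reg r = S.reg s
  | .lt r s => (S.reg r).toNat < (S.reg s).toNat

/-- Machine programs; `r`, `s` are registers, and `a` is a list of registers whose values form
a memory address. -/
inductive Cmd (P : Type u) (K : Type v) where
  | skip : Cmd P K
  | set (r : ℕ) (x : Val P K) : Cmd P K
  | move (r s : ℕ) : Cmd P K
  | succ (r : ℕ) : Cmd P K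
  | pred (r : ℕ) : Cmd P K
  | load (r : ℕ) (a : List ℕ) : Cmd P K
  | store (a : List ℕ) (r : ℕ) : Cmd P K
  | seq (c d : Cmd P K) : Cmd P K
  | ite (b : Test) (c d : Cmd P K) : Cmd P K
  | while (b : Test) (c : Cmd P K) : Cmd P K

def State.setReg {P : Type u} {K : Type v} (S : State P K) (r : ℕ) (x : Val P K) : State P K :=
  { S with reg := Function.update S.reg r x }

open Classical in
noncomputable def State.setMem {P : Type u} {K : Type v} (S : State P K) (a : List (Val P K))
    (x : Val P K) : State P K :=
  { S with mem := Function.update S.mem a x }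

/-- `Exec c S t T`: started in `S`, the program `c` halts in `T` after `t` steps. Every
assignment and every test takes one step; a memory access takes one more step for each
component of the address. -/
inductive Exec {P : Type u} {K : Type v} : Cmd P K → State P K → ℕ → State P K → Prop
  | skip (S) : Exec .skip S 0 S
  | set (S r x) : Exec (.set r x) S 1 (S.setReg r x)
  | move (S r s) : Exec (.move r s) S 1 (S.setReg r (S.reg s))
  | succ (S r) : Exec (.succ r) S 1 (S.setReg r (.nat ((S.reg r).toNat + 1)))
  | pred (S r) : Exec (.pred r) S 1 (S.setReg r (.nat ((S.reg r).toNat - 1)))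
  | load (S r a) : Exec (.load r a) S (a.length + 1) (S.setReg r (S.mem (a.map S.reg)))
  | store (S a r) : Exec (.store a r) S (a.length + 1) (S.setMem (a.map S.reg) (S.reg r))
  | seq {c d S T U t u} (hc : Exec c S t T) (hd : Exec d T u U) : Exec (.seq c d) S (t + u) U
  | ite_true {b c d S T t} (hb : b.Holds S) (hc : Exec c S t T) : Exec (.ite b c d) S (t + 1) T
  | ite_false {b c d S T t} (hb : ¬ b.Holds S) (hd : Exec d S t T) :
      Exec (.ite b c d) S (t + 1) T
  | while_true {b c S T U t u} (hb : b.Holds S) (hc : Exec c S t T)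
      (hw : Exec (.while b c) T u U) : Exec (.while b c) S (t + u + 1) U
  | while_false {b c S} (hb : ¬ b.Holds S) : Exec (.while b c) S 1 S

section

variable {P : Type u} {ar : P → ℕ} {K : Type v}

/-- The memory stores the relation listed by `L` under the name `p`: its size, its
tuples as an array, and a membership table. -/
def State.Stores (S : State P K) (p : P) (L : List (Fin (ar p) → K)) : Prop :=
  S.mem [.nat 0, .pred p] = .nat L.length ∧
  (∀ (i : Fin L.length) (j : Fin (ar p)),
    S.mem [.nat 1, .pred p, .nat i, .nat j] = .const (L.get i j)) ∧
  (∀ t ∈ L, S.mem (.nat 2 :: .pred p :: List.ofFn fun j => .const (t j)) = .nat 1) ∧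
  (∀ t ∉ L, S.mem (.nat 2 :: .pred p :: List.ofFn fun j => .const (t j)) = .nat 0)

open Classical in
/-- The initial state: all extensional relations are stored, and everything else is `0`. -/
noncomputable def initState (prog : Program ar K) (D : Database ar K) : State P K where
  reg := fun _ => .nat 0
  mem
    | [.nat 0, .pred p] => if IsIDB prog p then .nat 0 else .nat (D.rel p).length
    | [.nat 1, .pred p, .nat i, .nat j] =>
      if h : ¬ IsIDB prog p ∧ i < (D.rel p).length ∧ j < ar p then
        .const ((D.rel p).get ⟨i, h.2.1⟩ ⟨j, h.2.2⟩)
      else .nat 0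
    | .nat 2 :: .pred p :: l =>
      if ¬ IsIDB prog p ∧ ∃ t ∈ D.rel p, l = List.ofFn fun j => .const (t j) then .nat 1
      else .nat 0
    | _ => .nat 0

/-- The result of evaluating `prog` over `D` is in memory: every intensional relation
is stored, listed without repetition. -/
def State.IsResult (S : State P K) (prog : Program ar K) (D : Database ar K) : Prop :=
  ∀ q, IsIDB prog q → ∃ L : List (Fin (ar q) → K),
    L.Nodup ∧ (∀ t, t ∈ L ↔ Holds prog D ⟨q, t⟩) ∧ S.Stores q L

end

end Datalog

/-! The program is evaluated by grounding it. All rule instances whose body holds in the least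
fixpoint, and possibly some more, are written down as propositional rules between numbered facts;
propagation along these ground rules, linear in their number, then finds the derivable facts. The
point is to find the instances among few enough candidates.

A derivable intensional fact is an instance of the head of an adornment whose body is satisfied by
the database (`Holds.exists_adornment`). More precisely, a true instance of a rule `R` comes with an
adornment `ρ` generated from `R` by a unifier `σ`, and with an assignment that satisfies the body of
`ρ` and composes with `σ` to the instance (`exists_generates`). Hence it suffices to treat each pair
of a rule and a class of adornments once, and there are at most `|Π| * f(Π)` such pairs
(`exists_adorned_rules`).

The atoms of `ρ` mention head variables only, yet groundability makes its hypergraph control all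
variables of `R`. An extensional atom `A` with a non-head variable has a head variable `x` that lies
in no other body atom. An idempotent most general unifier leaves `x` alone (`IsIdemMGU.eq_var`), so
an atom of `ρ` that contains `x` must be a relaxation of `A`, and a tuple for it fixes every
variable of `A`. Intensional atoms contribute no further variables. So each variable of `R`, unless
it is a head variable that `σ` sends to a constant, is attached to a head variable `v` of `ρ` such
that all atoms of `ρ` containing `v` determine it (`Generates.exists_determines`). A fractional edge
cover of `ρ` is therefore one of the join over all these variables (`Plan.joinWork_le`).

The join is searched variable by variable: scan the smallest list of continuations, and look the
values up in the tries of the other edges (`WP.search`). Hölder's inequality for covers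
(`sum_prod_rpow_le`), applied once per variable, bounds the number of steps by a constant times `N`
to the total weight of the cover (`joinWork_le`). Candidates satisfy only a relaxation of the rule;
its extensional atoms are tested exactly before an instance is registered, so the relaxation
influences the running time and not the result. There is one trie for each hyperedge, and hyperedges
are sets of head variables, so their number is bounded in terms of the arity; the time `N` for
building a trie is absorbed because an adornment with a hyperedge has width at least 1
(`Plan.le_rpow`).

Propagation (`WP.propagate`) derives exactly the intensional facts of the least fixpoint
(`holds_iff_derivable`). Everything is put together in `WP.evaluate`, and `evaluation_time_le`
collects the costs. -/

namespace Datalog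

/-! ### A layer of named registers and numbered tables over the machine -/

/-- Names for the registers that are not used as scratch space. -/
inductive Slot where
  | var (y : ℕ) : Slot
  | idx (y : ℕ) : Slot
  | lim (y : ℕ) : Slot
  | tmp (n : ℕ) : Slot
deriving DecidableEq

/-- The residues modulo 5 keep the four families of named registers apart; residue 4 is left for
`scratch`. -/
def Slot.reg : Slot → ℕ
  | .var y => 5 * y
  | .idx y => 5 * y + 1
  | .lim y => 5 * y + 2
  | .tmp y => 5 * y + 3

def scratch (j : ℕ) : ℕ := 5 * j + 4

theorem Slot.reg_injective : Function.Injective Slot.reg := by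
  intro a b h
  cases a <;> cases b <;> simp only [Slot.reg] at h <;> first | omega | (congr 1; omega)

theorem Slot.reg_ne_scratch (a : Slot) (j : ℕ) : a.reg ≠ scratch j := by
  cases a <;> simp only [Slot.reg, scratch] <;> omega

theorem scratch_injective : Function.Injective scratch := by
  intro a b h
  simp only [scratch] at h
  omega

section

variable {P : Type u} {ar : P → ℕ} {K : Type v}

/-- Machine states as seen by the programs below: named registers, and memory divided into
tables by the first component of the address. -/
structure Mach (P : Type u) (K : Type v) where
  env : Slot → Val P K
  tab : ℕ → List (Val P K) → Val P K

/-- Scratch registers, and memory at addresses that do not begin with a number, are deliberately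
left unconstrained: writing to a scratch register does not change the represented state. -/
def Represents (S : State P K) (s : Mach P K) : Prop :=
  (∀ r : Slot, S.reg r.reg = s.env r) ∧ ∀ n a, S.mem (.nat n :: a) = s.tab n a

namespace Mach

def set (s : Mach P K) (r : Slot) (x : Val P K) : Mach P K :=
  ⟨Function.update s.env r x, s.tab⟩

open Classical in
noncomputable def put (s : Mach P K) (n : ℕ) (a : List (Val P K)) (x : Val P K) : Mach P K :=
  ⟨s.env, Function.update s.tab n (Function.update (s.tab n) a x)⟩

@[simp] theorem tab_set (s : Mach P K) (r : Slot) (x : Val P K) : (s.set r x).tab = s.tab := rfl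

@[simp] theorem env_put (s : Mach P K) (n : ℕ) (a : List (Val P K)) (x : Val P K) :
    (s.put n a x).env = s.env := rfl

@[simp] theorem env_set_self (s : Mach P K) (r : Slot) (x : Val P K) : (s.set r x).env r = x := by
  simp [set]

theorem env_set (s : Mach P K) (r r' : Slot) (x : Val P K) :
    (s.set r x).env r' = if r' = r then x else s.env r' := by
  simp [set, Function.update_apply]

@[simp] theorem env_set_of_ne (s : Mach P K) {r r' : Slot} (x : Val P K) (h : r' ≠ r) :
    (s.set r x).env r' = s.env r' := by
  simp [set, h]

open Classical in
@[simp] theorem tab_put_self (s : Mach P K) (n : ℕ) (a : List (Val P K)) (x : Val P K) :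
    (s.put n a x).tab n = Function.update (s.tab n) a x := by
  simp [put]

@[simp] theorem tab_put_of_ne (s : Mach P K) {n m : ℕ} (a : List (Val P K)) (x : Val P K)
    (h : m ≠ n) : (s.put n a x).tab m = s.tab m := by
  simp [put, h]

end Mach

/-- Operands: named registers and immediate values. -/
inductive Opd (P : Type u) (K : Type v) where
  | slot (r : Slot) : Opd P K
  | imm (x : Val P K) : Opd P K

def Opd.eval (s : Mach P K) : Opd P K → Val P K
  | .slot r => s.env r
  | .imm x => x

@[simp] theorem Opd.eval_slot (s : Mach P K) (r : Slot) : (Opd.slot r).eval s = s.env r := rfl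
@[simp] theorem Opd.eval_imm (s : Mach P K) (x : Val P K) : (Opd.imm x).eval s = x := rfl

@[simp] theorem Opd.eval_put (s : Mach P K) (n : ℕ) (a : List (Val P K)) (x : Val P K)
    (o : Opd P K) : o.eval (s.put n a x) = o.eval s := by
  cases o <;> rfl

/-- Operands that do not depend on temporary registers. -/
def Opd.NoTmp (o : Opd P K) : Prop := ∀ n, o ≠ .slot (.tmp n)

theorem Opd.NoTmp.eval_set {o : Opd P K} (h : o.NoTmp) (s : Mach P K) (n : ℕ) (x : Val P K) :
    o.eval (s.set (.tmp n) x) = o.eval s := by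
  cases o with
  | slot r => exact Mach.env_set_of_ne _ _ fun e => h n (e ▸ rfl)
  | imm x => rfl

theorem Opd.map_eval_set_tmp {a : List (Opd P K)} (h : ∀ o ∈ a, o.NoTmp) (s : Mach P K) (n : ℕ)
    (x : Val P K) : a.map (Opd.eval (s.set (.tmp n) x)) = a.map (Opd.eval s) :=
  List.map_congr_left fun o ho => (h o ho).eval_set s n x

@[simp] theorem Opd.map_eval_put (s : Mach P K) (n : ℕ) (b : List (Val P K)) (x : Val P K)
    (a : List (Opd P K)) : a.map (Opd.eval (s.put n b x)) = a.map (Opd.eval s) :=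
  List.map_congr_left fun _ _ => Opd.eval_put _ _ _ _ _

/-- `WP c t Q s`: started in a state represented by `s`, the program `c` halts within `t` steps
in a state represented by some `s'` with `Q s'`. -/
def WP (c : Cmd P K) (t : ℕ) (Q : Mach P K → Prop) (s : Mach P K) : Prop :=
  ∀ S, Represents S s → ∃ u S' s', Exec c S u S' ∧ u ≤ t ∧ Represents S' s' ∧ Q s'

theorem WP.mono {c : Cmd P K} {t t' : ℕ} {Q Q' : Mach P K → Prop} {s : Mach P K}
    (h : WP c t Q s) (ht : t ≤ t') (hQ : ∀ s', Q s' → Q' s') : WP c t' Q' s := by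
  intro S hS
  obtain ⟨u, S', s', h1, h2, h3, h4⟩ := h S hS
  exact ⟨u, S', s', h1, h2.trans ht, h3, hQ _ h4⟩

theorem WP.skip {Q : Mach P K → Prop} {s : Mach P K} (h : Q s) : WP .skip 0 Q s :=
  fun S hS => ⟨0, S, s, .skip S, le_rfl, hS, h⟩

theorem WP.seq {c d : Cmd P K} {t u : ℕ} {Q : Mach P K → Prop} {s : Mach P K}
    (h : WP c t (fun s' => WP d u Q s') s) : WP (.seq c d) (t + u) Q s := by
  intro S hS
  obtain ⟨t', S', s', h1, h2, h3, h4⟩ := h S hS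
  obtain ⟨u', S'', s'', k1, k2, k3, k4⟩ := h4 S' h3
  exact ⟨t' + u', S'', s'', .seq h1 k1, by omega, k3, k4⟩

theorem Represents.setReg {S : State P K} {s : Mach P K} (h : Represents S s) (r : Slot)
    (x : Val P K) : Represents (S.setReg r.reg x) (s.set r x) := by
  refine ⟨fun r' => ?_, h.2⟩
  by_cases hr : r' = r
  · subst hr; simp [State.setReg]
  · simp [State.setReg, hr, Slot.reg_injective.ne hr, h.1]

theorem Represents.setScratch {S : State P K} {s : Mach P K} (h : Represents S s) (j : ℕ)
    (x : Val P K) : Represents (S.setReg (scratch j) x) s := by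
  refine ⟨fun r' => ?_, h.2⟩
  simp [State.setReg, Slot.reg_ne_scratch, h.1]

theorem Represents.setMem {S : State P K} {s : Mach P K} (h : Represents S s) (n : ℕ)
    (a : List (Val P K)) (x : Val P K) :
    Represents (S.setMem (.nat n :: a) x) (s.put n a x) := by
  refine ⟨h.1, fun m b => ?_⟩
  by_cases hm : m = n
  · subst hm
    by_cases hb : b = a
    · simp [State.setMem, hb]
    · simp [State.setMem, hb, h.2]
  · simp [State.setMem, hm, h.2]

def Opd.moveTo (r : ℕ) : Opd P K → Cmd P K
  | .slot r' => .move r r'.reg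
  | .imm x => .set r x

theorem Opd.exec_moveTo {S : State P K} {s : Mach P K} (h : Represents S s) (r : ℕ) (o : Opd P K) :
    Exec (o.moveTo r) S 1 (S.setReg r (o.eval s)) := by
  cases o with
  | slot r' => simpa [Opd.moveTo, h.1] using Exec.move S r r'.reg
  | imm x => exact Exec.set S r x

namespace Cmd

def assign (r : Slot) (o : Opd P K) : Cmd P K := o.moveTo r.reg

def incr (r : Slot) : Cmd P K := .succ r.reg

/-- Load operands into consecutive scratch registers. -/
def prep : ℕ → List (Opd P K) → Cmd P K
  | _, [] => .skip
  | j, o :: os => .seq (o.moveTo (scratch j)) (prep (j + 1) os)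

def get (r : Slot) (n : ℕ) (a : List (Opd P K)) : Cmd P K :=
  .seq (prep 0 (.imm (.nat n) :: a)) (.load r.reg ((List.range' 0 (a.length + 1)).map scratch))

/-- The value goes into scratch register 0 and the address into the following ones, hence the range
starting at 1. -/
def save (n : ℕ) (a : List (Opd P K)) (o : Opd P K) : Cmd P K :=
  .seq (prep 0 (o :: .imm (.nat n) :: a))
    (.store ((List.range' 1 (a.length + 1)).map scratch) (scratch 0))

def ifEq (o o' : Opd P K) (c d : Cmd P K) : Cmd P K :=
  .seq (prep 0 [o, o']) (.ite (.eq (scratch 0) (scratch 1)) c d)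

def ifLt (r r' : Slot) (c d : Cmd P K) : Cmd P K := .ite (.lt r.reg r'.reg) c d

def whileLt (i n : Slot) (c : Cmd P K) : Cmd P K := .while (.lt i.reg n.reg) c

def forLt (i n : Slot) (c : Cmd P K) : Cmd P K :=
  .seq (assign i (.imm (.nat 0))) (whileLt i n (.seq c (incr i)))

end Cmd

/-- Operands are named registers or immediate values, never scratch registers, so loading one
operand does not disturb those still to be loaded. The clause about the registers below `j` carries
the values already loaded through the induction. -/
theorem exec_prep {s : Mach P K} (a : List (Opd P K)) : ∀ (j : ℕ) (S : State P K),
    Represents S s → ∃ S', Exec (Cmd.prep j a) S a.length S' ∧ Represents S' s ∧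
      ((List.range' j a.length).map scratch).map S'.reg = a.map (Opd.eval s) ∧
      (∀ i < j, S'.reg (scratch i) = S.reg (scratch i)) ∧ S'.mem = S.mem := by
  induction a with
  | nil => exact fun j S hS => ⟨S, .skip S, hS, rfl, fun _ _ => rfl, rfl⟩
  | cons o a ih =>
    intro j S hS
    obtain ⟨S', h1, h2, h3, h4, h5⟩ := ih (j + 1) _ (hS.setScratch j (o.eval s))
    refine ⟨S', ?_, h2, ?_, fun i hi => ?_, h5⟩
    · rw [List.length_cons, add_comm]
      exact .seq (o.exec_moveTo hS (scratch j)) h1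
    · rw [List.length_cons, List.range'_succ, List.map_cons, List.map_cons, h3, List.map_cons,
        h4 j (by omega)]
      simp [State.setReg]
    · rw [h4 i (by omega)]
      simp [State.setReg, scratch_injective.ne (Nat.ne_of_lt hi)]

/-! ### Proof rules for the derived commands, with running times -/

theorem WP.assign {Q : Mach P K → Prop} {s : Mach P K} {r : Slot} {o : Opd P K}
    (h : Q (s.set r (o.eval s))) : WP (.assign r o) 1 Q s :=
  fun _ hS => ⟨1, _, _, o.exec_moveTo hS r.reg, le_rfl, hS.setReg r _, h⟩

theorem WP.incr {Q : Mach P K → Prop} {s : Mach P K} {r : Slot}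
    (h : Q (s.set r (.nat ((s.env r).toNat + 1)))) : WP (.incr r) 1 Q s := by
  intro S hS
  refine ⟨1, _, _, Exec.succ S r.reg, le_rfl, hS.setReg r _, ?_⟩
  rwa [hS.1]

theorem WP.get {Q : Mach P K → Prop} {s : Mach P K} {r : Slot} {n : ℕ} {a : List (Opd P K)}
    (h : Q (s.set r (s.tab n (a.map (Opd.eval s))))) :
    WP (.get r n a) (2 * a.length + 3) Q s := by
  intro S hS
  obtain ⟨S', h1, h2, h3, -, h5⟩ := exec_prep (.imm (.nat n) :: a) 0 S hS
  refine ⟨_, _, _, .seq h1 (.load S' r.reg _), ?_, h2.setReg r _, ?_⟩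
  · simp; omega
  · rw [List.length_cons] at h3
    rw [h3]
    simpa [h2.2] using h

theorem WP.save {Q : Mach P K → Prop} {s : Mach P K} {n : ℕ} {a : List (Opd P K)} {o : Opd P K}
    (h : Q (s.put n (a.map (Opd.eval s)) (o.eval s))) :
    WP (.save n a o) (2 * a.length + 4) Q s := by
  intro S hS
  obtain ⟨S', h1, h2, h3, h4, h5⟩ := exec_prep (o :: .imm (.nat n) :: a) 0 S hS
  rw [List.length_cons, List.range'_succ, List.map_cons, List.map_cons, List.map_cons,
    List.cons.injEq] at h3
  refine ⟨_, _, _, .seq h1 (.store S' _ _), ?_, ?_, h⟩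
  · simp; omega
  · rw [h3.1, List.length_cons] at *
    rw [h3.2]
    exact h2.setMem n _ _

theorem WP.ifEq {Q : Mach P K → Prop} {s : Mach P K} {o o' : Opd P K} {c d : Cmd P K} {t : ℕ}
    (h : o.eval s = o'.eval s → WP c t Q s) (h' : o.eval s ≠ o'.eval s → WP d t Q s) :
    WP (.ifEq o o' c d) (t + 3) Q s := by
  intro S hS
  obtain ⟨S', h1, h2, h3, h4, h5⟩ := exec_prep [o, o'] 0 S hS
  simp only [List.length_cons, List.length_nil, List.range'_succ, List.range'_zero, List.map_cons,
    List.map_nil, List.cons.injEq, and_true, zero_add] at h3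
  by_cases hb : o.eval s = o'.eval s
  · obtain ⟨u, T, s', k1, k2, k3, k4⟩ := h hb S' h2
    refine ⟨_, T, s', .seq h1 (.ite_true ?_ k1), ?_, k3, k4⟩
    · show S'.reg _ = S'.reg _
      rw [h3.1, h3.2, hb]
    · simp; omega
  · obtain ⟨u, T, s', k1, k2, k3, k4⟩ := h' hb S' h2
    refine ⟨_, T, s', .seq h1 (.ite_false ?_ k1), ?_, k3, k4⟩
    · show ¬ S'.reg _ = S'.reg _
      rwa [h3.1, h3.2]
    · simp; omega

theorem WP.ifLt {Q : Mach P K → Prop} {s : Mach P K} {r r' : Slot} {c d : Cmd P K} {t : ℕ}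
    (h : (s.env r).toNat < (s.env r').toNat → WP c t Q s)
    (h' : ¬ (s.env r).toNat < (s.env r').toNat → WP d t Q s) :
    WP (.ifLt r r' c d) (t + 1) Q s := by
  intro S hS
  by_cases hb : (s.env r).toNat < (s.env r').toNat
  · obtain ⟨u, T, s', k1, k2, k3, k4⟩ := h hb S hS
    refine ⟨_, T, s', .ite_true ?_ k1, by omega, k3, k4⟩
    show (S.reg _).toNat < (S.reg _).toNat
    rwa [hS.1, hS.1]
  · obtain ⟨u, T, s', k1, k2, k3, k4⟩ := h' hb S hS
    refine ⟨_, T, s', .ite_false ?_ k1, by omega, k3, k4⟩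
    show ¬ (S.reg _).toNat < (S.reg _).toNat
    rwa [hS.1, hS.1]

/-- Loops, with an invariant indexed by a bound for the remaining time. -/
theorem WP.whileLt {i n : Slot} {c : Cmd P K} (I : ℕ → Mach P K → Prop)
    (h : ∀ m s, I m s → (s.env i).toNat < (s.env n).toNat →
      ∃ t, WP c t (fun s' => ∃ m', t + 1 + m' ≤ m ∧ I m' s') s)
    {m : ℕ} {s : Mach P K} (hI : I m s) :
    WP (.whileLt i n c) (m + 1)
      (fun s' => ¬ (s'.env i).toNat < (s'.env n).toNat ∧ ∃ m', I m' s') s := by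
  induction m using Nat.strong_induction_on generalizing s with
  | _ m ih =>
  intro S hS
  by_cases hb : (s.env i).toNat < (s.env n).toNat
  · obtain ⟨t, ht⟩ := h m s hI hb
    obtain ⟨u, T, s', k1, k2, k3, m', hm', k4⟩ := ht S hS
    obtain ⟨u', T', s'', l1, l2, l3, l4⟩ := ih m' (by omega) k4 T k3
    refine ⟨_, T', s'', .while_true ?_ k1 l1, by omega, l3, l4⟩
    show (S.reg _).toNat < (S.reg _).toNat
    rwa [hS.1, hS.1]
  · refine ⟨1, S, s, .while_false ?_, by omega, hS, hb, m, hI⟩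
    show ¬ (S.reg _).toNat < (S.reg _).toNat
    rwa [hS.1, hS.1]

/-- Counting loops. -/
theorem WP.forLt {i l : Slot} (hil : i ≠ l) {c : Cmd P K} {n : ℕ} (T : ℕ → ℕ)
    (I : ℕ → Mach P K → Prop) {s : Mach P K} (hl : s.env l = .nat n)
    (h0 : I 0 (s.set i (.nat 0)))
    (h : ∀ j < n, ∀ s, s.env i = .nat j → s.env l = .nat n → I j s →
      WP c (T j) (fun s' => s'.env i = .nat j ∧ s'.env l = .nat n ∧
        I (j + 1) (s'.set i (.nat (j + 1)))) s) :
    WP (.forLt i l c) (∑ j ∈ Finset.range n, (T j + 2) + 2) (I n) s := by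
  have key : WP (Cmd.whileLt i l (.seq c (.incr i))) (∑ j ∈ Finset.Ico 0 n, (T j + 2) + 1) (I n)
      (s.set i (.nat 0)) := by
    -- The time left is the cost of the remaining rounds; the 2 in each round pays for the test and
    -- the increment.
    refine (WP.whileLt (fun m s => ∃ j, j ≤ n ∧ s.env i = .nat j ∧ s.env l = .nat n ∧ I j s ∧
      m = ∑ j ∈ Finset.Ico j n, (T j + 2)) ?_ ⟨0, by omega, by simp, ?_, h0, rfl⟩).mono le_rfl ?_
    · rintro m s ⟨j, hj, hi, hl, hI, rfl⟩ hlt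
      simp only [hi, hl, Val.toNat] at hlt
      refine ⟨T j + 1, WP.seq ((h j hlt s hi hl hI).mono le_rfl ?_)⟩
      rintro s' ⟨h1, h2, h3⟩
      refine WP.incr ⟨∑ j ∈ Finset.Ico (j + 1) n, (T j + 2), ?_, j + 1, hlt, ?_, ?_, ?_, rfl⟩
      · rw [Finset.sum_eq_sum_Ico_succ_bot hlt]
      · simp [h1, Val.toNat]
      · simp [hil.symm, h2]
      · simpa [h1, Val.toNat] using h3
    · simp [hil.symm, hl]
    · rintro s' ⟨h1, m', j, hj, hi, hl, hI, -⟩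
      simp only [hi, hl, Val.toNat] at h1
      rwa [show n = j by omega]
  refine (WP.seq (t := 1) (WP.assign (by simpa using key))).mono ?_ fun _ h => h
  rw [Finset.range_eq_Ico]; omega

/-- Static repetition. -/
def Cmd.seqMap {α : Type*} (l : List α) (c : α → Cmd P K) : Cmd P K :=
  l.foldr (fun x d => .seq (c x) d) .skip

/-- The invariant is indexed by the prefix already executed, so that it can speak about the elements
that have been handled. -/
theorem WP.seqMap {α : Type*} {c : α → Cmd P K} (T : α → ℕ) (I : List α → Mach P K → Prop)
    {l : List α}
    (h : ∀ l₁ x l₂, l = l₁ ++ x :: l₂ → ∀ s, I l₁ s → WP (c x) (T x) (I (l₁ ++ [x])) s)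
    {s : Mach P K} (h0 : I [] s) : WP (.seqMap l c) (l.map T).sum (I l) s := by
  suffices H : ∀ l₂ l₁, l = l₁ ++ l₂ → ∀ s, I l₁ s → WP (.seqMap l₂ c) (l₂.map T).sum (I l) s from
    H l [] rfl s h0
  intro l₂
  induction l₂ with
  | nil => rintro l₁ rfl s hs; exact WP.skip (by simpa using hs)
  | cons x l₂ ih =>
    intro l₁ hl s hs
    exact WP.seq ((h l₁ x l₂ hl s hs).mono le_rfl fun s' hs' => ih (l₁ ++ [x])
      (by simp [hl]) s' hs')

/-- Append the value of `o` to the list whose length is kept in table `n` and whose entries are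
kept in table `m`, both under the key `a`. -/
def Cmd.push (n m : ℕ) (a : List (Opd P K)) (o : Opd P K) : Cmd P K :=
  .seq (.get (.tmp 0) n a) (.seq (.save m (.slot (.tmp 0) :: a) o)
    (.seq (.incr (.tmp 0)) (.save n a (.slot (.tmp 0)))))

/-- The list `l` is kept in the tables `n` (length) and `m` (entries) under the key `a`. -/
def Mach.HasList (s : Mach P K) (n m : ℕ) (a : List (Val P K)) (l : List (Val P K)) : Prop :=
  s.tab n a = .nat l.length ∧ ∀ (i : ℕ) (x : Val P K), l[i]? = some x → s.tab m (.nat i :: a) = x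

/-- The old length is loaded into `tmp 0` before the key and the operand are evaluated again; `ha`
and `ho` express that neither of them depends on this register. -/
theorem WP.push {Q : Mach P K → Prop} {s : Mach P K} {n m : ℕ} {a : List (Opd P K)} {o : Opd P K}
    {k : ℕ} (ha : ∀ x, a.map (Opd.eval (s.set (.tmp 0) x)) = a.map (Opd.eval s))
    (ho : ∀ x, o.eval (s.set (.tmp 0) x) = o.eval s)
    (hk : s.tab n (a.map (Opd.eval s)) = .nat k)
    (h : Q (((s.put m (.nat k :: a.map (Opd.eval s)) (o.eval s)).put n (a.map (Opd.eval s))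
      (.nat (k + 1))).set (.tmp 0) (.nat (k + 1)))) :
    WP (.push n m a o) (6 * a.length + 15) Q s := by
  refine (WP.seq (WP.get (WP.seq (WP.save (WP.seq (WP.incr (WP.save ?_))))))).mono
    (t := 2 * a.length + 3 +
    (2 * (a.length + 1) + 4 + (1 + (2 * a.length + 4)))) (by omega) fun _ h => h
  convert h using 1
  simp only [hk, Opd.eval_slot, List.map_cons, Mach.env_set_self, ho, ha, Mach.env_put, Val.toNat]
  have e : ∀ x y z, (((s.set (.tmp 0) x).put m y z).set (.tmp 0) (.nat (k + 1))) =
      (s.put m y z).set (.tmp 0) (.nat (k + 1)) := by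
    intro x y z
    simp [Mach.set, Mach.put]
  have e' : ∀ y z, a.map (Opd.eval ((s.put m y z).set (.tmp 0) (.nat (k + 1)))) =
      a.map (Opd.eval s) := by
    intro y z
    rw [← ha (.nat (k + 1))]
    refine List.map_congr_left fun o _ => ?_
    cases o <;> simp [Opd.eval, Mach.set, Mach.put]
  rw [e, e']
  simp [Mach.put, Mach.set]

/-! ### Tries in memory -/

/-- Tables outside `T` and registers outside `E` are the same in both states. -/
def Mach.Agree (s s' : Mach P K) (T : Set ℕ) (E : Set Slot) : Prop :=
  (∀ t, t ∉ T → s'.tab t = s.tab t) ∧ ∀ r, r ∉ E → s'.env r = s.env r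

theorem Mach.Agree.refl (s : Mach P K) (T : Set ℕ) (E : Set Slot) : s.Agree s T E :=
  ⟨fun _ _ => rfl, fun _ _ => rfl⟩

theorem Mach.Agree.trans {s s' s'' : Mach P K} {T : Set ℕ} {E : Set Slot} (h : s.Agree s' T E)
    (h' : s'.Agree s'' T E) : s.Agree s'' T E :=
  ⟨fun t ht => (h'.1 t ht).trans (h.1 t ht), fun r hr => (h'.2 r hr).trans (h.2 r hr)⟩

theorem Mach.Agree.mono {s s' : Mach P K} {T T' : Set ℕ} {E E' : Set Slot} (h : s.Agree s' T E)
    (hT : T ⊆ T') (hE : E ⊆ E') : s.Agree s' T' E' :=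
  ⟨fun t ht => h.1 t fun h' => ht (hT h'), fun r hr => h.2 r fun h' => hr (hE h')⟩

theorem Mach.Agree.set (s : Mach P K) {T : Set ℕ} {E : Set Slot} {r : Slot} (hr : r ∈ E)
    (x : Val P K) : s.Agree (s.set r x) T E :=
  ⟨fun _ _ => rfl, fun _ h => Mach.env_set_of_ne _ _ fun e => h (e ▸ hr)⟩

theorem Mach.Agree.put (s : Mach P K) {T : Set ℕ} {E : Set Slot} {n : ℕ} (hn : n ∈ T)
    (a : List (Val P K)) (x : Val P K) : s.Agree (s.put n a x) T E :=
  ⟨fun _ h => Mach.tab_put_of_ne _ _ _ fun e => h (e ▸ hn), fun _ _ => rfl⟩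

theorem Mach.HasList.of_tab {s s' : Mach P K} {n m : ℕ} {a l : List (Val P K)}
    (h : s.HasList n m a l) (hn : s'.tab n = s.tab n) (hm : s'.tab m = s.tab m) :
    s'.HasList n m a l := by
  unfold Mach.HasList
  rw [hn, hm]
  exact h

theorem Mach.HasList.push {s : Mach P K} {n m : ℕ} (hnm : n ≠ m) {a l : List (Val P K)}
    (h : s.HasList n m a l) (x y : Val P K) (r : Slot) :
    (((s.put m (.nat l.length :: a) x).put n a (.nat (l.length + 1))).set r y).HasList n m a
      (l ++ [x]) := by
  refine ⟨by simp, fun i z hz => ?_⟩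
  simp only [Mach.tab_set, Mach.tab_put_of_ne _ _ _ hnm.symm, Mach.tab_put_self,
    Function.update_apply]
  rcases lt_trichotomy i l.length with hi | rfl | hi
  · rw [if_neg (by simp; omega)]
    exact h.2 i z (by rwa [List.getElem?_append_left hi] at hz)
  · simpa using hz
  · rw [List.getElem?_eq_none (by simp; omega)] at hz
    cases hz

theorem Mach.HasList.push_of_ne {s : Mach P K} {n m : ℕ} (hnm : n ≠ m) {a b l : List (Val P K)}
    (hab : a ≠ b) (h : s.HasList n m a l) (k : Val P K) (x y z : Val P K) (r : Slot) :
    (((s.put m (k :: b) x).put n b z).set r y).HasList n m a l := by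
  refine ⟨by simpa [hnm, Function.update_apply, hab] using h.1, fun i w hw => ?_⟩
  simpa [hnm.symm, Function.update_apply, hab] using h.2 i w hw

theorem map_const_injective : Function.Injective (List.map (Val.const (P := P) (K := K))) :=
  List.map_injective_iff.mpr fun _ _ h => by cases h; rfl

/-- The set `X` of non-empty words is kept in the tables 3 to 5 under the number `id`: for every
word, the list of the letters that continue it, and a mark for every member. -/
def Mach.HasTrie (s : Mach P K) (id : ℕ) (X : Set (List K)) : Prop :=
  ∀ k : List K,
    (∃ L : List K, L.Nodup ∧ (∀ v, v ∈ L ↔ k ++ [v] ∈ X) ∧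
      s.HasList 3 4 (.nat id :: k.map .const) (L.map .const)) ∧
    (k ∈ X → s.tab 5 (.nat id :: k.map .const) = .nat 1) ∧
    (k ∉ X → s.tab 5 (.nat id :: k.map .const) = .nat 0)

theorem Mach.HasTrie.of_tab {s s' : Mach P K} {id : ℕ} {X : Set (List K)} (h : s.HasTrie id X)
    (h3 : s'.tab 3 = s.tab 3) (h4 : s'.tab 4 = s.tab 4) (h5 : s'.tab 5 = s.tab 5) :
    s'.HasTrie id X := by
  unfold Mach.HasTrie Mach.HasList
  rw [h3, h4, h5]
  exact h

/-- Add the continuation of the word `a` by the letter `x` to a trie. -/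
def Cmd.insertLetter (id : ℕ) (a : List (Opd P K)) (x : Opd P K) : Cmd P K :=
  .seq (.get (.tmp 1) 5 (.imm (.nat id) :: a ++ [x]))
    (.ifEq (.slot (.tmp 1)) (.imm (.nat 1)) .skip
      (.seq (.save 5 (.imm (.nat id) :: a ++ [x]) (.imm (.nat 1)))
        (.push 3 4 (.imm (.nat id) :: a) x)))

-- A new letter changes the trie `id` in two places only: the continuation list of `k` grows, and `k
-- ++ [v]` gets its mark. Other tries are untouched because every address contains the number of its
-- trie. Both cases are stated together so that they share the same length `n`.
open Classical in
theorem Mach.HasTrie.insert {s : Mach P K} {id : ℕ} {X : Set (List K)} {k : List K} {v : K}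
    (hX : s.HasTrie id X) (hv : k ++ [v] ∉ X) :
    ∃ n : ℕ, s.tab 3 (.nat id :: k.map .const) = .nat n ∧ ∀ r y id' Y,
      id' = id ∧ Y = insert (k ++ [v]) X ∨ id' ≠ id ∧ s.HasTrie id' Y →
      Mach.HasTrie ((((s.put 5 (.nat id :: (k ++ [v]).map .const) (.nat 1)).put 4
        (.nat n :: .nat id :: k.map .const) (.const v)).put 3 (.nat id :: k.map .const)
        (.nat (n + 1))).set r y) id' Y := by
  obtain ⟨L, hL1, hL2, hL3⟩ := (hX k).1
  refine ⟨L.length, by simpa using hL3.1, ?_⟩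
  rintro r y id' Y (⟨rfl, rfl⟩ | ⟨hid, hY⟩) k'
  · refine ⟨?_, fun hk' => ?_, fun hk' => ?_⟩
    · by_cases hk : k' = k
      · subst hk
        refine ⟨L ++ [v], ?_, fun w => ?_, ?_⟩
        · rw [List.nodup_append]
          refine ⟨hL1, by simp, ?_⟩
          intro a ha b hb e
          simp only [List.mem_singleton] at hb
          subst hb; subst e
          exact hv ((hL2 _).1 ha)
        · simp [hL2, or_comm]
        · have := (hL3.of_tab (s' := s.put 5 (.nat id' :: (k' ++ [v]).map .const) (.nat 1))
            (by simp) (by simp)).push (by decide) (.const v) y r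
          simpa using this
      · obtain ⟨L', h1, h2, h3⟩ := (hX k').1
        refine ⟨L', h1, fun w => ?_, ?_⟩
        · rw [h2, Set.mem_insert_iff]
          refine ⟨Or.inr, fun h => h.resolve_left fun e => hk ?_⟩
          exact List.append_inj_left' e rfl
        · refine (h3.of_tab (s' := s.put 5 _ (.nat 1)) (by simp) (by simp)).push_of_ne
            (by decide) ?_ _ _ _ _ _
          simpa using fun h => hk (map_const_injective h)
    · by_cases hk : k' = k ++ [v]
      · subst hk; simp
      · have hne : Val.nat (P := P) id' :: k'.map Val.const ≠
            .nat id' :: (k ++ [v]).map Val.const :=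
          fun h => hk (map_const_injective (List.cons.inj h).2)
        simpa [Function.update_apply, hne] using
          fun _ => (hX k').2.1 (hk'.resolve_left hk)
    · have hk : k' ≠ k ++ [v] := fun h => hk' (Or.inl h)
      have hne : Val.nat (P := P) id' :: k'.map Val.const ≠
          .nat id' :: (k ++ [v]).map Val.const :=
        fun h => hk (map_const_injective (List.cons.inj h).2)
      rw [Mach.tab_set, Mach.tab_put_of_ne _ _ _ (by decide), Mach.tab_put_of_ne _ _ _ (by decide),
        Mach.tab_put_self, Function.update_of_ne hne]
      exact (hX k').2.2 fun h => hk' (Or.inr h)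
  · obtain ⟨⟨L', h1, h2, h3⟩, h4, h5⟩ := hY k'
    refine ⟨⟨L', h1, h2, ?_⟩, ?_, ?_⟩
    · exact (h3.of_tab (s' := s.put 5 _ (.nat 1)) (by simp) (by simp)).push_of_ne
        (by decide) (by simp [hid]) _ _ _ _ _
    · simpa [Function.update_apply, hid] using h4
    · simpa [Function.update_apply, hid] using h5

/-- The mark in table 5 tells whether the continuation is already present, so continuation lists
stay free of duplicates and are never scanned during insertion. -/
theorem WP.insertLetter {s : Mach P K} {id : ℕ} {X : Set (List K)} {k : List K} {v : K}
    {a : List (Opd P K)} {x : Opd P K} (hX : s.HasTrie id X)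
    (ha : a.map (Opd.eval s) = k.map .const) (ha' : ∀ o ∈ a, o.NoTmp)
    (hx : x.eval s = .const v) (hx' : x.NoTmp) :
    WP (.insertLetter id a x) (10 * a.length + 50)
      (fun s' => s'.HasTrie id (insert (k ++ [v]) X) ∧
        (∀ id' ≠ id, ∀ Y, s.HasTrie id' Y → s'.HasTrie id' Y) ∧
        s.Agree s' {3, 4, 5} {.tmp 0, .tmp 1}) s := by
  have hget : s.tab 5 ((.imm (.nat id) :: a ++ [x]).map (Opd.eval s)) =
      s.tab 5 (.nat id :: (k ++ [v]).map .const) := by simp [ha, hx]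
  refine (WP.seq (WP.get (WP.ifEq (t := (2 * (a.length + 2) + 4 + (6 * (a.length + 1) + 15)))
    (fun h => (WP.skip ?_).mono (by omega) fun _ h => h)
    (fun h => WP.seq ((WP.save ?_).mono (by simp) fun _ h => h))))).mono (by simp; omega)
      fun _ h => h
  · have hk : k ++ [v] ∈ X := by
      by_contra hk
      rw [hget, (hX (k ++ [v])).2.2 hk] at h
      simp at h
    rw [Set.insert_eq_of_mem hk]
    exact ⟨hX.of_tab rfl rfl rfl, fun id' _ Y hY => hY.of_tab rfl rfl rfl,
      Mach.Agree.set _ (by simp) _⟩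
  · have hk : k ++ [v] ∉ X := by
      intro hk
      rw [hget, (hX (k ++ [v])).2.1 hk] at h
      simp at h
    obtain ⟨n, hn, H⟩ := (hX.of_tab (s' := s.set (.tmp 1) (.nat 0)) rfl rfl rfl).insert hk
    rw [hget, (hX _).2.2 hk]
    have hax : ∀ o ∈ .imm (.nat id) :: a ++ [x], o.NoTmp := by
      intro o ho
      simp only [List.cons_append, List.mem_cons, List.mem_append, List.not_mem_nil, or_false] at ho
      rcases ho with h | h | h
      · subst h; exact fun n h => by cases h
      · exact ha' o h
      · subst h; exact hx'
    have e1 : (.imm (.nat id) :: a).map (Opd.eval s) = .nat id :: k.map .const := by simp [ha]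
    have e2 : (.imm (.nat id) :: a ++ [x]).map (Opd.eval s) =
      .nat id :: (k ++ [v]).map .const := by simp [ha, hx]
    have ha1 : ∀ o ∈ .imm (.nat id) :: a, o.NoTmp := fun o ho => hax o (by
      simp only [List.cons_append, List.mem_cons, List.mem_append] at ho ⊢; tauto)
    refine (WP.push (k := n) (fun y => ?_) (fun y => hx'.eval_set _ _ _) ?_ ?_).mono (by simp)
      fun _ h => h
    · rw [Opd.map_eval_set_tmp ha1]
    · simp only [Opd.map_eval_put, Opd.map_eval_set_tmp ha1, e1]
      simpa using hn
    · simp only [Opd.map_eval_put, Opd.map_eval_set_tmp ha1, Opd.map_eval_set_tmp hax, e1, e2,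
        Opd.eval_put, hx'.eval_set, hx, Opd.eval_imm]
      refine ⟨H _ _ _ _ (.inl ⟨rfl, rfl⟩), fun id' hid Y hY => H _ _ _ _
        (.inr ⟨hid, hY.of_tab rfl rfl rfl⟩), ?_⟩
      exact ((((Mach.Agree.set _ (by simp) _).trans (Mach.Agree.put _ (by simp) _ _)).trans
        (Mach.Agree.put _ (by simp) _ _)).trans (Mach.Agree.put _ (by simp) _ _)).trans
        (Mach.Agree.set _ (by simp) _)

/-! ### Building the trie of an edge of a join -/

/-- A relation, some columns of which are named by variables. -/
structure JoinEdge {P : Type u} (ar : P → ℕ) where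
  rel : P
  col : ℕ → Option (Fin (ar rel))

/-- The values of those variables in `vs` that name a column. -/
def JoinEdge.key {β : Type*} (e : JoinEdge ar) (α : ℕ → β) (vs : List ℕ) : List β :=
  vs.filterMap fun y => (e.col y).map fun _ => α y

/-- The entries of a tuple in the columns named by variables in `vs`. -/
def JoinEdge.word {β : Type*} (e : JoinEdge ar) (t : Fin (ar e.rel) → β) (vs : List ℕ) : List β :=
  vs.filterMap fun y => (e.col y).map t

/-- The words of the trie of an edge: all non-empty prefixes of tuples. -/
def JoinEdge.words (e : JoinEdge ar) (V : List ℕ) (ts : List (Fin (ar e.rel) → K)) :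
    Set (List K) :=
  {u | u ≠ [] ∧ ∃ t ∈ ts, u <+: e.word t V}

def varOpd (y : ℕ) : Opd P K := .slot (.var y)

/-- Variables without a column are skipped when the command is built. The register of a variable
receives the entry of the tuple, and the registers of `done` then form the word to be continued. -/
def Cmd.insertTuple (id : ℕ) (e : JoinEdge ar) : List ℕ → List ℕ → Cmd P K
  | _, [] => .skip
  | done, x :: rest =>
    match e.col x with
    | none => insertTuple id e (done ++ [x]) rest
    | some i =>
      .seq (.get (.var x) 1 [.imm (.pred e.rel), .slot (.idx 0), .imm (.nat i)])
        (.seq (.insertLetter id (e.key varOpd done) (varOpd x))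
          (insertTuple id e (done ++ [x]) rest))

def Cmd.buildTrie (id : ℕ) (e : JoinEdge ar) (V : List ℕ) : Cmd P K :=
  .seq (.get (.lim 0) 0 [.imm (.pred e.rel)])
    (.forLt (.idx 0) (.lim 0) (insertTuple id e [] V))

theorem JoinEdge.length_key_le {β : Type*} (e : JoinEdge ar) (α : ℕ → β) (vs : List ℕ) :
    (e.key α vs).length ≤ vs.length := List.length_filterMap_le _ _

theorem JoinEdge.noTmp_key (e : JoinEdge ar) (vs : List ℕ) :
    ∀ o ∈ e.key (varOpd (P := P) (K := K)) vs, o.NoTmp := by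
  intro o ho n h
  simp only [key, List.mem_filterMap, Option.map_eq_some_iff] at ho
  obtain ⟨y, -, i, -, rfl⟩ := ho
  cases h

theorem JoinEdge.map_key {β γ : Type*} (e : JoinEdge ar) (α : ℕ → β) (f : β → γ) (vs : List ℕ) :
    (e.key α vs).map f = e.key (fun y => f (α y)) vs := by
  simp only [key, List.map_filterMap, Option.map_map]
  rfl

theorem JoinEdge.key_eq_word {β : Type*} (e : JoinEdge ar) {α : ℕ → β} {t : Fin (ar e.rel) → β}
    {vs : List ℕ} (h : ∀ y ∈ vs, ∀ i, e.col y = some i → α y = t i) :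
    e.key α vs = e.word t vs := by
  refine List.filterMap_congr fun y hy => ?_
  cases hc : e.col y with
  | none => rfl
  | some i => simp [h y hy i hc]

theorem JoinEdge.key_congr {β : Type*} (e : JoinEdge ar) {α α' : ℕ → β}
    {vs : List ℕ} (h : ∀ y ∈ vs, e.col y ≠ none → α y = α' y) :
    e.key α vs = e.key α' vs := by
  refine List.filterMap_congr fun y hy => ?_
  cases hc : e.col y with
  | none => rfl
  | some i => simp [h y hy (by simp [hc])]

/-- When one more column is read, the word of the tuple has exactly one new prefix, namely the
extended word itself; inserting a single letter restores the invariant. -/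
theorem WP.insertTuple {id : ℕ} {e : JoinEdge ar} {t : Fin (ar e.rel) → K} {j : ℕ}
    {X : Set (List K)} (V : List ℕ) (hV : V.Nodup) : ∀ (rest done : List ℕ), V = done ++ rest →
    ∀ s : Mach P K, s.env (.idx 0) = .nat j →
      (∀ i : Fin (ar e.rel), s.tab 1 [.pred e.rel, .nat j, .nat i] = .const (t i)) →
      (∀ y ∈ done, ∀ i, e.col y = some i → s.env (.var y) = .const (t i)) →
      s.HasTrie id (X ∪ {u | u ≠ [] ∧ u <+: e.word t done}) →
      WP (.insertTuple id e done rest) (rest.length * (10 * V.length + 59))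
        (fun s' => s'.HasTrie id (X ∪ {u | u ≠ [] ∧ u <+: e.word t V}) ∧
          (∀ id' ≠ id, ∀ Y, s.HasTrie id' Y → s'.HasTrie id' Y) ∧
          s.Agree s' {3, 4, 5} ({.tmp 0, .tmp 1} ∪ Set.range Slot.var)) s := by
  intro rest
  induction rest with
  | nil =>
    rintro done rfl s - - - hX
    refine (WP.skip ⟨?_, fun _ _ _ h => h, .refl _ _ _⟩).mono (by simp) fun _ h => h
    simpa using hX
  | cons x rest ih =>
    intro done hd s hj ht hreg hX
    simp only [Cmd.insertTuple]
    have hx : x ∉ done := by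
      rw [hd, List.nodup_append] at hV
      exact fun h => hV.2.2 x h x (by simp) rfl
    cases hc : e.col x with
    | none =>
      refine (ih (done ++ [x]) (by simp [hd]) s hj ht ?_ ?_).mono
        (Nat.mul_le_mul_right _ (by simp)) fun _ h => h
      · intro y hy i hi
        simp only [List.mem_append, List.mem_singleton] at hy
        rcases hy with hy | rfl
        · exact hreg y hy i hi
        · simp [hc] at hi
      · simpa [JoinEdge.word, hc] using hX
    | some i =>
      have hlen : (e.key (varOpd (P := P) (K := K)) done).length ≤ V.length := by
        refine (e.length_key_le _ _).trans ?_
        simp [hd]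
      have hw : e.word t (done ++ [x]) = e.word t done ++ [t i] := by
        simp [JoinEdge.word, hc]
      have hr : ∀ y ∈ done ++ [x], ∀ i', e.col y = some i' →
          (s.set (.var x) (.const (t i))).env (.var y) = .const (t i') := by
        intro y hy i' hi'
        simp only [List.mem_append, List.mem_singleton] at hy
        by_cases hyx : y = x
        · subst hyx
          rw [hc] at hi'
          cases hi'
          simp
        · rw [Mach.env_set_of_ne _ _ (by simpa using hyx)]
          exact hreg y (hy.resolve_right hyx) i' hi'
      have hget : s.tab 1 ([.imm (.pred e.rel), .slot (.idx 0), .imm (.nat i)].map (Opd.eval s)) =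
          .const (t i) := by simp [hj, ht]
      have main : WP (.seq (.insertLetter id (e.key varOpd done) (varOpd x))
          (.insertTuple id e (done ++ [x]) rest))
          (10 * V.length + 50 + rest.length * (10 * V.length + 59))
          (fun s' => s'.HasTrie id (X ∪ {u | u ≠ [] ∧ u <+: e.word t V}) ∧
            (∀ id' ≠ id, ∀ Y, s.HasTrie id' Y → s'.HasTrie id' Y) ∧
            s.Agree s' {3, 4, 5} ({.tmp 0, .tmp 1} ∪ Set.range Slot.var))
          (s.set (.var x) (.const (t i))) := by
        refine WP.seq (t := 10 * V.length + 50) ((WP.insertLetter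
          (s := s.set (.var x) (.const (t i))) (k := e.word t done) (v := t i) (x := varOpd x)
          (hX.of_tab rfl rfl rfl) ?_ (e.noTmp_key done) (by simp [varOpd])
          (fun n h => by simp [varOpd] at h)).mono
            (by omega) ?_)
        -- An assignment read off from the tuple presents the word as a key, which can be compared
        -- with the registers; its values at variables without a column are irrelevant.
        · rw [e.map_key, ← e.key_eq_word (α := fun y => if h : ∃ i, e.col y = some i then
            t h.choose else t i), e.map_key]
          · refine e.key_congr fun y hy hc => ?_
            obtain ⟨i', hi'⟩ := Option.ne_none_iff_exists'.1 hc
            have h : ∃ i, e.col y = some i := ⟨i', hi'⟩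
            rw [dif_pos h]
            exact hr y (by simp [hy]) _ h.choose_spec
          · intro y hy i' hi'
            have h : ∃ i, e.col y = some i := ⟨i', hi'⟩
            rw [dif_pos h, Option.some_injective _ (h.choose_spec.symm.trans hi')]
        · rintro s' ⟨h1, h2, h3⟩
          refine (ih (done ++ [x]) (by simp [hd]) s' ?_ ?_ ?_ ?_).mono le_rfl ?_
          · rw [h3.2 _ (by simp)]; simpa using hj
          · intro i'; rw [h3.1 _ (by simp)]; exact ht i'
          · intro y hy i' hi'
            rw [h3.2 _ (by simp)]
            exact hr y hy i' hi'
          · convert h1 using 1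
            ext u
            rw [hw]
            simp only [Set.mem_union, Set.mem_ofPred_eq, Set.mem_insert_iff, List.prefix_concat_iff]
            have : u = e.word t done ++ [t i] → u ≠ [] := by rintro rfl; simp
            tauto
          · rintro s'' ⟨k1, k2, k3⟩
            refine ⟨k1, fun id' hid Y hY => k2 id' hid Y (h2 id' hid Y (hY.of_tab rfl rfl rfl)), ?_⟩
            exact (Mach.Agree.set _ (by simp) _).trans
              ((h3.mono le_rfl Set.subset_union_left).trans k3)
      refine (WP.seq (WP.get (by rw [hget]; exact main))).mono ?_ fun _ h => h
      simp only [List.length_cons, List.length_nil]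
      ring_nf
      omega

theorem WP.buildTrie {id : ℕ} {e : JoinEdge ar} {V : List ℕ} (hV : V.Nodup)
    {ts : List (Fin (ar e.rel) → K)} {s : Mach P K} (h0 : s.tab 0 [.pred e.rel] = .nat ts.length)
    (h1 : ∀ (j : Fin ts.length) (i : Fin (ar e.rel)),
      s.tab 1 [.pred e.rel, .nat j, .nat i] = .const (ts.get j i)) (hX : s.HasTrie id ∅) :
    WP (.buildTrie id e V) (ts.length * (V.length * (10 * V.length + 59) + 2) + 7)
      (fun s' => s'.HasTrie id (e.words V ts) ∧
        (∀ id' ≠ id, ∀ Y, s.HasTrie id' Y → s'.HasTrie id' Y) ∧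
        s.Agree s' {3, 4, 5} ({.tmp 0, .tmp 1, .idx 0, .lim 0} ∪ Set.range Slot.var)) s := by
  have hloop := WP.forLt (i := .idx 0) (l := .lim 0) (by simp) (c := Cmd.insertTuple id e [] V)
    (n := ts.length) (fun _ => V.length * (10 * V.length + 59))
    (fun j s' => s'.HasTrie id (e.words V (ts.take j)) ∧
        (∀ id' ≠ id, ∀ Y, s.HasTrie id' Y → s'.HasTrie id' Y) ∧
        s.Agree s' {3, 4, 5} ({.tmp 0, .tmp 1, .idx 0, .lim 0} ∪ Set.range Slot.var))
    (s := s.set (.lim 0) (.nat ts.length)) (by simp) ?_ ?_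
  · refine (WP.seq (WP.get (by simpa [h0] using hloop))).mono ?_ ?_
    · simp only [List.length_cons, List.length_nil]
      omega
    · rintro s' ⟨k1, k2, k3⟩
      exact ⟨by simpa using k1, k2, k3⟩
  · refine ⟨?_, fun _ _ Y hY => hY.of_tab rfl rfl rfl,
      (Mach.Agree.set _ (by simp) _).trans (Mach.Agree.set _ (by simp) _)⟩
    simpa [JoinEdge.words] using hX.of_tab (s' := (s.set (.lim 0) (.nat ts.length)).set (.idx 0)
      (.nat 0)) rfl rfl rfl
  · rintro j hj s1 hi hl ⟨k1, k2, k3⟩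
    refine (WP.insertTuple (t := ts[j]) (X := e.words V (ts.take j)) V hV V [] rfl s1 hi ?_
      (by simp) ?_).mono le_rfl ?_
    · intro i
      rw [k3.1 _ (by simp)]
      exact h1 ⟨j, hj⟩ i
    · convert k1 using 1
      ext u
      simp only [JoinEdge.word, List.filterMap_nil, Set.mem_union, Set.mem_ofPred_eq,
        List.prefix_nil]
      tauto
    · rintro s' ⟨l1, l2, l3⟩
      refine ⟨by rw [l3.2 _ (by simp), hi], by rw [l3.2 _ (by simp), hl], ?_, ?_, ?_⟩
      · refine Mach.HasTrie.of_tab (s := s') ?_ rfl rfl rfl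
        convert l1 using 1
        ext u
        simp only [JoinEdge.words, List.take_add_one, List.getElem?_eq_getElem hj,
          Option.toList_some, List.mem_append, List.mem_singleton, Set.mem_ofPred_eq,
          Set.mem_union]
        constructor
        · rintro ⟨hu, t, ht | rfl, h⟩
          exacts [.inl ⟨hu, t, ht, h⟩, .inr ⟨hu, h⟩]
        · rintro (⟨hu, t, ht, h⟩ | ⟨hu, h⟩)
          exacts [⟨hu, t, .inl ht, h⟩, ⟨hu, _, .inr rfl, h⟩]
      · exact fun id' hid Y hY => (l2 id' hid Y (k2 id' hid Y hY)).of_tab rfl rfl rfl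
      · refine k3.trans ((l3.mono le_rfl ?_).trans (Mach.Agree.set _ (by simp) _))
        exact Set.union_subset_union_left _ (by intro x; simp; tauto)

end

/-! ### The number of steps of a worst-case optimal join -/

/-- Hölder's inequality for exponents with sum `W ≥ 1`. Divided by `S k`, all values lie between 0
and 1, so passing from the exponent `w k` to `w k / W` can only increase the powers. The weighted
inequality of arithmetic and geometric means then bounds each product by an average, and the
averages sum to at most 1. -/
theorem sum_prod_rpow_le {ι β : Type*} (s : Finset β) (F : Finset ι) (f : ι → β → ℝ) (w S : ι → ℝ)
    (hf : ∀ k ∈ F, ∀ v ∈ s, 0 ≤ f k v) (hw : ∀ k ∈ F, 0 ≤ w k) (h1 : 1 ≤ ∑ k ∈ F, w k)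
    (hS : ∀ k ∈ F, 0 < S k) (hfS : ∀ k ∈ F, ∑ v ∈ s, f k v ≤ S k) :
    ∑ v ∈ s, ∏ k ∈ F, f k v ^ w k ≤ ∏ k ∈ F, S k ^ w k := by
  set W := ∑ k ∈ F, w k with hW
  have hWpos : 0 < W := by linarith
  have hle : ∀ k ∈ F, ∀ v ∈ s, f k v / S k ≤ 1 := fun k hk v hv =>
    (div_le_one (hS k hk)).2 ((Finset.single_le_sum (fun v hv => hf k hk v hv) hv).trans (hfS k hk))
  have h0 : ∀ k ∈ F, ∀ v ∈ s, 0 ≤ f k v / S k := fun k hk v hv =>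
    div_nonneg (hf k hk v hv) (hS k hk).le
  have hpt : ∀ v ∈ s, ∏ k ∈ F, f k v ^ w k ≤
      (∏ k ∈ F, S k ^ w k) * ∑ k ∈ F, w k / W * (f k v / S k) := by
    intro v hv
    have e : ∏ k ∈ F, f k v ^ w k = (∏ k ∈ F, S k ^ w k) * ∏ k ∈ F, (f k v / S k) ^ w k := by
      rw [← Finset.prod_mul_distrib]
      refine Finset.prod_congr rfl fun k hk => ?_
      rw [← Real.mul_rpow (hS k hk).le (h0 k hk v hv), mul_div_cancel₀ _ (hS k hk).ne']
    rw [e]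
    refine mul_le_mul_of_nonneg_left ?_
      (Finset.prod_nonneg fun k hk => Real.rpow_nonneg (hS k hk).le _)
    calc ∏ k ∈ F, (f k v / S k) ^ w k ≤ ∏ k ∈ F, (f k v / S k) ^ (w k / W) := by
          refine Finset.prod_le_prod (fun k hk => Real.rpow_nonneg (h0 k hk v hv) _) fun k hk => ?_
          exact Real.rpow_le_rpow_of_exponent_ge' (h0 k hk v hv) (hle k hk v hv)
            (div_nonneg (hw k hk) hWpos.le) (div_le_self (hw k hk) h1)
      _ ≤ ∑ k ∈ F, w k / W * (f k v / S k) :=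
          Real.geom_mean_le_arith_mean_weighted _ _ _ (fun k hk => div_nonneg (hw k hk) hWpos.le)
            (by rw [← Finset.sum_div, ← hW, div_self hWpos.ne']) fun k hk => h0 k hk v hv
  refine (Finset.sum_le_sum hpt).trans ?_
  rw [← Finset.mul_sum, Finset.sum_comm]
  refine mul_le_of_le_one_right
    (Finset.prod_nonneg fun k hk => Real.rpow_nonneg (hS k hk).le _) ?_
  calc ∑ k ∈ F, ∑ v ∈ s, w k / W * (f k v / S k) ≤ ∑ k ∈ F, w k / W := by
        refine Finset.sum_le_sum fun k hk => ?_
        rw [← Finset.mul_sum, ← Finset.sum_div]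
        exact mul_le_of_le_one_right (div_nonneg (hw k hk) hWpos.le)
          ((div_le_one (hS k hk)).2 (hfS k hk))
    _ = 1 := by rw [← Finset.sum_div, ← hW, div_self hWpos.ne']

theorem sum_length_filter_le {β γ : Type*} [DecidableEq β] (s : Finset β) (l : List γ) (f : γ → β) :
    ∑ v ∈ s, (l.filter fun t => f t = v).length ≤ l.length := by
  induction l with
  | nil => simp
  | cons a l ih =>
    have : ∀ v, ((a :: l).filter fun t => f t = v).length =
        (l.filter fun t => f t = v).length + if f a = v then 1 else 0 := by
      intro v
      by_cases h : f a = v <;> simp [h]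
    simp only [this, Finset.sum_add_distrib, Finset.sum_ite_eq, List.length_cons]
    split_ifs <;> omega

section

variable {P : Type u} {ar : P → ℕ} {K : Type v}

/-- The tuple `t` agrees with `α` on the variables in `vs`. -/
def JoinEdge.Fits (e : JoinEdge ar) (α : ℕ → K) (vs : List ℕ) (t : Fin (ar e.rel) → K) : Prop :=
  ∀ y ∈ vs, ∀ i, e.col y = some i → α y = t i

open Classical in
/-- The number of tuples that agree with `α` on the variables in `vs`. -/
noncomputable def JoinEdge.count (e : JoinEdge ar) (D : Database ar K) (α : ℕ → K)
    (vs : List ℕ) : ℕ :=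
  ((D.rel e.rel).filter (e.Fits α vs)).length

open Classical in
/-- The values for `x` that extend the restriction of `α` to the variables in `vs`. -/
noncomputable def JoinEdge.ext (e : JoinEdge ar) (D : Database ar K) (α : ℕ → K) (vs : List ℕ)
    (x : ℕ) : Finset K :=
  (((D.rel e.rel).filter (e.Fits α vs)).filterMap fun t => (e.col x).map t).toFinset

theorem JoinEdge.mem_ext {e : JoinEdge ar} {D : Database ar K} {α : ℕ → K} {vs : List ℕ} {x : ℕ}
    {v : K} : v ∈ e.ext D α vs x ↔
      ∃ t ∈ D.rel e.rel, e.Fits α vs t ∧ ∃ i, e.col x = some i ∧ t i = v := by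
  classical
  simp [ext, and_assoc]

theorem JoinEdge.card_ext_le (e : JoinEdge ar) (D : Database ar K) (α : ℕ → K) (vs : List ℕ)
    (x : ℕ) : (e.ext D α vs x).card ≤ e.count D α vs := by
  classical exact (List.toFinset_card_le _).trans (List.length_filterMap_le _ _)

theorem JoinEdge.fits_update {e : JoinEdge ar} {α : ℕ → K} {vs : List ℕ} {x : ℕ} (hx : x ∉ vs)
    {v : K} {t : Fin (ar e.rel) → K} : e.Fits (Function.update α x v) (vs ++ [x]) t ↔
      e.Fits α vs t ∧ ∀ i, e.col x = some i → v = t i := by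
  simp only [Fits, List.mem_append, List.mem_singleton]
  constructor
  · refine fun h => ⟨fun y hy i hi => ?_, fun i hi => by simpa using h x (.inr rfl) i hi⟩
    have hyx : y ≠ x := fun e => hx (e ▸ hy)
    simpa [hyx] using h y (.inl hy) i hi
  · rintro ⟨h1, h2⟩ y (hy | rfl) i hi
    · have hyx : y ≠ x := fun e => hx (e ▸ hy)
      simpa [hyx] using h1 y hy i hi
    · simpa using h2 i hi

theorem JoinEdge.count_update_of_none {e : JoinEdge ar} {D : Database ar K} {α : ℕ → K}
    {vs : List ℕ} {x : ℕ} (hx : x ∉ vs) (hc : e.col x = none) (v : K) :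
    e.count D (Function.update α x v) (vs ++ [x]) = e.count D α vs := by
  refine congrArg _ (List.filter_congr fun t _ => ?_)
  simp [fits_update hx, hc]

/-- The tuples that agree with `α` are split according to their entry in the column of `x`, and
different values give disjoint parts. -/
theorem JoinEdge.sum_count_update_le {e : JoinEdge ar} {D : Database ar K} {α : ℕ → K}
    {vs : List ℕ} {x : ℕ} (hx : x ∉ vs) (hc : e.col x ≠ none) (s : Finset K) :
    ∑ v ∈ s, e.count D (Function.update α x v) (vs ++ [x]) ≤ e.count D α vs := by
  classical
  obtain ⟨i, hi⟩ := Option.ne_none_iff_exists'.1 hc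
  refine le_trans (Finset.sum_le_sum fun v _ => ?_)
    (sum_length_filter_le s ((D.rel e.rel).filter (e.Fits α vs)) fun t => t i)
  rw [List.filter_filter, count]
  refine le_of_eq (congrArg _ (List.filter_congr fun t _ => ?_))
  simp [fits_update hx, hi, and_comm, eq_comm]

theorem JoinEdge.one_le_count_update {e : JoinEdge ar} {D : Database ar K} {α : ℕ → K}
    {vs : List ℕ} {x : ℕ} (hx : x ∉ vs) {v : K} (hv : v ∈ e.ext D α vs x) :
    1 ≤ e.count D (Function.update α x v) (vs ++ [x]) := by
  classical
  obtain ⟨t, ht, h1, i, hi, rfl⟩ := mem_ext.1 hv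
  refine List.length_pos_of_mem (a := t) (List.mem_filter.2 ⟨ht, ?_⟩)
  simp only [decide_eq_true_eq, fits_update hx]
  exact ⟨h1, fun i' hi' => by rw [hi] at hi'; cases hi'; rfl⟩

variable (J : ℕ → JoinEdge ar) (D : Database ar K) (E : Finset ℕ)

open Classical in
/-- The values for `x` that extend the restriction of `α` to the variables in `vs` in all edges. -/
noncomputable def common (α : ℕ → K) (vs : List ℕ) (x : ℕ) : Finset K :=
  (E.biUnion fun k => (J k).ext D α vs x).filter fun v =>
    ∀ k ∈ E, (J k).col x ≠ none → v ∈ (J k).ext D α vs x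

/-- The number of steps of a search for the assignments to the variables in `rest` that extend
the restriction of `α` to `vs`. -/
noncomputable def joinWork : List ℕ → List ℕ → (ℕ → K) → ℕ
  | _, [], _ => 1
  | vs, x :: rest, α =>
    1 + sInf {n | ∃ k ∈ E, (J k).col x ≠ none ∧ n = ((J k).ext D α vs x).card} +
      ∑ v ∈ common J D E α vs x, joinWork (vs ++ [x]) rest (Function.update α x v)

variable {J D E}

theorem mem_common {α : ℕ → K} {vs : List ℕ} {x : ℕ} {v : K} : v ∈ common J D E α vs x ↔
    (∃ k ∈ E, v ∈ (J k).ext D α vs x) ∧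
      ∀ k ∈ E, (J k).col x ≠ none → v ∈ (J k).ext D α vs x := by
  classical
  simp [common]

/-- Induction on the remaining variables, with the product on the right as potential `B`. At the
variable `x` the smallest candidate list has length at most `B`, because the weights of the edges at
`x` sum to at least 1, and the potentials of the recursive calls sum to at most `B` by
`sum_prod_rpow_le`. The node itself and the scan thus add at most `2 * B` for each variable. The
maximum with 1 makes all factors at least 1, so that factors can be dropped. -/
theorem joinWork_le {w : ℕ → ℝ} (hw : ∀ k ∈ E, 0 ≤ w k) (rest : List ℕ) :
    ∀ (vs : List ℕ) (α : ℕ → K), (vs ++ rest).Nodup →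
    (∀ x ∈ rest, 1 ≤ ∑ k ∈ E with (J k).col x ≠ none, w k) →
    (joinWork J D E vs rest α : ℝ) ≤
      (2 * rest.length + 1) * ∏ k ∈ E, (max 1 ((J k).count D α vs : ℝ)) ^ w k := by
  have hone : ∀ (α : ℕ → K) (vs) (F : Finset ℕ), F ⊆ E →
      1 ≤ ∏ k ∈ F, (max 1 ((J k).count D α vs : ℝ)) ^ w k := by
    intro α vs F hF
    exact Finset.one_le_prod fun k hk => Real.one_le_rpow (le_max_left _ _) (hw k (hF hk))
  induction rest with
  | nil => intro vs α _ _; simpa [joinWork] using hone α vs E le_rfl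
  | cons x rest ih =>
    intro vs α hnd hcov
    have hx : x ∉ vs := by
      rw [List.nodup_append] at hnd
      exact fun h => hnd.2.2 x h x (by simp) rfl
    have hcx := hcov x (by simp)
    set F := E.filter fun k => (J k).col x ≠ none with hF
    set G := E.filter fun k => ¬ (J k).col x ≠ none with hG
    have hsplit : ∀ g : ℕ → ℝ, ∏ k ∈ E, g k = (∏ k ∈ F, g k) * ∏ k ∈ G, g k :=
      fun g => (Finset.prod_filter_mul_prod_filter_not E _ g).symm
    set B := ∏ k ∈ E, (max 1 ((J k).count D α vs : ℝ)) ^ w k with hB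
    have hBF : ∏ k ∈ F, (max 1 ((J k).count D α vs : ℝ)) ^ w k ≤ B := by
      rw [hB, hsplit]
      exact le_mul_of_one_le_right (zero_le_one.trans (hone α vs F (Finset.filter_subset _ _)))
        (hone α vs G (Finset.filter_subset _ _))
    have hB1 : 1 ≤ B := hone α vs E le_rfl
    have hmin : (sInf {n | ∃ k ∈ E, (J k).col x ≠ none ∧ n = ((J k).ext D α vs x).card} : ℕ) ≤
        B := by
      set m := sInf {n | ∃ k ∈ E, (J k).col x ≠ none ∧ n = ((J k).ext D α vs x).card} with hm
      rcases Nat.eq_zero_or_pos m with h0 | hpos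
      · rw [h0]; push_cast; linarith
      · have hle : ∀ k ∈ F, (m : ℝ) ≤ max 1 ((J k).count D α vs : ℝ) := by
          intro k hk
          rw [hF, Finset.mem_filter] at hk
          refine le_max_of_le_right (Nat.cast_le.2 ((Nat.sInf_le ?_).trans
            ((J k).card_ext_le D α vs x)))
          exact ⟨k, hk.1, hk.2, rfl⟩
        refine le_trans ?_ hBF
        have hm1 : (1 : ℝ) ≤ m := by exact_mod_cast hpos
        calc (m : ℝ) = (m : ℝ) ^ (1 : ℝ) := (Real.rpow_one _).symm
          _ ≤ (m : ℝ) ^ (∑ k ∈ F, w k) := Real.rpow_le_rpow_of_exponent_le hm1 hcx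
          _ = ∏ k ∈ F, (m : ℝ) ^ w k := Real.rpow_sum_of_pos (by linarith) _ _
          _ ≤ _ := Finset.prod_le_prod (fun k _ => Real.rpow_nonneg (by linarith) _)
              fun k hk => Real.rpow_le_rpow (by linarith) (hle k hk)
                (hw k (Finset.mem_of_mem_filter k hk))
    have hsum : ∑ v ∈ common J D E α vs x, ∏ k ∈ E,
        (max 1 ((J k).count D (Function.update α x v) (vs ++ [x]) : ℝ)) ^ w k ≤ B := by
      -- For a common value each edge at `x` keeps a tuple, so the maximum with 1 is not needed
      -- there; the counts of the other edges do not change.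
      have e : ∀ v ∈ common J D E α vs x, ∏ k ∈ E,
          (max 1 ((J k).count D (Function.update α x v) (vs ++ [x]) : ℝ)) ^ w k =
          (∏ k ∈ F, ((J k).count D (Function.update α x v) (vs ++ [x]) : ℝ) ^ w k) *
            ∏ k ∈ G, (max 1 ((J k).count D α vs : ℝ)) ^ w k := by
        intro v hv
        rw [hsplit]
        congr 1
        · refine Finset.prod_congr rfl fun k hk => ?_
          rw [hF, Finset.mem_filter] at hk
          rw [max_eq_right]
          exact_mod_cast JoinEdge.one_le_count_update hx
            ((mem_common.1 hv).2 k hk.1 hk.2)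
        · refine Finset.prod_congr rfl fun k hk => ?_
          rw [hG, Finset.mem_filter, not_not] at hk
          rw [JoinEdge.count_update_of_none hx hk.2]
      rw [Finset.sum_congr rfl e, ← Finset.sum_mul, hB, hsplit]
      refine mul_le_mul_of_nonneg_right ?_
        (zero_le_one.trans (hone α vs G (Finset.filter_subset _ _)))
      refine sum_prod_rpow_le _ F _ w _ (fun k _ v _ => Nat.cast_nonneg _)
        (fun k hk => hw k (Finset.mem_of_mem_filter k hk)) hcx
        (fun k _ => lt_of_lt_of_le one_pos (le_max_left _ _)) fun k hk => ?_
      rw [hF, Finset.mem_filter] at hk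
      refine le_max_of_le_right ?_
      exact_mod_cast JoinEdge.sum_count_update_le (D := D) (α := α) hx hk.2 (common J D E α vs x)
    have hrec : (∑ v ∈ common J D E α vs x,
        joinWork J D E (vs ++ [x]) rest (Function.update α x v) : ℝ) ≤
        (2 * rest.length + 1) * B := by
      refine le_trans (Finset.sum_le_sum fun v _ =>
        ih (vs ++ [x]) (Function.update α x v) (by simpa using hnd)
          fun y hy => hcov y (by simp [hy])) ?_
      rw [← Finset.mul_sum]
      exact mul_le_mul_of_nonneg_left hsum (by positivity)
    simp only [joinWork, List.length_cons]
    push_cast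
    nlinarith

theorem joinWork_le_rpow {w : ℕ → ℝ} (hw : ∀ k ∈ E, 0 ≤ w k) {V : List ℕ} (hV : V.Nodup)
    (hcov : ∀ x ∈ V, 1 ≤ ∑ k ∈ E with (J k).col x ≠ none, w k) {N : ℕ} (hN : 1 ≤ N)
    (hD : ∀ k ∈ E, (D.rel (J k).rel).length ≤ N) (α : ℕ → K) :
    (joinWork J D E [] V α : ℝ) ≤ (2 * V.length + 1) * (N : ℝ) ^ ∑ k ∈ E, w k := by
  refine (joinWork_le hw V [] α (by simpa using hV) hcov).trans ?_
  have hN' : (1 : ℝ) ≤ N := by exact_mod_cast hN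
  rw [Real.rpow_sum_of_pos (by linarith)]
  refine mul_le_mul_of_nonneg_left (Finset.prod_le_prod (fun k _ => by positivity) fun k hk => ?_)
    (by positivity)
  refine Real.rpow_le_rpow (by positivity) (max_le hN' ?_) (hw k hk)
  exact_mod_cast (List.length_filter_le _ _).trans (hD k hk)

/-! ### The search for the tuples of a join -/

theorem JoinEdge.length_key_eq {β γ : Type*} (e : JoinEdge ar) (α : ℕ → β)
    (t : Fin (ar e.rel) → γ) (vs : List ℕ) : (e.key α vs).length = (e.word t vs).length := by
  induction vs with
  | nil => rfl
  | cons x vs ih =>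
    cases hc : e.col x <;> simpa [key, word, hc] using ih

theorem JoinEdge.key_eq_word_iff (e : JoinEdge ar) {α : ℕ → K} {t : Fin (ar e.rel) → K}
    {vs : List ℕ} : e.key α vs = e.word t vs ↔ e.Fits α vs t := by
  refine ⟨fun h => ?_, fun h => e.key_eq_word h⟩
  induction vs with
  | nil => simp [Fits]
  | cons x vs ih =>
    intro y hy i hi
    cases hc : e.col x with
    | none =>
      have hyx : y ≠ x := by rintro rfl; simp [hc] at hi
      exact ih (by simpa [key, word, hc] using h) y (by simpa [hyx] using hy) i hi
    | some i' =>
      have h' : α x = t i' ∧ e.key α vs = e.word t vs := by simpa [key, word, hc] using h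
      by_cases hyx : y = x
      · subst hyx
        rw [hc] at hi
        cases hi
        exact h'.1
      · exact ih h'.2 y (by simpa [hyx] using hy) i hi

/-- The lengths of a key and of a word depend only on which variables name a column, so a prefix of
a tuple's word splits exactly after the part for `vs`. This translates lookups in a trie into
membership in `ext`. -/
theorem JoinEdge.key_append_mem_words {e : JoinEdge ar} {D : Database ar K} {α : ℕ → K}
    {V vs rest : List ℕ} {x : ℕ} (hV : V = vs ++ x :: rest) (hx : e.col x ≠ none) (v : K) :
    e.key α vs ++ [v] ∈ e.words V (D.rel e.rel) ↔ v ∈ e.ext D α vs x := by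
  obtain ⟨i, hi⟩ := Option.ne_none_iff_exists'.1 hx
  have hw : ∀ t : Fin (ar e.rel) → K, e.word t V = e.word t vs ++ t i :: e.word t rest := by
    intro t
    simp [word, hV, hi]
  simp only [words, Set.mem_ofPred_eq, mem_ext, hw]
  constructor
  · rintro ⟨-, t, ht, c, hc⟩
    rw [List.append_assoc] at hc
    obtain ⟨h1, h2⟩ := List.append_inj hc (e.length_key_eq α t vs)
    refine ⟨t, ht, e.key_eq_word_iff.1 h1, i, hi, ?_⟩
    simp only [List.cons_append, List.cons.injEq] at h2
    exact h2.1.symm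
  · rintro ⟨t, ht, h1, i', hi', rfl⟩
    rw [hi] at hi'
    cases hi'
    refine ⟨by simp, t, ht, e.word t rest, ?_⟩
    rw [e.key_eq_word_iff.2 h1]
    simp

/-- Registers of the variables in `vs` and of the loops for them. -/
def searchRegs (vs : List ℕ) : Set Slot :=
  {r | r = .tmp 0 ∨ r = .tmp 1 ∨ ∃ y ∈ vs, r = .var y ∨ r = .idx y ∨ r = .lim y}

theorem searchRegs_mono {vs vs' : List ℕ} (h : vs ⊆ vs') : searchRegs vs ⊆ searchRegs vs' := by
  rintro r (hr | hr | ⟨y, hy, hr⟩)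
  exacts [.inl hr, .inr (.inl hr), .inr (.inr ⟨y, h hy, hr⟩)]

namespace Cmd

/-- Numbers of edges occur in addresses as immediate values, so the continuation is compiled
separately for each possible outcome of the comparisons. The code grows exponentially with the
number of edges, while the running time grows linearly. -/
def pick (J : ℕ → JoinEdge ar) (vs : List ℕ) (f : ℕ → Cmd P K) : ℕ → List ℕ → Cmd P K
  | k, [] => f k
  | k, k' :: ks =>
    .seq (.get (.tmp 0) 3 (.imm (.nat k) :: (J k).key varOpd vs))
      (.seq (.get (.tmp 1) 3 (.imm (.nat k') :: (J k').key varOpd vs))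
        (.ifLt (.tmp 0) (.tmp 1) (pick J vs f k ks) (pick J vs f k' ks)))

def checks (J : ℕ → JoinEdge ar) (vs : List ℕ) (x : ℕ) (c : Cmd P K) : List ℕ → Cmd P K
  | [] => c
  | k :: ks =>
    .seq (.get (.tmp 0) 5 (.imm (.nat k) :: (J k).key varOpd vs ++ [varOpd x]))
      (.ifEq (.slot (.tmp 0)) (.imm (.nat 1)) (checks J vs x c ks) .skip)

def values (J : ℕ → JoinEdge ar) (vs : List ℕ) (x : ℕ) (c : Cmd P K) (k : ℕ) : Cmd P K :=
  .seq (.get (.lim x) 3 (.imm (.nat k) :: (J k).key varOpd vs))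
    (.forLt (.idx x) (.lim x)
      (.seq (.get (.var x) 4 (.slot (.idx x) :: .imm (.nat k) :: (J k).key varOpd vs)) c))

open Classical in
/-- Search for the assignments to `rest` that are consistent with the edges in `es`, and run
`leaf` for each of them. -/
noncomputable def search (J : ℕ → JoinEdge ar) (es : List ℕ) (leaf : Cmd P K) :
    List ℕ → List ℕ → Cmd P K
  | _, [] => leaf
  | vs, x :: rest =>
    match es.filter (fun k => (J k).col x ≠ none) with
    | [] => .skip
    | k :: ks => pick J vs (values J vs x
        (checks J vs x (search J es leaf (vs ++ [x]) rest) (k :: ks))) k ks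

end Cmd

/-- The tries of the edges in `es` are in memory. -/
def Mach.HasTries (s : Mach P K) (J : ℕ → JoinEdge ar) (D : Database ar K) (V es : List ℕ) : Prop :=
  ∀ k ∈ es, s.HasTrie k ((J k).words V (D.rel (J k).rel))

theorem Mach.HasTries.of_agree {s s' : Mach P K} {J : ℕ → JoinEdge ar} {D : Database ar K}
    {V es : List ℕ} {T : Set ℕ} {E : Set Slot} (h : s.HasTries J D V es) (hs : s.Agree s' T E)
    (hT : ∀ n ∈ T, 5 < n) : s'.HasTries J D V es := by
  have : ∀ n ≤ 5, s'.tab n = s.tab n := fun n hn => hs.1 n fun h => absurd (hT n h) (by omega)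
  exact fun k hk => (h k hk).of_tab (this 3 (by omega)) (this 4 (by omega)) (this 5 (by omega))

/-- The registers of the variables in `vs` hold the values of `α`. -/
def Mach.Reads (s : Mach P K) (α : ℕ → K) (vs : List ℕ) : Prop :=
  ∀ y ∈ vs, s.env (.var y) = .const (α y)

theorem Mach.Reads.map_key {s : Mach P K} {α : ℕ → K} {vs : List ℕ} (h : s.Reads α vs)
    (e : JoinEdge ar) : (e.key varOpd vs).map (Opd.eval s) = (e.key α vs).map .const := by
  rw [e.map_key, e.map_key]
  exact e.key_congr fun y hy _ => h y hy

/-- Continuation lists have no duplicates, so the stored length is the size of `ext`, and comparing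
stored lengths finds the edge with fewest extensions. -/
theorem Mach.HasTries.length_ext {s : Mach P K} {J : ℕ → JoinEdge ar} {D : Database ar K}
    {V es vs rest : List ℕ} {x : ℕ} (h : s.HasTries J D V es) {α : ℕ → K} (hα : s.Reads α vs)
    (hV : V = vs ++ x :: rest) {k : ℕ} (hk : k ∈ es) (hx : (J k).col x ≠ none) :
    ∃ L : List K, L.Nodup ∧ (∀ v, v ∈ L ↔ v ∈ (J k).ext D α vs x) ∧
      L.length = ((J k).ext D α vs x).card ∧
      s.tab 3 ((.imm (.nat k) :: (J k).key varOpd vs).map (Opd.eval s)) = .nat L.length ∧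
      ∀ (i : ℕ) (v : K), L[i]? = some v →
        s.tab 4 (.nat i :: (.imm (.nat k) :: (J k).key varOpd vs).map (Opd.eval s)) = .const v := by
  classical
  obtain ⟨L, h1, h2, h3, h4⟩ := (h k hk ((J k).key α vs)).1
  have h2' : ∀ v, v ∈ L ↔ v ∈ (J k).ext D α vs x := fun v => by
    rw [h2, JoinEdge.key_append_mem_words hV hx]
  refine ⟨L, h1, h2', ?_, ?_, fun i v hv => ?_⟩
  · rw [← List.toFinset_card_of_nodup h1]
    congr 1
    ext v
    simp [h2']
  · simpa [hα.map_key] using h3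
  · simpa [hα.map_key] using h4 i (.const v) (by simp [hv])

/-- The edge kept so far is no larger than those discarded, so the continuation has to be verified
for a smallest edge only. -/
theorem WP.pick {J : ℕ → JoinEdge ar} {D : Database ar K} {V es vs rest : List ℕ} {x : ℕ}
    (hV : V = vs ++ x :: rest) {f : ℕ → Cmd P K} {α : ℕ → K} {t : ℕ} {Q : Mach P K → Prop}
    (ks : List ℕ) : ∀ (k : ℕ) (s : Mach P K), s.HasTries J D V es → s.Reads α vs →
      (∀ k' ∈ k :: ks, k' ∈ es ∧ (J k').col x ≠ none) →
      (∀ k' ∈ k :: ks, (∀ k'' ∈ k :: ks, ((J k').ext D α vs x).card ≤ ((J k'').ext D α vs x).card) →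
        ∀ s', s.Agree s' ∅ {.tmp 0, .tmp 1} → WP (f k') t Q s') →
      WP (.pick J vs f k ks) (ks.length * (4 * V.length + 11) + t) Q s := by
  induction ks with
  | nil =>
    intro k s _ _ _ h
    exact (h k (by simp) (by simp) s (.refl _ _ _)).mono (by simp) fun _ h => h
  | cons k' ks ih =>
    intro k s hs hα hks h
    have hlen : ∀ k, ((J k).key (varOpd (P := P) (K := K)) vs).length ≤ V.length :=
      fun k => ((J k).length_key_le _ _).trans (by simp [hV])
    obtain ⟨L, -, -, hL, hL', -⟩ := hs.length_ext hα hV (hks k (by simp)).1 (hks k (by simp)).2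
    obtain ⟨L', -, -, hM, hM', -⟩ := hs.length_ext hα hV (hks k' (by simp)).1 (hks k' (by simp)).2
    have hnt : ∀ k, ∀ o ∈ Opd.imm (.nat k) :: (J k).key (varOpd (P := P) (K := K)) vs, o.NoTmp := by
      intro k o ho
      rcases List.mem_cons.1 ho with rfl | ho
      · exact fun n h => by cases h
      · exact (J k).noTmp_key vs o ho
    refine (WP.seq (WP.get (WP.seq (WP.get (WP.ifLt
      (t := ks.length * (4 * V.length + 11) + t) (fun hlt => ?_) (fun hlt => ?_)))))).mono ?_
        fun _ h => h
    · rw [Opd.map_eval_set_tmp (hnt k'), Mach.tab_set, hL', hM'] at hlt ⊢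
      simp only [Mach.env_set_self, Mach.env_set_of_ne _ _ (show Slot.tmp 0 ≠ .tmp 1 by simp),
        Val.toNat, hL, hM] at hlt
      refine ih k _ hs (fun y hy => ?_) (fun k'' hk => hks k'' (by simp at hk ⊢; tauto))
        fun k₁ hk₁ hmin s' hs' => h k₁ (by simp at hk₁ ⊢; tauto) (fun k₂ hk₂ => ?_) s' ?_
      · simpa using hα y hy
      · simp only [List.mem_cons] at hk₂
        rcases hk₂ with rfl | rfl | hk₂
        · exact hmin _ (by simp)
        · exact (hmin k (by simp)).trans hlt.le
        · exact hmin _ (by simp [hk₂])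
      · exact ((Mach.Agree.set _ (by simp) _).trans (Mach.Agree.set _ (by simp) _)).trans hs'
    · rw [Opd.map_eval_set_tmp (hnt k'), Mach.tab_set, hL', hM'] at hlt ⊢
      simp only [Mach.env_set_self, Mach.env_set_of_ne _ _ (show Slot.tmp 0 ≠ .tmp 1 by simp),
        Val.toNat, hL, hM] at hlt
      refine ih k' _ hs (fun y hy => ?_) (fun k'' hk => hks k'' (by simp at hk ⊢; tauto))
        fun k₁ hk₁ hmin s' hs' => h k₁ (by simp at hk₁ ⊢; tauto) (fun k₂ hk₂ => ?_) s' ?_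
      · simpa using hα y hy
      · simp only [List.mem_cons] at hk₂
        rcases hk₂ with rfl | rfl | hk₂
        · exact (hmin k' (by simp)).trans (not_lt.1 hlt)
        · exact hmin _ (by simp)
        · exact hmin _ (by simp [hk₂])
      · exact ((Mach.Agree.set _ (by simp) _).trans (Mach.Agree.set _ (by simp) _)).trans hs'
    · have h1 := hlen k
      have h2 := hlen k'
      simp only [List.length_cons]
      ring_nf
      omega

-- The time of the continuation is charged only if all checks succeed. In the search this restricts
-- the recursive costs to values in `common`; a bound with `t` for each scanned value would be too
-- weak.
open Classical in
theorem WP.checks {J : ℕ → JoinEdge ar} {D : Database ar K} {V es vs rest : List ℕ} {x : ℕ}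
    (hV : V = vs ++ x :: rest) {c : Cmd P K} {α : ℕ → K} {v : K} {t : ℕ} {Q : Mach P K → Prop}
    (ks : List ℕ) : ∀ (s : Mach P K), s.HasTries J D V es → s.Reads α vs →
      s.env (.var x) = .const v → (∀ k ∈ ks, k ∈ es ∧ (J k).col x ≠ none) →
      ((∀ k ∈ ks, v ∈ (J k).ext D α vs x) → ∀ s', s.Agree s' ∅ {.tmp 0} → WP c t Q s') →
      ((¬ ∀ k ∈ ks, v ∈ (J k).ext D α vs x) → ∀ s', s.Agree s' ∅ {.tmp 0} → Q s') →
      WP (.checks J vs x c ks) (ks.length * (2 * V.length + 10) +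
        if ∀ k ∈ ks, v ∈ (J k).ext D α vs x then t else 0) Q s := by
  induction ks with
  | nil =>
    intro s _ _ _ _ h _
    exact (h (by simp) s (.refl _ _ _)).mono (by simp) fun _ h => h
  | cons k ks ih =>
    intro s hs hα hx hks h h'
    have hlen : ((J k).key (varOpd (P := P) (K := K)) vs).length ≤ V.length :=
      ((J k).length_key_le _ _).trans (by simp [hV])
    have hget : s.tab 5 ((Opd.imm (.nat k) :: (J k).key varOpd vs ++ [varOpd x]).map (Opd.eval s)) =
        s.tab 5 (.nat k :: ((J k).key α vs ++ [v]).map .const) := by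
      simp [hα.map_key, varOpd, hx]
    have hmem := JoinEdge.key_append_mem_words (D := D) (α := α) hV (hks k (by simp)).2 v
    have hk := hs k (hks k (by simp)).1 ((J k).key α vs ++ [v])
    rw [hmem] at hk
    refine (WP.seq (WP.get (WP.ifEq (t := ks.length * (2 * V.length + 10) +
      if ∀ k' ∈ k :: ks, v ∈ (J k').ext D α vs x then t else 0) (fun heq => ?_)
        (fun hne => ?_)))).mono ?_ fun _ h => h
    · rw [hget] at heq ⊢
      have hv : v ∈ (J k).ext D α vs x := by
        by_contra hv
        rw [hk.2.2 hv] at heq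
        simp at heq
      refine (ih (s.set (.tmp 0) _) (fun k' hk' => (hs k' hk').of_tab rfl rfl rfl)
        (fun y hy => ?_) ?_
        (fun k' hk' => hks k' (by simp [hk'])) (fun hall s' hs' => h
          (by simpa [hv] using hall) s' ?_)
        (fun hall s' hs' => h' (fun hall' => hall fun k' hk' => hall' k'
          (by simp [hk'])) s' ?_)).mono ?_ fun _ h => h
      · simpa using hα y hy
      · simpa using hx
      · exact (Mach.Agree.set _ (by simp) _).trans hs'
      · exact (Mach.Agree.set _ (by simp) _).trans hs'
      · simp [hv]
    · rw [hget] at hne ⊢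
      have hv : v ∉ (J k).ext D α vs x := by
        intro hv
        rw [hk.2.1 hv] at hne
        simp at hne
      refine (WP.skip (h' (fun hall => hv (hall k (by simp))) _ ?_)).mono (by omega) fun _ h => h
      exact Mach.Agree.set _ (by simp) _
    · simp only [List.length_cons, List.length_append, List.length_nil]
      ring_nf
      omega

/-- The behaviour of a program `leaf` that reads the registers of the variables in `W` and
updates an abstract state. -/
structure LeafSpec {A : Type*} (leaf : Cmd P K) (t : ℕ) (W : List ℕ) (T : Set ℕ) (E : Set Slot)
    (Acc : A → Mach P K → Prop) (step : A → (ℕ → K) → A) : Prop where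
  run : ∀ α a s, s.Reads α W → Acc a s →
    WP leaf t (fun s' => Acc (step a α) s' ∧ s.Agree s' T E) s
  stable : ∀ a s s' vs, Acc a s → s.Agree s' ∅ (searchRegs vs) → Acc a s'
  five_lt : ∀ n ∈ T, 5 < n
  regs : ∀ y, Slot.var y ∉ E ∧ Slot.idx y ∉ E ∧ Slot.lim y ∉ E

theorem not_mem_union_searchRegs {E : Set Slot} (hE : ∀ y, Slot.var y ∉ E ∧ Slot.idx y ∉ E ∧
    Slot.lim y ∉ E) {vs : List ℕ} {y : ℕ} (hy : y ∉ vs) : Slot.var y ∉ E ∪ searchRegs vs ∧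
      Slot.idx y ∉ E ∪ searchRegs vs ∧ Slot.lim y ∉ E ∪ searchRegs vs := by
  refine ⟨?_, ?_, ?_⟩ <;> rintro (h | h | h | ⟨z, hz, h⟩) <;> simp_all

theorem sum_range_getElem? {β : Type*} (f : β → ℕ) (L : List β) :
    ∑ j ∈ Finset.range L.length, ((L[j]?).map f).getD 0 = (L.map f).sum := by
  induction L with
  | nil => rfl
  | cons a L ih =>
    rw [List.length_cons, Finset.sum_range_succ']
    simp only [List.getElem?_cons_succ, ih]
    simp [add_comm]

/-- Each unit of `joinWork` pays for `C` machine steps: the choice of the smallest edge, a round of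
the scan with its checks, or a run of the leaf. The list `αs` collects the assignments for which the
leaf was run. Only completeness of this list is claimed; the leaf makes its own tests. The set `W`
may contain variables outside `V`, whose registers have been set before the search. -/
theorem WP.search {J : ℕ → JoinEdge ar} {D : Database ar K} {V es W : List ℕ} (hV : V.Nodup)
    (hVW : V ⊆ W) (hes : ∀ x ∈ V, ∃ k ∈ es, (J k).col x ≠ none) {A : Type*} {leaf : Cmd P K}
    {tl : ℕ} {T : Set ℕ} {E : Set Slot} {Acc : A → Mach P K → Prop} {step : A → (ℕ → K) → A}
    (H : LeafSpec leaf tl W T E Acc step) (rest : List ℕ) :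
    ∀ (vs : List ℕ) (α : ℕ → K) (a : A) (s : Mach P K), V = vs ++ rest → s.HasTries J D V es →
      (∀ y ∈ W, y ∉ rest → s.env (.var y) = .const (α y)) → Acc a s →
      WP (.search J es leaf vs rest) (((es.length + 1) * (4 * V.length + 20) + tl) *
          joinWork J D es.toFinset vs rest α)
        (fun s' => s.Agree s' T (E ∪ searchRegs rest) ∧ ∃ αs : List (ℕ → K),
          Acc (αs.foldl step a) s' ∧ αs.length ≤ joinWork J D es.toFinset vs rest α ∧
          ∀ β : ℕ → K, (∀ y, y ∉ rest → β y = α y) →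
            (∀ k ∈ es, ∃ t ∈ D.rel (J k).rel, (J k).Fits β V t) → β ∈ αs) s := by
  classical
  set C := (es.length + 1) * (4 * V.length + 20) + tl with hC
  induction rest with
  | nil =>
    intro vs α a s _ _ hα ha
    refine (H.run α a s (fun y hy => hα y hy (by simp)) ha).mono ?_ ?_
    · simp only [joinWork]
      rw [hC]
      omega
    · rintro s' ⟨h1, h2⟩
      refine ⟨h2.mono le_rfl Set.subset_union_left, [α], h1, by simp [joinWork], fun β hβ _ => ?_⟩
      rw [List.mem_singleton]
      funext y
      exact hβ y (by simp)
  | cons x rest ih =>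
    intro vs α a s hvs hs hα ha
    have hx : x ∉ vs := by
      rw [hvs, List.nodup_append] at hV
      exact fun h => hV.2.2 x h x (by simp) rfl
    have hxr : x ∉ rest := by
      rw [hvs, List.nodup_append, List.nodup_cons] at hV
      exact hV.2.1.1
    have hdis : ∀ y ∈ vs, y ∉ x :: rest := by
      rw [hvs, List.nodup_append] at hV
      exact fun y hy hy' => hV.2.2 y hy y hy' rfl
    have hvsW : ∀ y ∈ vs, y ∈ W := fun y hy => hVW (by simp [hvs, hy])
    have hαvs : s.Reads α vs := fun y hy => hα y (hvsW y hy) (hdis y hy)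
    set F := es.filter (fun k => (J k).col x ≠ none) with hF
    have hmemF : ∀ k, k ∈ F ↔ k ∈ es ∧ (J k).col x ≠ none := by simp [hF]
    set wk := ∑ v ∈ common J D es.toFinset α vs x,
      joinWork J D es.toFinset (vs ++ [x]) rest (Function.update α x v) with hwk
    set Q : Mach P K → Prop := fun s' => s.Agree s' T (E ∪ searchRegs (x :: rest)) ∧
      ∃ αs : List (ℕ → K), Acc (αs.foldl step a) s' ∧ αs.length ≤ wk ∧
        ∀ β : ℕ → K, (∀ y, y ∉ x :: rest → β y = α y) →
          (∀ k ∈ es, ∃ t ∈ D.rel (J k).rel, (J k).Fits β V t) → β ∈ αs with hQ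
    suffices hmain : WP (.search J es leaf vs (x :: rest))
        (C * joinWork J D es.toFinset vs (x :: rest) α) Q s by
      refine hmain.mono le_rfl ?_
      rintro s' ⟨h1, αs, h2, h3, h4⟩
      refine ⟨h1, αs, h2, h3.trans ?_, h4⟩
      rw [joinWork]
      exact Nat.le_add_left _ _
    obtain ⟨k₀, ks, hks⟩ : ∃ k₀ ks, F = k₀ :: ks := by
      obtain ⟨k, hk, hc⟩ := hes x (by simp [hvs])
      exact List.exists_cons_of_ne_nil (List.ne_nil_of_mem ((hmemF k).2 ⟨hk, hc⟩))
    have hmem : ∀ k, k ∈ k₀ :: ks ↔ k ∈ es ∧ (J k).col x ≠ none := by rw [← hks]; exact hmemF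
    have hcommon : ∀ v, v ∈ common J D es.toFinset α vs x ↔
        ∀ k ∈ k₀ :: ks, v ∈ (J k).ext D α vs x := by
      intro v
      simp only [mem_common, List.mem_toFinset, hmem]
      refine ⟨fun h k hk => h.2 k hk.1 hk.2, fun h => ⟨?_, fun k hk hc => h k ⟨hk, hc⟩⟩⟩
      have := (hmem k₀).1 (by simp)
      exact ⟨k₀, this.1, h k₀ this⟩
    simp only [Cmd.search]
    rw [← hF, hks]
    set m := sInf {n | ∃ k ∈ es.toFinset, (J k).col x ≠ none ∧ n = ((J k).ext D α vs x).card}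
      with hm
    have hFle : ks.length + 1 ≤ es.length := by
      rw [← List.length_cons (a := k₀), ← hks]
      exact List.length_filter_le _ _
    refine (WP.pick (D := D) (es := es) (α := α) (Q := Q) (rest := rest)
      (t := (2 * (V.length + 1) + 3) + (m * ((2 * (V.length + 2) + 3) +
        es.length * (2 * V.length + 10) + 2) + C * wk + 2)) hvs ks k₀ s hs
      hαvs (fun k hk => (hmem k).1 hk) ?_).mono ?_ fun _ h => h
    swap
    · rw [joinWork, ← hm, ← hwk]
      have h1 : ks.length * (4 * V.length + 11) ≤ es.length * (4 * V.length + 11) :=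
        Nat.mul_le_mul_right _ (by omega)
      have h2 : m * ((2 * (V.length + 2) + 3) + es.length * (2 * V.length + 10) + 2) ≤ m * C := by
        refine Nat.mul_le_mul_left _ ?_
        rw [hC]
        nlinarith
      have h3 : es.length * (4 * V.length + 11) + (2 * (V.length + 1) + 3) + 2 ≤ C := by
        rw [hC]
        nlinarith
      calc _ ≤ C + m * C + C * wk := by omega
        _ = _ := by ring
    intro k hk hmin s₁ hs₁
    have hk' := (hmem k).1 hk
    have hs₁' : s₁.HasTries J D V es := hs.of_agree hs₁ (by simp)
    have hα₁ : s₁.Reads α vs := fun y hy => by rw [hs₁.2 _ (by simp)]; exact hαvs y hy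
    obtain ⟨L, hL1, hL2, hL3, hL4, hL5⟩ := hs₁'.length_ext hα₁ hvs hk'.1 hk'.2
    -- The chosen edge is a smallest one, so the infimum in `joinWork` is the length of the list
    -- that is scanned.
    have hmL : m = L.length := by
      rw [hL3]
      refine le_antisymm (Nat.sInf_le ⟨k, by simpa using hk'.1, hk'.2, rfl⟩) ?_
      obtain ⟨k'', hk'', hc'', he⟩ := Nat.sInf_mem (s := {n | ∃ k ∈ es.toFinset,
        (J k).col x ≠ none ∧ n = ((J k).ext D α vs x).card})
          ⟨_, k, by simpa using hk'.1, hk'.2, rfl⟩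
      rw [← hm] at he
      rw [he]
      exact hmin k'' ((hmem k'').2 ⟨by simpa using hk'', hc''⟩)
    have hlen : ((J k).key (varOpd (P := P) (K := K)) vs).length ≤ V.length :=
      ((J k).length_key_le _ _).trans (by simp [hvs])
    -- Rejected values cause no recursive work, so summing over the scanned list leaves only values
    -- in `common`.
    set g' : K → ℕ := fun v => if ∀ k' ∈ k₀ :: ks, v ∈ (J k').ext D α vs x then
      joinWork J D es.toFinset (vs ++ [x]) rest (Function.update α x v) else 0 with hg'
    set g : ℕ → ℕ := fun j => ((L[j]?).map g').getD 0 with hg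
    have hgsum : ∑ j ∈ Finset.range L.length, g j ≤ wk := by
      rw [hg, sum_range_getElem?, ← List.sum_toFinset _ hL1, hg', ← Finset.sum_filter, hwk]
      refine Finset.sum_le_sum_of_subset_of_nonneg (fun v hv => ?_) fun _ _ _ => Nat.zero_le _
      exact (hcommon v).2 (Finset.mem_filter.1 hv).2
    have hstable : ∀ {y : ℕ}, y ∉ x :: rest → _ := fun hy => not_mem_union_searchRegs H.regs hy
    have hloop := WP.forLt (i := .idx x) (l := .lim x) (by simp) (n := L.length)
      (c := .seq (.get (.var x) 4 (.slot (.idx x) :: .imm (.nat k) :: (J k).key varOpd vs))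
        (Cmd.checks J vs x (Cmd.search J es leaf (vs ++ [x]) rest) (k₀ :: ks)))
      (fun j => (2 * (V.length + 2) + 3) + (es.length * (2 * V.length + 10) + C * g j))
      (fun j s' => s.Agree s' T (E ∪ searchRegs (x :: rest)) ∧
        ∃ αs : List (ℕ → K), Acc (αs.foldl step a) s' ∧ αs.length ≤ ∑ i ∈ Finset.range j, g i ∧
          ∀ β : ℕ → K, (∀ y, y ∉ x :: rest → β y = α y) → β x ∈ L.take j →
            (∀ k ∈ es, ∃ t ∈ D.rel (J k).rel, (J k).Fits β V t) → β ∈ αs)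
      (s := s₁.set (.lim x) (.nat L.length)) (by simp) ?_ ?_
    · refine (WP.seq (u := ∑ j ∈ Finset.range L.length, ((2 * (V.length + 2) + 3) +
        (es.length * (2 * V.length + 10) + C * g j) + 2) + 2) (WP.get ?_)).mono ?_ fun _ h => h
      · rw [hL4]
        refine hloop.mono le_rfl ?_
        rintro s' ⟨h1, αs, h2, h3, h4⟩
        refine ⟨h1, αs, h2, h3.trans hgsum, fun β hβ hfit => h4 β hβ ?_ hfit⟩
        rw [List.take_length, hL2, JoinEdge.mem_ext]
        obtain ⟨t, ht, hft⟩ := hfit k hk'.1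
        obtain ⟨i, hi⟩ := Option.ne_none_iff_exists'.1 hk'.2
        refine ⟨t, ht, fun y hy i hi => ?_, i, hi, (hft x (by simp [hvs]) i hi).symm⟩
        rw [← hβ y (hdis y hy)]
        exact hft y (by simp [hvs, hy]) i hi
      · simp only [List.length_cons, Finset.sum_add_distrib, Finset.sum_const, Finset.card_range,
          smul_eq_mul, ← Finset.mul_sum]
        have := Nat.mul_le_mul_left C hgsum
        rw [hmL]
        ring_nf at this ⊢
        omega
    · refine ⟨?_, [], ?_, by simp, by simp⟩
      · exact (hs₁.mono (by simp) (fun r hr => by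
          rcases hr with rfl | rfl
          exacts [.inr (.inl rfl), .inr (.inr (.inl rfl))])).trans
          ((Mach.Agree.set _ (.inr (.inr (.inr ⟨x, by simp⟩))) _).trans
            (Mach.Agree.set _ (.inr (.inr (.inr ⟨x, by simp⟩))) _))
      · refine H.stable a s _ [x] ha ((hs₁.mono le_rfl (fun r hr => ?_)).trans
          ((Mach.Agree.set _ (.inr (.inr ⟨x, by simp⟩)) _).trans
            (Mach.Agree.set _ (.inr (.inr ⟨x, by simp⟩)) _)))
        rcases hr with rfl | rfl
        exacts [.inl rfl, .inr (.inl rfl)]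
    · rintro j hj s₂ hidx hlim ⟨h1, αs, h2, h3, h4⟩
      set v := L[j] with hv
      have hLj : L[j]? = some v := List.getElem?_eq_getElem hj
      have hgj : g j = g' v := by simp [hg, hLj]
      have hs₂ : s₂.HasTries J D V es := hs.of_agree h1 H.five_lt
      have hα₂ : s₂.Reads α vs := fun y hy => by
        rw [h1.2 _ (hstable (hdis y hy)).1]
        exact hαvs y hy
      have htab4 : s₂.tab 4 = s₁.tab 4 := by
        rw [h1.1 4 (fun h => absurd (H.five_lt 4 h) (by omega)), hs₁.1 4 (by simp)]
      have hget : s₂.tab 4 ((.slot (.idx x) :: .imm (.nat k) :: (J k).key varOpd vs).map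
          (Opd.eval s₂)) = .const v := by
        rw [htab4, ← hL5 j v hLj]
        simp [hα₂.map_key, hα₁.map_key, hidx]
      have htake : ∀ w, w ∈ L.take (j + 1) → w ∈ L.take j ∨ w = v := by
        intro w hw
        simpa [List.take_add_one, hLj] using hw
      refine (WP.seq (u := es.length * (2 * V.length + 10) + C * g j) (WP.get ?_)).mono ?_
        fun _ h => h
      swap
      · simp only [List.length_cons]
        omega
      rw [hget]
      refine (WP.checks (D := D) (es := es) (α := α) (v := v) (rest := rest)
        (t := C * joinWork J D es.toFinset (vs ++ [x]) rest (Function.update α x v)) hvs (k₀ :: ks)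
        (s₂.set (.var x) (.const v)) (fun k hk => (hs₂ k hk).of_tab rfl rfl rfl)
        (fun y hy => ?_) (by simp) (fun k hk => (hmem k).1 hk) (fun hall s₃ hs₃ => ?_)
        (fun hall s₃ hs₃ => ?_)).mono ?_ fun _ h => h
      · have hyx : y ≠ x := fun e => hx (e ▸ hy)
        simpa [hyx] using hα₂ y hy
      · have h23 : s₂.Agree s₃ ∅ (searchRegs [x]) :=
          (Mach.Agree.set _ (.inr (.inr ⟨x, by simp⟩)) _).trans (hs₃.mono le_rfl
            fun r hr => .inl hr)
        have h23' : s₂.Agree s₃ T (E ∪ searchRegs (x :: rest)) :=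
          h23.mono (by simp) ((searchRegs_mono (by simp)).trans Set.subset_union_right)
        refine (ih (vs ++ [x]) (Function.update α x v) (αs.foldl step a) s₃ (by simp [hvs])
          (hs₂.of_agree h23 (by simp)) (fun y hy hyr => ?_)
            (H.stable _ _ _ _ h2 h23)).mono le_rfl ?_
        · by_cases hyx : y = x
          · subst hyx
            rw [hs₃.2 _ (by simp)]
            simp
          · rw [hs₃.2 _ (by simp), Mach.env_set_of_ne _ _ (by simpa using hyx),
              h1.2 _ (hstable (by simp [hyx, hyr])).1, Function.update_of_ne hyx]
            exact hα y hy (by simp [hyx, hyr])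
        · rintro s₄ ⟨k1, αs', k2, k3, k4⟩
          have k1' : s₃.Agree s₄ T (E ∪ searchRegs (x :: rest)) := k1.mono le_rfl
            (Set.union_subset_union_right _ (searchRegs_mono (by simp)))
          have hx4 := not_mem_union_searchRegs H.regs hxr
          refine ⟨?_, ?_, ?_, αs ++ αs', ?_, ?_, ?_⟩
          · rw [k1.2 _ hx4.2.1, hs₃.2 _ (by simp)]
            simpa using hidx
          · rw [k1.2 _ hx4.2.2, hs₃.2 _ (by simp)]
            simpa using hlim
          · exact ((h1.trans h23').trans k1').trans
              (Mach.Agree.set _ (.inr (.inr (.inr ⟨x, by simp⟩))) _)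
          · rw [List.foldl_append]
            exact H.stable _ _ _ [x] k2 (Mach.Agree.set _ (.inr (.inr ⟨x, by simp⟩)) _)
          · rw [List.length_append, Finset.sum_range_succ, hgj, show g' v = _ from if_pos hall]
            exact Nat.add_le_add h3 k3
          · intro β hβ hβx hfit
            rw [List.mem_append]
            rcases htake _ hβx with h | h
            · exact .inl (h4 β hβ h hfit)
            · refine .inr (k4 β (fun y hy => ?_) hfit)
              by_cases hyx : y = x
              · subst hyx; simpa using h
              · rw [Function.update_of_ne hyx]
                exact hβ y (by simp [hyx, hy])
      · have h23 : s₂.Agree s₃ ∅ (searchRegs [x]) :=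
          (Mach.Agree.set _ (.inr (.inr ⟨x, by simp⟩)) _).trans (hs₃.mono le_rfl
            fun r hr => .inl hr)
        have h23' : s₂.Agree s₃ T (E ∪ searchRegs (x :: rest)) :=
          h23.mono (by simp) ((searchRegs_mono (by simp)).trans Set.subset_union_right)
        refine ⟨?_, ?_, ?_, αs, ?_, ?_, ?_⟩
        · rw [hs₃.2 _ (by simp)]
          simpa using hidx
        · rw [hs₃.2 _ (by simp)]
          simpa using hlim
        · exact (h1.trans h23').trans (Mach.Agree.set _ (.inr (.inr (.inr ⟨x, by simp⟩))) _)
        · exact H.stable _ _ _ [x] h2 (h23.trans (Mach.Agree.set _ (.inr (.inr ⟨x, by simp⟩)) _))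
        · rw [Finset.sum_range_succ]
          omega
        · intro β hβ hβx hfit
          rcases htake _ hβx with h | h
          · exact h4 β hβ h hfit
          -- An assignment that fits all edges cannot take a rejected value, since its tuples
          -- witness membership in each `ext`.
          · refine absurd (fun k'' hk'' => ?_) hall
            obtain ⟨hke, hkc⟩ := (hmem k'').1 hk''
            obtain ⟨t, ht, hft⟩ := hfit k'' hke
            obtain ⟨i, hi⟩ := Option.ne_none_iff_exists'.1 hkc
            refine JoinEdge.mem_ext.2 ⟨t, ht, fun y hy i hi => ?_, i, hi, ?_⟩
            · rw [← hβ y (hdis y hy)]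
              exact hft y (by simp [hvs, hy]) i hi
            · rw [← h]
              exact (hft x (by simp [hvs]) i hi).symm
      · have e1 : (if ∀ k' ∈ k₀ :: ks, v ∈ (J k').ext D α vs x then
            C * joinWork J D es.toFinset (vs ++ [x]) rest (Function.update α x v) else 0) =
            C * g j := by
          rw [hgj]
          simp only [hg', mul_ite, mul_zero]
        have e2 : (k₀ :: ks).length * (2 * V.length + 10) ≤ es.length * (2 * V.length + 10) :=
          Nat.mul_le_mul_right _ hFle
        rw [e1]
        omega

/-! ### Tables of ground facts and ground rules -/

/-- Distinct addresses protect earlier entries from later writes, and since no named register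
changes, all operands may be evaluated in the initial state. -/
theorem WP.saveAll {β : Type*} {n : ℕ} (addr : β → List (Opd P K)) (o : β → Opd P K) {m : ℕ}
    {l : List β} (hm : ∀ x ∈ l, (addr x).length ≤ m) {s : Mach P K}
    (hinj : ∀ x ∈ l, ∀ y ∈ l, (addr x).map (Opd.eval s) = (addr y).map (Opd.eval s) → x = y) :
    WP (.seqMap l fun x => .save n (addr x) (o x)) (l.length * (2 * m + 4))
      (fun s' => (∀ x ∈ l, s'.tab n ((addr x).map (Opd.eval s)) = (o x).eval s) ∧
        (∀ b, (∀ x ∈ l, b ≠ (addr x).map (Opd.eval s)) → s'.tab n b = s.tab n b) ∧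
        s.Agree s' {n} ∅) s := by
  have hev : ∀ s' : Mach P K, s.Agree s' {n} ∅ → Opd.eval s' = Opd.eval s := by
    intro s' h
    funext o
    cases o with
    | slot r => exact h.2 r (by simp)
    | imm x => rfl
  classical
  refine (WP.seqMap (fun x => 2 * (addr x).length + 4) (fun l₁ s' =>
    (∀ x ∈ l₁, s'.tab n ((addr x).map (Opd.eval s)) = (o x).eval s) ∧
        (∀ b, (∀ x ∈ l₁, b ≠ (addr x).map (Opd.eval s)) → s'.tab n b = s.tab n b) ∧
        s.Agree s' {n} ∅) ?_ ⟨by simp, by simp, .refl _ _ _⟩).mono ?_ fun _ h => h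
  · rintro l₁ x l₂ hl s' ⟨h1, h2, h3⟩
    refine WP.save ⟨?_, ?_, h3.trans (Mach.Agree.put _ (by simp) _ _)⟩
    · intro y hy
      rw [hev s' h3, Mach.tab_put_self]
      rcases List.mem_append.1 hy with hy | hy
      · by_cases hxy : y = x
        · subst hxy; simp
        · rw [Function.update_of_ne, h1 y hy]
          exact fun h => hxy (hinj y (by simp [hl, hy]) x (by simp [hl]) h)
      · simp only [List.mem_singleton] at hy
        subst hy
        simp
    · intro b hb
      rw [hev s' h3, Mach.tab_put_self, Function.update_of_ne (hb x (by simp))]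
      exact h2 b fun y hy => hb y (by simp [hy])
  · rw [← List.length_map (as := l) (fun x => 2 * (addr x).length + 4), ← smul_eq_mul]
    refine List.sum_le_card_nsmul _ _ ?_
    intro k hk
    obtain ⟨x, hx, rfl⟩ := List.mem_map.1 hk
    have := hm x hx
    omega

/-! ### Addresses and numbers of facts -/

def Term.opd : Term K → Opd P K
  | .var y => varOpd y
  | .const c => .imm (.const c)

theorem Term.eval_opd {s : Mach P K} {α : ℕ → K} {t : Term K}
    (h : ∀ y ∈ t.vars, s.env (.var y) = .const (α y)) : t.opd.eval s = .const (t.ground α) := by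
  cases t with
  | var y => exact h y (by simp [Term.vars])
  | const c => rfl

/-- The address of an atom. -/
def Atom.opds (A : Atom ar K) : List (Opd P K) :=
  .imm (.pred A.pred) :: List.ofFn fun i => (A.args i).opd

/-- The address of a fact. -/
def Fact.addr (f : Fact ar K) : List (Val P K) := .pred f.1 :: List.ofFn fun i => .const (f.2 i)

theorem Fact.addr_injective : Function.Injective (Fact.addr (ar := ar) (K := K)) := by
  rintro ⟨p, t⟩ ⟨q, u⟩ h
  simp only [addr, List.cons.injEq, Val.pred.injEq] at h
  obtain ⟨rfl, h⟩ := h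
  have := List.ofFn_injective h
  congr
  funext i
  exact Val.const.inj (congrFun this i)

theorem Atom.eval_opds {s : Mach P K} {α : ℕ → K} {W : List ℕ} (h : s.Reads α W) {A : Atom ar K}
    (hA : ∀ y ∈ A.vars, y ∈ W) : A.opds.map (Opd.eval s) = Fact.addr (A.ground α) := by
  simp only [opds, Fact.addr, List.map_cons, List.map_ofFn, Opd.eval_imm, ground]
  congr 2
  funext i
  refine Term.eval_opd fun y hy => h y (hA y ?_)
  simp only [vars, Finset.mem_biUnion, Finset.mem_univ, true_and]
  exact ⟨i, hy⟩

open Classical in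
/-- The numbers of the facts with predicate `q`; facts are numbered from 1. -/
noncomputable def factIds (q : P) (F : List (Fact ar K)) : List ℕ :=
  F.zipIdx.filterMap fun x => if x.1.1 = q then some (x.2 + 1) else none

open Classical in
noncomputable def factId (F : List (Fact ar K)) (f : Fact ar K) : ℕ := F.idxOf f + 1

open Classical in
noncomputable def addFact (F : List (Fact ar K)) (f : Fact ar K) : List (Fact ar K) :=
  if f ∈ F then F else F ++ [f]

theorem factIds_append_singleton (q : P) (F : List (Fact ar K)) (f : Fact ar K) :
    (f.1 = q → factIds q (F ++ [f]) = factIds q F ++ [F.length + 1]) ∧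
      (f.1 ≠ q → factIds q (F ++ [f]) = factIds q F) := by
  constructor <;> intro h <;> simp [factIds, List.zipIdx_append, h]

theorem mem_addFact {F : List (Fact ar K)} {f g : Fact ar K} : g ∈ addFact F f ↔ g ∈ F ∨ g = f := by
  unfold addFact
  split_ifs with h
  · exact ⟨.inl, fun h' => h'.elim id fun e => e ▸ h⟩
  · simp

theorem prefix_addFact (F : List (Fact ar K)) (f : Fact ar K) : F <+: addFact F f := by
  unfold addFact
  split_ifs
  exacts [List.prefix_rfl, List.prefix_append _ _]

/-- The number of a fact is the position of its first occurrence, so numbers stay valid when the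
list of facts grows. -/
theorem factId_of_prefix {F F' : List (Fact ar K)} (h : F <+: F') {f : Fact ar K} (hf : f ∈ F) :
    factId F' f = factId F f := by
  classical
  obtain ⟨G, rfl⟩ := h
  simp only [factId]
  rw [List.idxOf_append_of_mem hf]

theorem getElem?_factId {F : List (Fact ar K)} {f : Fact ar K} (hf : f ∈ F) :
    F[factId F f - 1]? = some f := by
  classical
  simp only [factId, Nat.add_sub_cancel]
  exact List.getElem?_idxOf hf

theorem prefix_foldl_addFact (l F : List (Fact ar K)) : F <+: l.foldl addFact F := by
  induction l generalizing F with
  | nil => exact List.prefix_rfl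
  | cons f l ih => exact (prefix_addFact F f).trans (ih _)

theorem mem_foldl_addFact {l F : List (Fact ar K)} {g : Fact ar K} :
    g ∈ l.foldl addFact F ↔ g ∈ F ∨ g ∈ l := by
  induction l generalizing F with
  | nil => simp
  | cons f l ih => simp [ih, mem_addFact, or_assoc]

theorem length_foldl_addFact_le (l F : List (Fact ar K)) :
    (l.foldl addFact F).length ≤ F.length + l.length := by
  induction l generalizing F with
  | nil => simp
  | cons f l ih =>
    have : (addFact F f).length ≤ F.length + 1 := by
      unfold addFact
      split_ifs <;> simp
    have := ih (addFact F f)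
    simp only [List.foldl_cons, List.length_cons]
    omega

/-- Register for the number of facts. -/
def factReg : Slot := .tmp 10

/-- Register for the number of ground rules. -/
def ruleReg : Slot := .tmp 11

/-- The facts in the list `F` are in memory. -/
structure Mach.HasFacts (s : Mach P K) (F : List (Fact ar K)) : Prop where
  nodup : F.Nodup
  size : s.env factReg = .nat F.length
  id : ∀ n f, F[n]? = some f → s.tab 6 f.addr = .nat (n + 1)
  no_id : ∀ f : Fact ar K, f ∉ F → s.tab 6 f.addr = .nat 0
  ids : ∀ q, s.HasList 7 8 [.pred q] ((factIds q F).map .nat)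
  args : ∀ n f, F[n]? = some f → ∀ j : Fin (ar f.1),
    s.tab 9 [.nat (n + 1), .nat j] = .const (f.2 j)

/-- Find the number of a fact, and number it if it has not been seen before. -/
def Cmd.getId (A : Atom ar K) (r : Slot) : Cmd P K :=
  .seq (.get r 6 A.opds) (.ifEq (.slot r) (.imm (.nat 0))
    (.seq (.incr factReg) (.seq (.assign r (.slot factReg)) (.seq (.save 6 A.opds (.slot factReg))
      (.seq (.push 7 8 [.imm (.pred A.pred)] (.slot factReg))
        (.seqMap (List.finRange (ar A.pred)) fun j =>
          .save 9 [.slot factReg, .imm (.nat j)] (A.args j).opd))))) .skip)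

/-- Facts are numbered from 1, so the entry 0 in table 6 marks a fact that has not been seen. The
condition `20 ≤ i` keeps the target register apart from `tmp 0` and from the counters. -/
theorem WP.getId {s : Mach P K} {α : ℕ → K} {W : List ℕ} (hα : s.Reads α W) {A : Atom ar K}
    (hA : ∀ y ∈ A.vars, y ∈ W) {F : List (Fact ar K)} (hF : s.HasFacts F) {i : ℕ} (hi : 20 ≤ i) :
    WP (.getId A (.tmp i)) (20 * ar A.pred + 60) (fun s' => s'.HasFacts (addFact F (A.ground α)) ∧
      s'.env (.tmp i) = .nat (factId (addFact F (A.ground α)) (A.ground α)) ∧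
      s.Agree s' {6, 7, 8, 9} {.tmp 0, factReg, .tmp i}) s := by
  classical
  have hget : s.tab 6 (A.opds.map (Opd.eval s)) = s.tab 6 (Fact.addr (A.ground α)) := by
    rw [Atom.eval_opds hα hA]
  have hlen : A.opds.length = ar A.pred + 1 := by simp [Atom.opds]
  have hne : factReg ≠ Slot.tmp i := by simp [factReg]; omega
  have hne0 : Slot.tmp 0 ≠ Slot.tmp i := by simp; omega
  set f := A.ground α with hf
  refine (WP.seq (WP.get (WP.ifEq (t := 18 * ar A.pred + 40) (fun h => ?_)
    fun h => (WP.skip ?_).mono (Nat.zero_le _) fun _ h => h))).mono (by omega) fun _ h => h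
  · rw [hget] at h ⊢
    have hfF : f ∉ F := by
      intro hfF
      obtain ⟨n, hn⟩ := List.mem_iff_getElem?.1 hfF
      rw [hF.id n f hn] at h
      simp at h
    set n := F.length with hn
    set s₁ := ((s.set (.tmp i) (s.tab 6 f.addr)).set factReg (.nat (n + 1))).set (.tmp i)
      (.nat (n + 1)) with hs₁
    have hs₁α : s₁.Reads α W := fun y hy => by simpa [hs₁, factReg] using hα y hy
    have h1f : s₁.env factReg = .nat (n + 1) := by simp [hs₁, hne]
    set s₂ := s₁.put 6 f.addr (.nat (n + 1)) with hs₂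
    set s₃ := ((s₂.put 8 [.nat (factIds f.1 F).length, .pred f.1] (.nat (n + 1))).put 7 [.pred f.1]
      (.nat ((factIds f.1 F).length + 1))).set (.tmp 0) (.nat ((factIds f.1 F).length + 1)) with hs₃
    have h13 : s₁.Agree s₃ {6, 7, 8, 9} {.tmp 0} :=
      (((Mach.Agree.put _ (by simp) _ _).trans (Mach.Agree.put _ (by simp) _ _)).trans
        (Mach.Agree.put _ (by simp) _ _)).trans (Mach.Agree.set _ (by simp) _)
    have hs₃α : s₃.Reads α W := fun y hy => by rw [h13.2 _ (by simp)]; exact hs₁α y hy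
    have h3f : s₃.env factReg = .nat (n + 1) := by rw [h13.2 _ (by simp [factReg]), h1f]
    have h4 := WP.saveAll (P := P) (K := K) (n := 9) (fun j : Fin (ar A.pred) =>
      [.slot factReg, .imm (.nat j)]) (fun j => (A.args j).opd) (m := 2)
        (l := List.finRange (ar A.pred)) (by simp) (s := s₃)
          (fun x _ y _ h => by simpa [Fin.val_inj] using h)
    have h4' : WP (.seqMap (List.finRange (ar A.pred)) fun j =>
        .save 9 [.slot factReg, .imm (.nat j)] (A.args j).opd) (8 * ar A.pred)
        (fun s' => s'.HasFacts (addFact F f) ∧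
          s'.env (.tmp i) = .nat (factId (addFact F f) f) ∧
          s.Agree s' {6, 7, 8, 9} {.tmp 0, factReg, .tmp i}) s₃ := by
      refine h4.mono (by simp; omega) ?_
      rintro s₄ ⟨k1, k2, k3⟩
      have k1' : ∀ j : Fin (ar A.pred), s₄.tab 9 [.nat (n + 1), .nat j.1] =
          .const ((A.args j).ground α) := by
        intro j
        have := k1 j (List.mem_finRange j)
        simp only [List.map_cons, List.map_nil, Opd.eval_slot, h3f, Opd.eval_imm] at this
        rw [this]
        refine Term.eval_opd fun y hy => hs₃α y (hA y ?_)
        simp only [Atom.vars, Finset.mem_biUnion, Finset.mem_univ, true_and]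
        exact ⟨j, hy⟩
      have hadd : addFact F f = F ++ [f] := by simp [addFact, hfF]
      have ht6 : s₄.tab 6 = s₂.tab 6 := by rw [k3.1 6 (by simp)]; simp [hs₃]
      have ht7 : s₄.tab 7 = s₃.tab 7 := k3.1 7 (by simp)
      have ht8 : s₄.tab 8 = s₃.tab 8 := k3.1 8 (by simp)
      have hsplit : ∀ {m : ℕ} {g : Fact ar K}, (F ++ [f])[m]? = some g →
          F[m]? = some g ∨ m = n ∧ g = f := by
        intro m g hm
        rw [List.getElem?_append] at hm
        split_ifs at hm with hlt
        · exact .inl hm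
        · have hmn : m - F.length = 0 := by
            by_contra h0
            rw [List.getElem?_eq_none (by simp; omega)] at hm
            cases hm
          rw [hmn] at hm
          simp only [List.getElem?_cons_zero, Option.some.injEq] at hm
          exact .inr ⟨by omega, hm.symm⟩
      refine ⟨?_, ?_, ?_⟩
      · rw [hadd]
        refine ⟨?_, ?_, ?_, ?_, ?_, ?_⟩
        · rw [List.nodup_append]
          exact ⟨hF.nodup, by simp, fun a ha b hb e => hfF (by
            simp only [List.mem_singleton] at hb; rw [← hb, ← e]; exact ha)⟩
        · rw [k3.2 _ (by simp), h3f]; simp [hn]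
        · intro m g hm
          rw [ht6, hs₂, Mach.tab_put_self]
          rcases hsplit hm with h' | ⟨rfl, rfl⟩
          · have : g ≠ f := fun e => hfF (e ▸ List.mem_of_getElem? h')
            rw [Function.update_of_ne (Fact.addr_injective.ne this)]
            simpa [hs₁] using hF.id m g h'
          · simp
        · intro g hg
          simp only [List.mem_append, List.mem_singleton, not_or] at hg
          rw [ht6, hs₂, Mach.tab_put_self,
            Function.update_of_ne (Fact.addr_injective.ne hg.2)]
          simpa [hs₁] using hF.no_id g hg.1
        · intro q
          refine Mach.HasList.of_tab (s := s₃) ?_ ht7 ht8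
          have hFq : s₂.HasList 7 8 [.pred q] ((factIds q F).map .nat) :=
            (hF.ids q).of_tab (by simp [hs₂, hs₁]) (by simp [hs₂, hs₁])
          by_cases h : f.1 = q
          · rw [(factIds_append_singleton q F f).1 h]
            subst h
            simpa [hs₃] using hFq.push (by decide) (.nat (n + 1))
              (.nat ((factIds f.1 F).length + 1)) (.tmp 0)
          · rw [(factIds_append_singleton q F f).2 h]
            exact hFq.push_of_ne (by decide) (by simpa using fun e => h e.symm) _ _ _ _ _
        · intro m g hm j
          rcases hsplit hm with h' | ⟨rfl, rfl⟩
          · have hmn : m ≠ n := by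
              have := (List.getElem?_eq_some_iff.1 h').1
              omega
            rw [k2 _ fun x _ => by simpa [h3f] using fun e => absurd e hmn]
            simpa [hs₃, hs₂, hs₁] using hF.args m g h' j
          · exact k1' j
      · have : factId (addFact F f) f = n + 1 := by
          rw [hadd, factId, List.idxOf_append_of_notMem hfF]
          simp [hn]
        rw [this, k3.2 _ (by simp), h13.2 _ (by simpa using hne0.symm)]
        simp [hs₁]
      · refine Mach.Agree.trans ?_ ((h13.mono le_rfl (by simp)).trans (k3.mono (by simp) (by simp)))
        exact ((Mach.Agree.set _ (by simp) _).trans (Mach.Agree.set _ (by simp) _)).trans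
          (Mach.Agree.set _ (by simp) _)
    have hopd : ∀ s' : Mach P K, s'.Reads α W → A.opds.map (Opd.eval s') = f.addr :=
      fun s' h' => Atom.eval_opds h' hA
    have hsize : ((s.set (.tmp i) (s.tab 6 f.addr)).set factReg (.nat (((s.set (.tmp i)
        (s.tab 6 f.addr)).env factReg).toNat + 1))).set (.tmp i) (.nat (((s.set (.tmp i)
        (s.tab 6 f.addr)).env factReg).toNat + 1)) = s₁ := by
      simp [hne, hF.size, Val.toNat, hs₁, hn]
    refine (WP.seq (WP.incr (WP.seq (WP.assign ?_)))).mono (t := 1 + (1 + (2 * A.opds.length + 4 +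
      (6 * 1 + 15 + 8 * ar A.pred)))) (by omega) fun _ h => h
    rw [Opd.eval_slot, Mach.env_set_self, hsize]
    refine WP.seq (WP.save (WP.seq (WP.push (k := (factIds f.1 F).length) (fun x => rfl)
      (fun x => ?_) ?_ ?_)))
    · exact Mach.env_set_of_ne _ _ (by simp [factReg])
    · have := (hF.ids f.1).1
      simp only [List.length_map] at this
      change s.tab 7 [.pred A.pred] = _ at this
      simpa [hs₁] using this
    · rw [hopd s₁ hs₁α, Opd.eval_slot, h1f]
      have e : s₃ = (((s₁.put 6 f.addr (.nat (n + 1))).put 8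
          [.nat (factIds f.1 F).length, .pred A.pred] (.nat (n + 1))).put 7 [.pred A.pred]
          (.nat ((factIds f.1 F).length + 1))).set (.tmp 0)
            (.nat ((factIds f.1 F).length + 1)) := rfl
      rw [e] at h4'
      simpa [h1f] using h4'
  · rw [hget] at h ⊢
    have hfF : f ∈ F := by
      by_contra hfF
      rw [hF.no_id f hfF] at h
      simp at h
    have hadd : addFact F f = F := by simp [addFact, hfF]
    rw [hadd]
    refine ⟨⟨hF.nodup, ?_, hF.id, hF.no_id, hF.ids, hF.args⟩, ?_, Mach.Agree.set _ (by simp) _⟩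
    · rw [Mach.env_set_of_ne _ _ hne, hF.size]
    · rw [Mach.env_set_self, hF.id _ f (List.getElem?_idxOf hfF)]
      rfl

/-- Entry `i` of the body of the ground rule `r`; a ground rule consists of the numbers of its
head and of its body facts. Beyond the body this is `0`, the number of the true fact. -/
def bodyAt (G : List (ℕ × List ℕ)) (r i : ℕ) : ℕ := (((G[r]?).map Prod.snd).getD [])[i]?.getD 0

/-- The ground rules with the fact `n` in the body; the true fact is in all bodies. -/
def watchers (G : List (ℕ × List ℕ)) (n : ℕ) : List ℕ :=
  G.zipIdx.flatMap fun x => ((0 :: x.1.2).filter (· = n)).map fun _ => x.2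

/-- The ground rules in the list `G` are in memory. -/
structure Mach.HasRules (s : Mach P K) (G : List (ℕ × List ℕ)) : Prop where
  size : s.env ruleReg = .nat G.length
  head : ∀ r g, G[r]? = some g → s.tab 10 [.nat r] = .nat g.1
  body : ∀ r i, s.tab 11 [.nat r, .nat i] = .nat (bodyAt G r i)
  watch : ∀ n, s.HasList 12 13 [.nat n] ((watchers G n).map .nat)

/-- Add a ground rule with `k` body facts; the numbers of the head and of the body facts are in
registers. -/
def Cmd.addRule (k : ℕ) : Cmd P K :=
  .seq (.save 10 [.slot ruleReg] (.slot (.tmp 20)))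
    (.seq (.seqMap (List.range k) fun i =>
        .save 11 [.slot ruleReg, .imm (.nat i)] (.slot (.tmp (21 + i))))
      (.seq (.seqMap (.imm (.nat 0) :: (List.range k).map fun i => .slot (.tmp (21 + i)))
          fun o => .push 12 13 [o] (.slot ruleReg))
        (.incr ruleReg)))

theorem watchers_append_singleton (G : List (ℕ × List ℕ)) (g : ℕ × List ℕ) (n : ℕ) :
    watchers (G ++ [g]) n = watchers G n ++ ((0 :: g.2).filter (· = n)).map fun _ => G.length := by
  simp [watchers, List.zipIdx_append]

theorem bodyAt_append_singleton (G : List (ℕ × List ℕ)) (g : ℕ × List ℕ) (r i : ℕ) :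
    bodyAt (G ++ [g]) r i = if r = G.length then g.2[i]?.getD 0 else bodyAt G r i := by
  unfold bodyAt
  split_ifs with h
  · simp [h]
  · rcases Nat.lt_or_gt_of_ne h with h | h
    · rw [List.getElem?_append_left h]
    · rw [List.getElem?_eq_none (l := G ++ [g]) (by simpa using h),
        List.getElem?_eq_none (l := G) h.le]

/-- The rule is also put on the watch list of 0, the true fact. In this way a rule without
intensional body atoms is considered during propagation, which starts with 0. -/
theorem WP.addRule {s : Mach P K} {G : List (ℕ × List ℕ)} (hG : s.HasRules G) {h : ℕ}
    {bs : List ℕ} (hh : s.env (.tmp 20) = .nat h)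
    (hbs : ∀ i b, bs[i]? = some b → s.env (.tmp (21 + i)) = .nat b) :
    WP (.addRule bs.length) (29 * bs.length + 28) (fun s' => s'.HasRules (G ++ [(h, bs)]) ∧
      s.Agree s' {10, 11, 12, 13} {.tmp 0, ruleReg}) s := by
  classical
  set n := G.length with hn
  set s₁ := s.put 10 [.nat n] (.nat h) with hs₁
  have h1r : s₁.env ruleReg = .nat n := hG.size
  refine (WP.seq (t := 6) (u := bs.length * 8 + (21 * (bs.length + 1) + 1)) (WP.save ?_)).mono
    (by omega) fun _ h => h
  have e : s.put 10 (List.map (Opd.eval s) [Opd.slot ruleReg])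
      (Opd.eval s (Opd.slot (Slot.tmp 20))) = s₁ := by
    simp [hh, hs₁, hG.size, hn]
  rw [e]
  refine WP.seq ((WP.saveAll (m := 2) (fun i => [.slot ruleReg, .imm (.nat i)])
    (fun i => .slot (.tmp (21 + i))) (by simp) (by simp)).mono (by simp) ?_)
  rintro s₂ ⟨k1, k2, k3⟩
  have h2r : s₂.env ruleReg = .nat n := by rw [k3.2 _ (by simp), h1r]
  have hb2 : ∀ i b, bs[i]? = some b → s₂.env (.tmp (21 + i)) = .nat b := fun i b hb => by
    rw [k3.2 _ (by simp)]; exact hbs i b hb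
  set os : List (Opd P K) := .imm (.nat 0) :: (List.range bs.length).map fun i =>
    .slot (.tmp (21 + i)) with hos
  have hosbs : os.map (Opd.eval s₂) = (0 :: bs).map .nat := by
    simp only [hos, List.map_cons, List.map_map, Opd.eval_imm, List.cons.injEq, true_and]
    refine List.ext_getElem (by simp) fun i h1 h2 => ?_
    simp only [List.length_map] at h2
    simp [hb2 i bs[i] (List.getElem?_eq_getElem h2)]
  have hstab : ∀ o ∈ os, ∀ s₃ : Mach P K,
      s₂.Agree s₃ {12, 13} {.tmp 0} → o.eval s₃ = o.eval s₂ := by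
    intro o ho s₃ hs₃
    simp only [hos, List.mem_cons, List.mem_map] at ho
    rcases ho with rfl | ⟨i, -, rfl⟩
    · rfl
    · exact hs₃.2 _ (by simp)
  have hpush := WP.seqMap (l := os) (c := fun o => .push 12 13 [o] (.slot ruleReg)) (fun _ => 21)
    (fun l₁ s₃ => s₂.Agree s₃ {12, 13} {.tmp 0} ∧ ∀ m : ℕ, s₃.HasList 12 13 [.nat m]
      ((watchers G m).map .nat ++ ((l₁.map (Opd.eval s₂)).filter (· = .nat m)).map
        fun _ => .nat n)) ?_ (s := s₂) ?_
  · refine WP.seq (hpush.mono (t' := 21 * (bs.length + 1)) (by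
      rw [List.map_const', List.sum_replicate]; simp [hos, mul_comm]) ?_)
    rintro s₃ ⟨l1, l2⟩
    refine WP.incr ?_
    have h3r : s₃.env ruleReg = .nat n := by rw [l1.2 _ (by simp [ruleReg]), h2r]
    refine ⟨⟨?_, ?_, ?_, ?_⟩, ?_⟩
    · simp [h3r, Val.toNat, hn]
    · intro r g hg
      rw [Mach.tab_set, l1.1 _ (by simp), k3.1 _ (by simp), hs₁, Mach.tab_put_self]
      rw [List.getElem?_append] at hg
      split_ifs at hg with hlt
      · rw [Function.update_of_ne (by simp; omega)]
        exact hG.head r g hg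
      · have hr : r = n := by
          by_contra h0
          rw [List.getElem?_eq_none (by simp; omega)] at hg
          cases hg
        subst hr
        simp only [hn, Nat.sub_self, List.getElem?_cons_zero, Option.some.injEq] at hg
        subst hg
        simp
    · intro r i
      rw [Mach.tab_set, l1.1 _ (by simp), bodyAt_append_singleton]
      by_cases hri : r = n ∧ i < bs.length
      · obtain ⟨rfl, hi⟩ := hri
        have := k1 i (by simpa using hi)
        simp only [List.map_cons, List.map_nil, Opd.eval_slot, h1r, Opd.eval_imm] at this
        rw [this, if_pos rfl, List.getElem?_eq_getElem hi]
        exact hbs i _ (List.getElem?_eq_getElem hi)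
      -- Cells beyond the body of the new rule are not written and still contain the 0 that `bodyAt`
      -- prescribes.
      · rw [k2]
        · rw [hs₁, Mach.tab_put_of_ne _ _ _ (by decide), hG.body]
          split_ifs with hr
          · subst hr
            rw [List.getElem?_eq_none (by simpa [hn] using hri)]
            simp [bodyAt]
          · rfl
        · intro j hj
          simp only [List.mem_range] at hj
          simp only [List.map_cons, List.map_nil, Opd.eval_slot, h1r, Opd.eval_imm]
          intro e
          simp only [List.cons.injEq, Val.nat.injEq, and_true] at e
          exact hri ⟨e.1, by omega⟩
    · intro m
      refine Mach.HasList.of_tab (s := s₃) ?_ rfl rfl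
      rw [watchers_append_singleton]
      convert l2 m using 1
      rw [List.map_append, hosbs, List.filter_map, List.map_map, List.map_map]
      congr 2
      refine List.filter_congr fun x _ => ?_
      simp
    · exact (((Mach.Agree.put (T := {10, 11, 12, 13}) _ (by simp) _ _).trans (k3.mono (by simp)
        (by simp))).trans
        (l1.mono (T' := {10, 11, 12, 13}) (E' := {.tmp 0, ruleReg})
          (by simp [Set.insert_subset_iff])
          (by simp))).trans (Mach.Agree.set (r := ruleReg) _ (by simp) _)
  · rintro l₁ o l₂ hl s₃ ⟨l1, l2⟩
    have ho : o ∈ os := by simp [hl]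
    obtain ⟨b, hb⟩ : ∃ b : ℕ, o.eval s₂ = .nat b := by
      have : o.eval s₂ ∈ os.map (Opd.eval s₂) := List.mem_map_of_mem ho
      rw [hosbs, List.mem_map] at this
      obtain ⟨b, -, hb⟩ := this
      exact ⟨b, hb.symm⟩
    have ho3 := (hstab o ho s₃ l1).trans hb
    have h3r : s₃.env ruleReg = .nat n := by rw [l1.2 _ (by simp [ruleReg]), h2r]
    set lst : ℕ → List (Val P K) := fun m => (watchers G m).map .nat ++
      ((l₁.map (Opd.eval s₂)).filter (· = .nat m)).map fun _ => .nat n with hlst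
    have l2' : ∀ m, s₃.HasList 12 13 [.nat m] (lst m) := l2
    refine (WP.push (k := (lst b).length) (fun x => ?_) (fun x => ?_) ?_ ?_).mono (by simp)
      fun _ h => h
    · have := hstab o ho (s₃.set (.tmp 0) x) (l1.trans (Mach.Agree.set _ (by simp) _))
      simp [this, ho3, hb]
    · exact Mach.env_set_of_ne _ _ (by simp [ruleReg])
    · simpa [ho3] using (l2' b).1
    · refine ⟨l1.trans (((Mach.Agree.put _ (by simp) _ _).trans
        (Mach.Agree.put _ (by simp) _ _)).trans (Mach.Agree.set _ (by simp) _)), fun m => ?_⟩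
      have e : (watchers G m).map .nat ++ (((l₁ ++ [o]).map (Opd.eval s₂)).filter
          (· = .nat m)).map (fun _ => .nat n) = lst m ++ if b = m then [Val.nat n] else [] := by
        by_cases hbm : b = m <;> simp [hlst, hb, hbm]
      rw [e]
      simp only [List.map_cons, List.map_nil, ho3, Opd.eval_slot, h3r]
      by_cases hbm : b = m
      · subst hbm
        simpa using (l2' b).push (by decide) (.nat n) (.nat ((lst b).length + 1)) (.tmp 0)
      · rw [if_neg hbm, List.append_nil]
        exact (l2' m).push_of_ne (by decide) (by simpa using fun e => hbm e.symm) _ _ _ _ _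
  · refine ⟨.refl _ _ _, fun m => ?_⟩
    simpa using (hG.watch m).of_tab (s' := s₂) (by rw [k3.1 _ (by simp)]; simp [hs₁])
      (by rw [k3.1 _ (by simp)]; simp [hs₁])

/-! ### Registering the instances of a rule -/

/-- The membership tables of the predicates in `S` are in memory. -/
def Mach.HasMarks (s : Mach P K) (D : Database ar K) (S : Set P) : Prop :=
  ∀ p ∈ S, ∀ t : Fin (ar p) → K,
    (t ∈ D.rel p → s.tab 2 (Fact.addr ⟨p, t⟩) = .nat 1) ∧
    (t ∉ D.rel p → s.tab 2 (Fact.addr ⟨p, t⟩) = .nat 0)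

def Cmd.checkFacts (c : Cmd P K) : List (Atom ar K) → Cmd P K
  | [] => c
  | A :: l => .seq (.get (.tmp 0) 2 A.opds)
      (.ifEq (.slot (.tmp 0)) (.imm (.nat 1)) (checkFacts c l) .skip)

def Atom.InData (D : Database ar K) (α : ℕ → K) (A : Atom ar K) : Prop :=
  (A.ground α).2 ∈ D.rel A.pred

open Classical in
theorem WP.checkFacts {D : Database ar K} {S : Set P} {α : ℕ → K} {W : List ℕ} {a : ℕ}
    {c : Cmd P K} {t : ℕ} {Q : Mach P K → Prop} (l : List (Atom ar K)) : ∀ s : Mach P K,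
    s.Reads α W → s.HasMarks D S → (∀ A ∈ l, A.pred ∈ S ∧ (∀ y ∈ A.vars, y ∈ W) ∧ ar A.pred ≤ a) →
    ((∀ A ∈ l, A.InData D α) → ∀ s', s.Agree s' ∅ {.tmp 0} → WP c t Q s') →
    ((¬ ∀ A ∈ l, A.InData D α) → ∀ s', s.Agree s' ∅ {.tmp 0} → Q s') →
    WP (.checkFacts c l) (l.length * (2 * a + 8) + t) Q s := by
  induction l with
  | nil =>
    intro s _ _ _ h _
    exact (h (by simp) s (.refl _ _ _)).mono (by simp) fun _ h => h
  | cons A l ih =>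
    intro s hα hs hl h h'
    obtain ⟨hA1, hA2, hA3⟩ := hl A (by simp)
    have hmark := hs A.pred hA1 (A.ground α).2
    have hlen : A.opds.length = ar A.pred + 1 := by simp [Atom.opds]
    refine (WP.seq (WP.get (WP.ifEq (t := l.length * (2 * a + 8) + t) (fun heq => ?_)
      (fun hne => ?_)))).mono ?_ fun _ h => h
    · rw [Atom.eval_opds hα hA2] at heq ⊢
      have hv : A.InData D α := by
        by_contra hv
        have := hmark.2 hv
        change s.tab 2 (Fact.addr (A.ground α)) = _ at this
        rw [this] at heq
        simp at heq
      have h01 : s.Agree (s.set (.tmp 0) (s.tab 2 (Fact.addr (A.ground α)))) ∅ {.tmp 0} :=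
        Mach.Agree.set _ (by simp) _
      refine ih _ (fun y hy => ?_) (fun p hp => hs p hp) (fun B hB => hl B (by simp [hB]))
        (fun hall s' hs' => h (by simpa [hv] using hall) s' (h01.trans hs'))
        (fun hall s' hs' => h' (fun hall' => hall fun B hB => hall' B (by simp [hB])) s'
          (h01.trans hs'))
      simpa using hα y hy
    · rw [Atom.eval_opds hα hA2] at hne ⊢
      refine (WP.skip (h' (fun hall => hne ?_) _ (Mach.Agree.set _ (by simp) _))).mono
        (Nat.zero_le _) fun _ h => h
      have := hmark.1 (hall A (by simp))
      change s.tab 2 (Fact.addr (A.ground α)) = _ at this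
      simp [this]
    · simp only [List.length_cons, hlen]
      ring_nf
      omega

/-- The effect of registering the instance given by `α` of a rule with the given head and body. -/
noncomputable def register (D : Database ar K) (edb : List (Atom ar K)) (H : Atom ar K)
    (Bs : List (Atom ar K)) (a : List (Fact ar K) × List (ℕ × List ℕ)) (α : ℕ → K) :
    List (Fact ar K) × List (ℕ × List ℕ) :=
  open Classical in
  if ∀ A ∈ edb, A.InData D α then
    let F := ((H :: Bs).map (Atom.ground α)).foldl addFact a.1
    (F, a.2 ++ [(factId F (H.ground α), Bs.map fun B => factId F (B.ground α))])
  else a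

def Cmd.register (edb : List (Atom ar K)) (H : Atom ar K) (Bs : List (Atom ar K)) : Cmd P K :=
  .checkFacts (.seq (.seqMap (H :: Bs).zipIdx fun x => .getId x.1 (.tmp (20 + x.2)))
    (.addRule Bs.length)) edb

/-- The facts and the ground rules in memory. -/
def Mach.HasInstances (D : Database ar K) (S : Set P) (a : List (Fact ar K) × List (ℕ × List ℕ))
    (s : Mach P K) : Prop :=
  s.HasFacts a.1 ∧ s.HasRules a.2 ∧ s.HasMarks D S

theorem Mach.HasFacts.of_agree {s s' : Mach P K} {F : List (Fact ar K)} (h : s.HasFacts F)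
    {T : Set ℕ} {E : Set Slot} (hs : s.Agree s' T E) (hT : ∀ n ∈ T, n < 6 ∨ 9 < n)
    (hE : factReg ∉ E) : s'.HasFacts F := by
  have ht : ∀ n, 6 ≤ n → n ≤ 9 → s'.tab n = s.tab n := fun n h1 h2 =>
    hs.1 n fun h => by have := hT n h; omega
  refine ⟨h.nodup, by rw [hs.2 _ hE, h.size], ?_, ?_, fun q => (h.ids q).of_tab ?_ ?_, ?_⟩
  · rw [ht 6 (by omega) (by omega)]; exact h.id
  · rw [ht 6 (by omega) (by omega)]; exact h.no_id
  · exact ht 7 (by omega) (by omega)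
  · exact ht 8 (by omega) (by omega)
  · rw [ht 9 (by omega) (by omega)]; exact h.args

theorem Mach.HasRules.of_agree {s s' : Mach P K} {G : List (ℕ × List ℕ)} (h : s.HasRules G)
    {T : Set ℕ} {E : Set Slot} (hs : s.Agree s' T E) (hT : ∀ n ∈ T, n < 10 ∨ 13 < n)
    (hE : ruleReg ∉ E) : s'.HasRules G := by
  have ht : ∀ n, 10 ≤ n → n ≤ 13 → s'.tab n = s.tab n := fun n h1 h2 =>
    hs.1 n fun h => by have := hT n h; omega
  refine ⟨by rw [hs.2 _ hE, h.size], ?_, ?_, fun q => (h.watch q).of_tab ?_ ?_⟩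
  · rw [ht 10 (by omega) (by omega)]; exact h.head
  · rw [ht 11 (by omega) (by omega)]; exact h.body
  · exact ht 12 (by omega) (by omega)
  · exact ht 13 (by omega) (by omega)

/-- The head and the intensional body atoms are numbered one after the other; a number stored early
stays correct by `factId_of_prefix`. Only the tables 6 to 13 are written, which leaves the relations
and the tries intact. Instances reached more than once are recorded again, as the final bound counts
leaves and not distinct instances. -/
theorem LeafSpec.register {D : Database ar K} {S : Set P} {W : List ℕ} {edb Bs : List (Atom ar K)}
    {H : Atom ar K} {a b : ℕ} (hedb : ∀ A ∈ edb, A.pred ∈ S)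
    (hvars : ∀ A ∈ H :: (edb ++ Bs), ∀ y ∈ A.vars, y ∈ W)
    (har : ∀ A ∈ H :: (edb ++ Bs), ar A.pred ≤ a) (hb : edb.length + Bs.length ≤ b) :
    LeafSpec (Cmd.register edb H Bs) ((b + 1) * (22 * a + 100)) W (Set.Ioo 5 14)
      (Set.range Slot.tmp) (Mach.HasInstances D S) (register D edb H Bs) := by
  classical
  have hzip : ∀ x ∈ (H :: Bs).zipIdx, x.1 ∈ H :: (edb ++ Bs) := by
    intro x hx
    have := List.mem_of_getElem? (List.mem_zipIdx_iff_getElem?.1 hx)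
    simp only [List.mem_cons, List.mem_append] at this ⊢
    tauto
  refine ⟨?_, ?_, fun n hn => hn.1, by simp⟩
  · rintro α ⟨F, G⟩ s hα ⟨hF, hG, hM⟩
    refine (WP.checkFacts (D := D) (S := S) (W := W) (a := a) (α := α)
      (t := (Bs.length + 1) * (20 * a + 60) + (29 * Bs.length + 28)) edb s hα hM
      (fun A hA => ⟨hedb A hA, hvars A (by simp [hA]), har A (by simp [hA])⟩)
      (fun hall s₁ hs₁ => ?_) (fun hall s₁ hs₁ => ?_)).mono ?_ fun _ h => h
    · have hα₁ : s₁.Reads α W := fun y hy => by rw [hs₁.2 _ (by simp)]; exact hα y hy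
      have hids := WP.seqMap (l := (H :: Bs).zipIdx)
        (c := fun x : Atom ar K × ℕ => Cmd.getId x.1 (.tmp (20 + x.2)))
        (fun x => 20 * ar x.1.pred + 60)
        (fun l₁ s₂ => s₂.HasFacts ((l₁.map fun x => x.1.ground α).foldl addFact F) ∧
          (∀ x ∈ l₁, s₂.env (.tmp (20 + x.2)) = .nat (factId
            ((l₁.map fun x => x.1.ground α).foldl addFact F) (x.1.ground α))) ∧
          s₁.Agree s₂ {6, 7, 8, 9} ({.tmp 0, factReg} ∪ {r | ∃ i, 20 ≤ i ∧ r = .tmp i}))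
        ?_ (s := s₁) ?_
      · refine WP.seq (hids.mono (t' := (Bs.length + 1) * (20 * a + 60)) ?_ ?_)
        · have : ((H :: Bs).zipIdx.map fun x => 20 * ar x.1.pred + 60).length =
            Bs.length + 1 := by simp
          rw [← this, ← smul_eq_mul]
          refine List.sum_le_card_nsmul _ _ fun k hk => ?_
          obtain ⟨x, hx, rfl⟩ := List.mem_map.1 hk
          have := har x.1 (hzip x hx)
          omega
        · rintro s₂ ⟨k1, k2, k3⟩
          have e : (H :: Bs).zipIdx.map (fun x => x.1.ground α) =
              (H :: Bs).map (Atom.ground α) := by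
            rw [← List.zipIdx_map_fst 0 (H :: Bs), List.map_map, List.zipIdx_map_fst]
            rfl
          rw [e] at k1 k2
          set F' := ((H :: Bs).map (Atom.ground α)).foldl addFact F with hF'
          have hs₂G : s₂.HasRules G := (hG.of_agree hs₁ (by simp) (by simp [ruleReg])).of_agree k3
            (by simp) (by simp [ruleReg, factReg])
          have := WP.addRule (s := s₂) (h := factId F' (H.ground α))
            (bs := Bs.map fun B => factId F' (B.ground α)) hs₂G
              (k2 (H, 0) (by simp [List.zipIdx_cons])) (fun i c hc => ?_)
          · rw [List.length_map] at this
            refine this.mono le_rfl ?_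
            rintro s₃ ⟨l1, l2⟩
            have h23 : s.Agree s₃ (Set.Ioo 5 14) (Set.range Slot.tmp) := by
              refine ((hs₁.mono (by simp) (by simp)).trans (k3.mono
                (by simp [Set.insert_subset_iff]) ?_)).trans
                (l2.mono (by simp [Set.insert_subset_iff]) ?_)
              · rintro r (hr | ⟨i, -, rfl⟩)
                · rcases hr with rfl | rfl <;> simp [factReg]
                · simp
              · rintro r (rfl | rfl) <;> simp [ruleReg]
            refine ⟨?_, h23⟩
            rw [Datalog.register, if_pos hall]
            refine ⟨k1.of_agree l2 (by simp) (by simp [factReg, ruleReg]), l1, fun p hp t => ?_⟩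
            rw [h23.1 2 (by simp)]
            exact hM p hp t
          · simp only [List.getElem?_map, Option.map_eq_some_iff] at hc
            obtain ⟨B, hB, rfl⟩ := hc
            have := k2 (B, i + 1) (List.mem_zipIdx_iff_getElem?.2 (by simpa using hB))
            rw [← this]
            congr 2
            ring
      · rintro l₁ x l₂ hl s₂ ⟨k1, k2, k3⟩
        have hx : x ∈ (H :: Bs).zipIdx := by simp [hl]
        have hxm := hzip x hx
        have hα₂ : s₂.Reads α W := fun y hy => by
          rw [k3.2 _ (by simp [factReg])]
          exact hα₁ y hy
        refine (WP.getId hα₂ (hvars _ hxm) k1 (i := 20 + x.2) (by omega)).mono le_rfl ?_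
        rintro s₃ ⟨l1, l2, l3⟩
        have hpre := prefix_addFact ((l₁.map fun x => x.1.ground α).foldl addFact F) (x.1.ground α)
        simp only [List.map_append, List.map_cons, List.map_nil, List.foldl_append,
          List.foldl_cons, List.foldl_nil]
        refine ⟨l1, fun y hy => ?_, k3.trans (l3.mono le_rfl ?_)⟩
        · rcases List.mem_append.1 hy with hy' | hy'
          · have hyx : y.2 ≠ x.2 := by
              intro e
              have hnd : (((H :: Bs).zipIdx).map Prod.snd).Nodup := by
                rw [List.zipIdx_map_snd]
                exact List.nodup_range' 
              rw [hl, List.map_append, List.nodup_append] at hnd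
              exact hnd.2.2 y.2 (List.mem_map_of_mem hy') x.2 (by simp) e
            rw [l3.2 _ (by simp [factReg]; omega), k2 y hy', factId_of_prefix hpre]
            rw [mem_foldl_addFact]
            exact .inr (List.mem_map.2 ⟨y, hy', rfl⟩)
          · simp only [List.mem_singleton] at hy'
            subst hy'
            exact l2
        · rintro r (rfl | rfl | rfl)
          · simp
          · simp
          · exact .inr ⟨_, by omega, rfl⟩
      · refine ⟨?_, by simp, .refl _ _ _⟩
        exact hF.of_agree hs₁ (by simp) (by simp [factReg])
    · rw [Datalog.register, if_neg hall]
      refine ⟨⟨hF.of_agree hs₁ (by simp) (by simp [factReg]),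
        hG.of_agree hs₁ (by simp) (by simp [ruleReg]), fun p hp t => ?_⟩,
          hs₁.mono (by simp) (by simp)⟩
      rw [hs₁.1 2 (by simp)]
      exact hM p hp t
    · have h1 : edb.length * (2 * a + 8) + Bs.length * (20 * a + 89) ≤ b * (22 * a + 100) := by
        nlinarith
      nlinarith
  · rintro ⟨F, G⟩ s s' vs ⟨h1, h2, h3⟩ hs
    refine ⟨h1.of_agree hs (by simp) ?_, h2.of_agree hs (by simp) ?_, fun p hp t => ?_⟩
    · simp [searchRegs, factReg]
    · simp [searchRegs, ruleReg]
    · rw [hs.1 2 (by simp)]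
      exact h3 p hp t

end

/-! ### Propagation -/

/-- The facts derived by ground rules, by number. -/
inductive Derivable (G : List (ℕ × List ℕ)) : ℕ → Prop
  | top : Derivable G 0
  | rule (g : ℕ × List ℕ) (hg : g ∈ G) (h : ∀ b ∈ g.2, Derivable G b) : Derivable G g.1

theorem mem_watchers {G : List (ℕ × List ℕ)} {n r : ℕ} :
    r ∈ watchers G n ↔ ∃ g, G[r]? = some g ∧ n ∈ 0 :: g.2 := by
  simp only [watchers, List.mem_flatMap, List.mem_map, List.mem_filter, decide_eq_true_eq]
  constructor
  · rintro ⟨⟨g, i⟩, hx, b, ⟨hb, rfl⟩, rfl⟩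
    exact ⟨g, List.mem_zipIdx_iff_getElem?.1 hx, hb⟩
  · rintro ⟨g, hg, hn⟩
    exact ⟨(g, r), List.mem_zipIdx_iff_getElem?.2 hg, n, ⟨hn, rfl⟩, rfl⟩

/-- Each occurrence in a body, including the additional 0, accounts for one entry of one watch list.
This makes propagation linear in the size of the ground rules. -/
theorem sum_length_watchers_le (s : Finset ℕ) (G : List (ℕ × List ℕ)) {M : ℕ}
    (h : ∀ g ∈ G, g.2.length ≤ M) : ∑ n ∈ s, (watchers G n).length ≤ G.length * (M + 1) := by
  induction G using List.reverseRecOn with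
  | nil => simp [watchers]
  | append_singleton G g ih =>
    simp only [watchers_append_singleton, List.length_append, List.length_map,
      Finset.sum_add_distrib, List.length_singleton]
    have h1 := ih fun g hg => h g (by simp [hg])
    have h2 := sum_length_filter_le s (0 :: g.2) id
    have h3 := h g (by simp)
    simp only [id, List.length_cons] at h2
    rw [add_mul]
    omega

section

variable {P : Type u} {ar : P → ℕ} {K : Type v}

/-- The facts in the list `Q` are marked and in the queue. -/
structure Mach.HasQueue (s : Mach P K) (Q : List ℕ) : Prop where
  nodup : Q.Nodup
  size : s.env (.lim 0) = .nat Q.length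
  entry : ∀ i n : ℕ, Q[i]? = some n → s.tab 15 [.nat i] = .nat n
  mark : ∀ n ∈ Q, s.tab 14 [.nat n] = .nat 1
  no_mark : ∀ n ∉ Q, s.tab 14 [.nat n] = .nat 0

theorem Mach.HasQueue.of_agree {s s' : Mach P K} {Q : List ℕ} (h : s.HasQueue Q) {T : Set ℕ}
    {E : Set Slot} (hs : s.Agree s' T E) (hT : 14 ∉ T ∧ 15 ∉ T) (hE : .lim 0 ∉ E) :
    s'.HasQueue Q := by
  refine ⟨h.nodup, by rw [hs.2 _ hE, h.size], ?_, ?_, ?_⟩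
  · rw [hs.1 15 hT.2]; exact h.entry
  · rw [hs.1 14 hT.1]; exact h.mark
  · rw [hs.1 14 hT.1]; exact h.no_mark

theorem Mach.HasQueue.push {s : Mach P K} {Q : List ℕ} (h : s.HasQueue Q) {n : ℕ} (hn : n ∉ Q) :
    (((s.put 14 [.nat n] (.nat 1)).put 15 [.nat Q.length] (.nat n)).set (.lim 0)
      (.nat (Q.length + 1))).HasQueue (Q ++ [n]) := by
  refine ⟨?_, by simp, fun i m hm => ?_, fun m hm => ?_, fun m hm => ?_⟩
  · rw [List.nodup_append]
    exact ⟨h.nodup, by simp, fun a ha b hb e => hn (by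
      simp only [List.mem_singleton] at hb; rw [← hb, ← e]; exact ha)⟩
  · rcases lt_trichotomy i Q.length with hi | rfl | hi
    · rw [List.getElem?_append_left hi] at hm
      simpa [Function.update_apply, hi.ne] using h.entry i m hm
    · simpa [eq_comm] using hm
    · rw [List.getElem?_eq_none (by simpa using hi)] at hm
      cases hm
  · by_cases hmn : m = n
    · subst hmn; simp
    · simpa [Function.update_apply, hmn] using h.mark m (by simpa [hmn] using hm)
  · simp only [List.mem_append, List.mem_singleton, not_or] at hm
    simpa [Function.update_apply, hm.2] using h.no_mark m hm.1

namespace Cmd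

def checkBody (c : Cmd P K) : List ℕ → Cmd P K
  | [] => c
  | i :: l => .seq (.get (.tmp 4) 11 [.slot (.tmp 3), .imm (.nat i)])
      (.seq (.get (.tmp 5) 14 [.slot (.tmp 4)])
        (.ifEq (.slot (.tmp 5)) (.imm (.nat 1)) (checkBody c l) .skip))

def derive : Cmd P K :=
  .seq (.get (.tmp 4) 10 [.slot (.tmp 3)]) (.seq (.get (.tmp 5) 14 [.slot (.tmp 4)])
    (.ifEq (.slot (.tmp 5)) (.imm (.nat 1)) .skip
      (.seq (.save 14 [.slot (.tmp 4)] (.imm (.nat 1)))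
        (.seq (.save 15 [.slot (.lim 0)] (.slot (.tmp 4))) (.incr (.lim 0))))))

/-- Process the queue of derived facts; rules have at most `M` body facts. -/
def propagate (M : ℕ) : Cmd P K :=
  .seq (.save 14 [.imm (.nat 0)] (.imm (.nat 1))) (.seq (.save 15 [.imm (.nat 0)] (.imm (.nat 0)))
    (.seq (.assign (.lim 0) (.imm (.nat 1))) (.seq (.assign (.idx 0) (.imm (.nat 0)))
      (.whileLt (.idx 0) (.lim 0)
        (.seq (.get (.tmp 2) 15 [.slot (.idx 0)]) (.seq (.incr (.idx 0))
          (.seq (.get (.lim 1) 12 [.slot (.tmp 2)])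
            (.forLt (.idx 1) (.lim 1)
              (.seq (.get (.tmp 3) 13 [.slot (.idx 1), .slot (.tmp 2)])
                (checkBody derive (List.range M)))))))))))

end Cmd

theorem WP.checkBody {c : Cmd P K} {t : ℕ} {R : Mach P K → Prop} {G : List (ℕ × List ℕ)}
    {Q : List ℕ} {r : ℕ} (l : List ℕ) : ∀ s : Mach P K, s.HasRules G → s.HasQueue Q →
      s.env (.tmp 3) = .nat r →
      ((∀ i ∈ l, bodyAt G r i ∈ Q) → ∀ s', s.Agree s' ∅ {.tmp 4, .tmp 5} → WP c t R s') →
      ((¬ ∀ i ∈ l, bodyAt G r i ∈ Q) → ∀ s', s.Agree s' ∅ {.tmp 4, .tmp 5} → R s') →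
      WP (.checkBody c l) (l.length * 15 + t) R s := by
  induction l with
  | nil =>
    intro s _ _ _ h _
    exact (h (by simp) s (.refl _ _ _)).mono (by simp) fun _ h => h
  | cons i l ih =>
    intro s hG hQ hr h h'
    refine (WP.seq (u := 8 + (l.length * 15 + t)) (WP.get ?_)).mono ?_ fun _ h => h
    swap
    · simp only [List.length_cons, List.length_nil]
      ring_nf
      omega
    have e1 : s.tab 11 ([.slot (.tmp 3), .imm (.nat i)].map (Opd.eval s)) =
        .nat (bodyAt G r i) := by simp [hr, hG.body]
    rw [e1]
    refine (WP.seq (u := l.length * 15 + t + 3) (WP.get ?_)).mono (t := 5 + (l.length * 15 + t + 3))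
      (by omega) fun _ h => h
    set s₁ := s.set (.tmp 4) (.nat (bodyAt G r i)) with hs₁
    have e2 : s₁.tab 14 ([.slot (.tmp 4)].map (Opd.eval s₁)) = s.tab 14 [.nat (bodyAt G r i)] := by
      simp [hs₁]
    rw [e2]
    have hag : s.Agree (s₁.set (.tmp 5) (s.tab 14 [.nat (bodyAt G r i)])) ∅ {.tmp 4, .tmp 5} :=
      (Mach.Agree.set _ (by simp) _).trans (Mach.Agree.set _ (by simp) _)
    refine WP.ifEq (fun heq => ?_) fun hne => ?_
    · have hb : bodyAt G r i ∈ Q := by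
        by_contra hb
        simp [hQ.no_mark _ hb] at heq
      exact ih _ (hG.of_agree hag (by simp) (by simp [ruleReg])) (hQ.of_agree hag (by simp)
        (by simp))
        (by rw [hag.2 _ (by simp), hr]) (fun hall s' hs' => h (by simpa [hb] using hall) s'
          (hag.trans hs'))
        (fun hall s' hs' => h' (fun hall' => hall fun j hj => hall' j (by simp [hj])) s'
          (hag.trans hs'))
    · refine (WP.skip (h' (fun hall => ?_) _ hag)).mono (Nat.zero_le _) fun _ h => h
      simp [hQ.mark _ (hall i (by simp))] at hne

theorem WP.derive {s : Mach P K} {G : List (ℕ × List ℕ)} {Q : List ℕ} {r : ℕ} {g : ℕ × List ℕ}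
    (hG : s.HasRules G) (hQ : s.HasQueue Q) (hr : s.env (.tmp 3) = .nat r) (hg : G[r]? = some g) :
    WP .derive 26 (fun s' => ∃ Q', s'.HasQueue Q' ∧ (Q' = Q ∧ g.1 ∈ Q ∨ Q' = Q ++ [g.1]) ∧
      s.Agree s' {14, 15} {.tmp 4, .tmp 5, .lim 0}) s := by
  have e1 : s.tab 10 ([.slot (.tmp 3)].map (Opd.eval s)) = .nat g.1 := by simp [hr, hG.head r g hg]
  refine (WP.seq (u := 21) (WP.get ?_)).mono (by simp) fun _ h => h
  rw [e1]
  refine (WP.seq (u := 16) (WP.get ?_)).mono (by simp) fun _ h => h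
  set s₁ := s.set (.tmp 4) (.nat g.1) with hs₁
  have e2 : s₁.tab 14 ([.slot (.tmp 4)].map (Opd.eval s₁)) = s.tab 14 [.nat g.1] := by simp [hs₁]
  rw [e2]
  set s₂ := s₁.set (.tmp 5) (s.tab 14 [.nat g.1]) with hs₂
  have hag : s.Agree s₂ ∅ {.tmp 4, .tmp 5} :=
    (Mach.Agree.set _ (by simp) _).trans (Mach.Agree.set _ (by simp) _)
  have hQ₂ : s₂.HasQueue Q := hQ.of_agree hag (by simp) (by simp)
  have h4 : s₂.env (.tmp 4) = .nat g.1 := by simp [hs₂, hs₁]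
  refine WP.ifEq (t := 13) (fun heq => ?_) fun hne => ?_
  · have hb : g.1 ∈ Q := by
      by_contra hb
      simp [hs₂, hQ.no_mark _ hb] at heq
    exact (WP.skip ⟨Q, hQ₂, .inl ⟨rfl, hb⟩, hag.mono (by simp) (by
      intro x; simp; tauto)⟩).mono (Nat.zero_le _) fun _ h => h
  · have hb : g.1 ∉ Q := by
      intro hb
      simp [hs₂, hQ.mark _ hb] at hne
    refine (WP.seq (WP.save (WP.seq (WP.save (WP.incr ?_))))).mono (by simp) fun _ h => h
    refine ⟨Q ++ [g.1], ?_, .inr rfl, ?_⟩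
    · simpa [h4, hQ₂.size, Val.toNat] using hQ₂.push hb
    · exact (((hag.mono (T' := {14, 15}) (E' := {.tmp 4, .tmp 5, .lim 0}) (by simp) (by
        intro x; simp; tauto)).trans (Mach.Agree.put (n := 14) _ (by simp) _ _)).trans
          (Mach.Agree.put (n := 15) _ (by simp) _ _)).trans (Mach.Agree.set (r := .lim 0) _
            (by simp) _)

/-- No body length has to be stored: always `M` positions are tested, those beyond the body read 0,
and 0 is in the queue. -/
theorem bodyAt_mem_iff {G : List (ℕ × List ℕ)} {r M : ℕ} {g : ℕ × List ℕ} (hg : G[r]? = some g)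
    (hM : g.2.length ≤ M) (Q : List ℕ) (h0 : 0 ∈ Q) :
    (∀ i ∈ List.range M, bodyAt G r i ∈ Q) ↔ ∀ b ∈ g.2, b ∈ Q := by
  simp only [bodyAt, hg, Option.map_some, Option.getD_some, List.mem_range]
  constructor
  · intro h b hb
    obtain ⟨i, hi⟩ := List.mem_iff_getElem?.1 hb
    have := (List.getElem?_eq_some_iff.1 hi).1
    simpa [hi] using h i (by omega)
  · intro h i _
    cases hi : g.2[i]? with
    | none => simpa using h0
    | some b => exact h b (List.mem_of_getElem? hi)

/-- Let `Pd` be the processed initial part of the queue `Q`. The queue contains derivable facts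
only, and each rule whose body lies in `Pd` has its head in `Q`; once `Pd = Q`, the queue is closed
under the rules and hence complete. The time left is the sum of `cost n` over the numbers below `B`
that are not yet processed, where `cost n` pays for scanning the watch list of `n`. Since the queue
has no duplicates, each number is paid for once. -/
theorem WP.propagate {s : Mach P K} {G : List (ℕ × List ℕ)} {M B : ℕ} (hG : s.HasRules G)
    (hM : ∀ g ∈ G, g.2.length ≤ M) (hB : ∀ g ∈ G, g.1 < B) (hB0 : 0 < B)
    (h14 : ∀ n : ℕ, s.tab 14 [.nat n] = .nat 0) :
    WP (.propagate M) (14 * B + (15 * M + 35) * (G.length * (M + 1)) + 15)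
      (fun s' => (∀ n, (Derivable G n → s'.tab 14 [.nat n] = .nat 1) ∧
        (¬ Derivable G n → s'.tab 14 [.nat n] = .nat 0)) ∧
        s.Agree s' {14, 15} ({.idx 0, .lim 0, .idx 1, .lim 1} ∪ {r | ∃ n < 10, r = .tmp n})) s := by
  classical
  set E : Set Slot := {.idx 0, .lim 0, .idx 1, .lim 1} ∪ {r | ∃ n < 10, r = .tmp n} with hE
  have hErule : ruleReg ∉ E := by simp [hE, ruleReg]
  set cost : ℕ → ℕ := fun n => 14 + (15 * M + 35) * (watchers G n).length with hcost
  set I : ℕ → Mach P K → Prop := fun m s' => ∃ Pd Q : List ℕ, s'.HasQueue Q ∧ Pd <+: Q ∧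
    s'.env (.idx 0) = .nat Pd.length ∧ (∀ n ∈ Q, Derivable G n ∧ n < B) ∧ 0 ∈ Q ∧
    (∀ (r : ℕ) (g : ℕ × List ℕ), G[r]? = some g → (∀ b ∈ 0 :: g.2,
      b ∈ Pd) → g.1 ∈ Q) ∧ s.Agree s' {14, 15} E ∧
    m = ∑ n ∈ Finset.range B with n ∉ Pd, cost n with hI
  have hloop : ∀ s₁, I (∑ n ∈ Finset.range B, cost n) s₁ → WP (Cmd.whileLt (.idx 0) (.lim 0)
        (.seq (.get (.tmp 2) 15 [.slot (.idx 0)]) (.seq (.incr (.idx 0))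
          (.seq (.get (.lim 1) 12 [.slot (.tmp 2)])
            (.forLt (.idx 1) (.lim 1)
              (.seq (.get (.tmp 3) 13 [.slot (.idx 1), .slot (.tmp 2)])
                (Cmd.checkBody Cmd.derive (List.range M))))))))
      (∑ n ∈ Finset.range B, cost n + 1)
      (fun s' => ¬ (s'.env (.idx 0)).toNat < (s'.env (.lim 0)).toNat ∧ ∃ m', I m' s') s₁ := by
    intro s₁ hs₁
    refine WP.whileLt I ?_ hs₁
    rintro m s₂ ⟨Pd, Q, hQ, hPd, hidx, hsound, h0, hclosed, hag, rfl⟩ hlt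
    simp only [hidx, hQ.size, Val.toNat] at hlt
    set n := Q[Pd.length] with hn
    have hQn : Q[Pd.length]? = some n := List.getElem?_eq_getElem hlt
    have hnQ : n ∈ Q := List.getElem_mem hlt
    have hPd' : Pd ++ [n] <+: Q := by
      obtain ⟨c, hc⟩ := hPd
      subst hc
      cases c with
      | nil => simp at hlt
      | cons d c => refine ⟨c, by simp [hn]⟩
    have hnPd : n ∉ Pd := by
      have := hPd'.sublist.nodup hQ.nodup
      rw [List.nodup_append] at this
      exact fun h => this.2.2 n h n (by simp) rfl
    set w := watchers G n with hw
    have hsum : ∑ k ∈ Finset.range B with k ∉ Pd, cost k =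
        cost n + ∑ k ∈ Finset.range B with k ∉ Pd ++ [n], cost k := by
      have : (Finset.range B).filter (fun k => k ∉ Pd) =
          insert n ((Finset.range B).filter fun k => k ∉ Pd ++ [n]) := by
        ext k
        simp only [Finset.mem_filter, Finset.mem_insert, List.mem_append, List.mem_singleton,
          Finset.mem_range, not_or]
        have := (hsound n hnQ).2
        by_cases hk : k = n
        · subst hk; simp [hnPd, this]
        · simp [hk]
      rw [this, Finset.sum_insert (by simp)]
    refine ⟨13 + (15 * M + 35) * w.length, ?_⟩
    set s₃ := ((s₂.set (.tmp 2) (.nat n)).set (.idx 0) (.nat (Pd.length + 1))).set (.lim 1)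
      (.nat w.length) with hs₃
    have h23 : s₂.Agree s₃ ∅ {.tmp 2, .idx 0, .lim 1} :=
      ((Mach.Agree.set _ (by simp) _).trans (Mach.Agree.set _ (by simp) _)).trans
        (Mach.Agree.set _ (by simp) _)
    have hE3 : {Slot.tmp 2, Slot.idx 0, Slot.lim 1} ⊆ E := by
      rintro x (rfl | rfl | rfl) <;> simp [hE]
    have hag3 : s.Agree s₃ {14, 15} E := hag.trans (h23.mono (by simp) hE3)
    have hwatch : s.HasList 12 13 [.nat n] (w.map .nat) := hG.watch n
    -- During the scan of the watch list of `n`, a rule whose body lies in `Pd ++ [n]` either has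
    -- its head in the queue or is still to come in the list.
    have hfor := WP.forLt (i := .idx 1) (l := .lim 1) (by simp) (n := w.length)
      (c := .seq (.get (.tmp 3) 13 [.slot (.idx 1), .slot (.tmp 2)])
        (Cmd.checkBody Cmd.derive (List.range M))) (fun _ => 15 * M + 33)
      (fun j s' => ∃ Q : List ℕ, s'.HasQueue Q ∧ Pd ++ [n] <+: Q ∧
        s'.env (.idx 0) = .nat (Pd.length + 1) ∧ s'.env (.tmp 2) = .nat n ∧
        (∀ n ∈ Q, Derivable G n ∧ n < B) ∧ 0 ∈ Q ∧
        (∀ (r : ℕ) (g : ℕ × List ℕ), G[r]? = some g → (∀ b ∈ 0 :: g.2,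
          b ∈ Pd ++ [n]) → g.1 ∈ Q ∨ r ∈ w.drop j) ∧
        s.Agree s' {14, 15} E) (s := s₃) (by simp [hs₃]) ?_ ?_
    · refine (WP.seq (t := 5) (u := 1 + (5 + ((15 * M + 35) * w.length + 2))) (WP.get ?_)).mono
        (by omega) fun _ h => h
      have e1 : s₂.tab 15 ([.slot (.idx 0)].map (Opd.eval s₂)) = .nat n := by
        simp [hidx, hQ.entry _ _ hQn]
      rw [e1]
      refine WP.seq (WP.incr (WP.seq (WP.get ?_)))
      have e2 : (((s₂.set (.tmp 2) (.nat n)).set (.idx 0) (.nat ((((s₂.set (.tmp 2)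
          (.nat n)).env (.idx 0)).toNat + 1)))).set (.lim 1)
          (((s₂.set (.tmp 2) (.nat n)).set (.idx 0) (.nat ((((s₂.set (.tmp 2)
          (.nat n)).env (.idx 0)).toNat + 1)))).tab 12 ([.slot (.tmp 2)].map (Opd.eval
          ((s₂.set (.tmp 2) (.nat n)).set (.idx 0) (.nat ((((s₂.set (.tmp 2)
          (.nat n)).env (.idx 0)).toNat + 1)))))))) = s₃ := by
        have := hwatch.1
        rw [← hag.1 12 (by simp), List.length_map] at this
        simp [hidx, Val.toNat, hs₃, this]
      rw [e2]
      refine hfor.mono (by simp; ring_nf; omega) ?_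
      rintro s₄ ⟨Q', k1, k2, k3, k4, k5, k6, k7, k8⟩
      refine ⟨∑ k ∈ Finset.range B with k ∉ Pd ++ [n], cost k, ?_, Pd ++ [n], Q', k1, k2,
        by simpa using k3, k5, k6, fun r g hg hb => ?_, k8, rfl⟩
      · have hc : cost n = 14 + (15 * M + 35) * w.length := rfl
        rw [hsum, hc]
        omega
      · simpa using k7 r g hg hb
    · refine ⟨Q, ?_, hPd', by simp [hs₃], by simp [hs₃], hsound, h0, fun r g hg hb => ?_, ?_⟩
      · exact (hQ.of_agree h23 (by simp) (by simp)).of_agree (T := ∅) (E := {.idx 1})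
          (Mach.Agree.set _ (by simp) _) (by simp) (by simp)
      · by_cases hb' : ∀ b ∈ 0 :: g.2, b ∈ Pd
        · exact .inl (hclosed r g hg hb')
        -- A rule that became due only now has `n` in its body, so it is on the watch list of `n`.
        · push Not at hb'
          obtain ⟨b, hb1, hb2⟩ := hb'
          have : b = n := by simpa [hb2] using hb b hb1
          subst this
          exact .inr (by rw [List.drop_zero]; exact mem_watchers.2 ⟨g, hg, hb1⟩)
      · exact hag3.trans (Mach.Agree.set _ (by simp [hE]) _)
    · rintro j hj s₄ hi1 hl1 ⟨Q', k1, k2, k3, k4, k5, k6, k7, k8⟩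
      set r := w[j] with hr
      have hwr : w[j]? = some r := List.getElem?_eq_getElem hj
      obtain ⟨g, hg, hng⟩ := mem_watchers.1 (List.getElem_mem hj : w[j] ∈ watchers G n)
      have hgG : g ∈ G := List.mem_of_getElem? hg
      have e1 : s₄.tab 13 ([.slot (.idx 1), .slot (.tmp 2)].map (Opd.eval s₄)) = .nat r := by
        rw [k8.1 13 (by simp)]
        simpa [hi1, k4] using hwatch.2 j (.nat r) (by simp [hwr])
      refine (WP.seq (t := 7) (u := 15 * M + 26) (WP.get ?_)).mono (by omega) fun _ h => h
      rw [e1]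
      set s₅ := s₄.set (.tmp 3) (.nat r) with hs₅
      have h45 : s₄.Agree s₅ ∅ {.tmp 3} := Mach.Agree.set _ (by simp) _
      have hG5 : s₅.HasRules G := (hG.of_agree k8 (by simp) hErule).of_agree h45 (by simp)
        (by simp [ruleReg])
      have hQ5 : s₅.HasQueue Q' := k1.of_agree h45 (by simp) (by simp)
      have hdrop : ∀ r' ∈ w.drop j, r' = r ∨ r' ∈ w.drop (j + 1) := by
        intro r' hr'
        rw [List.drop_eq_getElem_cons hj] at hr'
        exact List.mem_cons.1 hr'
      have hE5 : ∀ s' : Mach P K, s₅.Agree s' {14, 15} {.tmp 4, .tmp 5, .lim 0} →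
          s.Agree (s'.set (.idx 1) (.nat (j + 1))) {14, 15} E := by
        intro s' hs'
        refine ((k8.trans (h45.mono (by simp) ?_)).trans (hs'.mono le_rfl ?_)).trans
          (Mach.Agree.set _ (by simp [hE]) _)
        · rintro x rfl; simp [hE]
        · rintro x (rfl | rfl | rfl) <;> simp [hE]
      have hset : ∀ {s' : Mach P K} {Q : List ℕ}, s'.HasQueue Q →
          (s'.set (.idx 1) (.nat (j + 1))).HasQueue Q := fun h =>
        h.of_agree (T := ∅) (E := {.idx 1}) (Mach.Agree.set _ (by simp) _) (by simp) (by simp)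
      refine (WP.checkBody (t := 26) (List.range M) s₅ hG5 hQ5 (r := r) (by simp [hs₅])
        (fun hall s₆ hs₆ => ?_) (fun hall s₆ hs₆ => ?_)).mono (by simp; omega) fun _ h => h
      · rw [bodyAt_mem_iff hg (hM g hgG) Q' k6] at hall
        refine (WP.derive (G := G) (Q := Q') (r := r) (hG5.of_agree hs₆ (by simp)
          (by simp [ruleReg]))
          (hQ5.of_agree hs₆ (by simp) (by simp)) (by rw [hs₆.2 _ (by simp)]; simp [hs₅]) hg).mono
            le_rfl ?_
        rintro s₇ ⟨Q'', l1, l2, l3⟩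
        have l3' : s₅.Agree s₇ {14, 15} {.tmp 4, .tmp 5, .lim 0} :=
          (hs₆.mono (by simp) (by intro x; simp; tauto)).trans l3
        have hpre : Q' <+: Q'' := by
          rcases l2 with ⟨rfl, -⟩ | rfl
          exacts [List.prefix_rfl, List.prefix_append _ _]
        have hgQ : g.1 ∈ Q'' := by
          rcases l2 with ⟨rfl, h⟩ | rfl
          exacts [h, by simp]
        refine ⟨?_, ?_, Q'', hset l1, k2.trans hpre, ?_, ?_, ?_, hpre.subset k6, ?_, hE5 _ l3'⟩
        · rw [l3'.2 _ (by simp)]; simpa [hs₅] using hi1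
        · rw [l3'.2 _ (by simp)]; simpa [hs₅] using hl1
        · rw [Mach.env_set_of_ne _ _ (by simp), l3'.2 _ (by simp)]; simpa [hs₅] using k3
        · rw [Mach.env_set_of_ne _ _ (by simp), l3'.2 _ (by simp)]; simpa [hs₅] using k4
        · rcases l2 with ⟨rfl, h⟩ | rfl
          · exact k5
          · intro b hb
            rcases List.mem_append.1 hb with hb | hb
            · exact k5 b hb
            · simp only [List.mem_singleton] at hb
              subst hb
              exact ⟨.rule g hgG fun b hb => (k5 b (hall b hb)).1, hB g hgG⟩
        · intro r' g' hg' hb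
          rcases k7 r' g' hg' hb with h | h
          · exact .inl (hpre.subset h)
          · rcases hdrop r' h with rfl | h
            · rw [hg] at hg'
              cases hg'
              exact .inl hgQ
            · exact .inr h
      · rw [bodyAt_mem_iff hg (hM g hgG) Q' k6] at hall
        have l3' : s₅.Agree s₆ {14, 15} {.tmp 4, .tmp 5, .lim 0} :=
          hs₆.mono (by simp) (by intro x; simp; tauto)
        refine ⟨?_, ?_, Q', hset (hQ5.of_agree hs₆ (by simp) (by simp)), k2, ?_, ?_, k5, k6, ?_,
          hE5 _ l3'⟩
        · rw [l3'.2 _ (by simp)]; simpa [hs₅] using hi1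
        · rw [l3'.2 _ (by simp)]; simpa [hs₅] using hl1
        · rw [Mach.env_set_of_ne _ _ (by simp), l3'.2 _ (by simp)]; simpa [hs₅] using k3
        · rw [Mach.env_set_of_ne _ _ (by simp), l3'.2 _ (by simp)]; simpa [hs₅] using k4
        · intro r' g' hg' hb
          rcases k7 r' g' hg' hb with h | h
          · exact .inl h
          · rcases hdrop r' h with rfl | h
            · rw [hg] at hg'
              cases hg'
              exact absurd (fun b hb' => k2.subset (hb b (by simp [hb']))) hall
            · exact .inr h
  have htotal : ∑ n ∈ Finset.range B, cost n ≤ 14 * B + (15 * M + 35) * (G.length * (M + 1)) := by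
    simp only [hcost, Finset.sum_add_distrib, Finset.sum_const, Finset.card_range, smul_eq_mul,
      ← Finset.mul_sum]
    have := Nat.mul_le_mul_left (15 * M + 35) (sum_length_watchers_le (Finset.range B) G hM)
    omega
  set s₀ := (((s.put 14 [.nat 0] (.nat 1)).put 15 [.nat 0] (.nat 0)).set (.lim 0) (.nat 1)).set
    (.idx 0) (.nat 0) with hs₀
  have hI₀ : I (∑ n ∈ Finset.range B, cost n) s₀ := by
    refine ⟨[], [0], ⟨by simp, by simp [hs₀], ?_, ?_, ?_⟩, by simp, by simp [hs₀], ?_, by simp,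
      fun r g _ hb => absurd (hb 0 (by simp)) (by simp), ?_, by simp⟩
    · intro i n hi
      cases i with
      | zero => simpa [hs₀, eq_comm] using hi
      | succ i => simp at hi
    · simp [hs₀]
    · intro n hn
      simp only [List.mem_singleton] at hn
      simpa [hs₀, Function.update_apply, hn] using h14 n
    · intro n hn
      simp only [List.mem_singleton] at hn
      subst hn
      exact ⟨.top, hB0⟩
    · exact ((((Mach.Agree.put (T := {14, 15}) (E := E) _ (by simp) _ _).trans
        (Mach.Agree.put (n := 15) _ (by simp) _ _)).trans
          (Mach.Agree.set (r := .lim 0) _ (by simp [hE]) _)).trans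
            (Mach.Agree.set (r := .idx 0) _ (by simp [hE]) _))
  have hpre : ∀ {t : ℕ} {R : Mach P K → Prop} {c : Cmd P K}, WP c t R s₀ →
      WP (.seq (.save 14 [.imm (.nat 0)] (.imm (.nat 1)))
        (.seq (.save 15 [.imm (.nat 0)] (.imm (.nat 0)))
          (.seq (.assign (.lim 0) (.imm (.nat 1))) (.seq (.assign (.idx 0) (.imm (.nat 0))) c))))
        (t + 14) R s := fun h =>
    (WP.seq (WP.save (WP.seq (WP.save (WP.seq (WP.assign (WP.seq (WP.assign h)))))))).mono
      (by simp; omega) fun _ h => h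
  refine (hpre (hloop _ hI₀)).mono (by omega) ?_
  · rintro s' ⟨h1, m, Pd, Q, hQ, hPd, hidx, hsound, h0, hclosed, hag, rfl⟩
    simp only [hidx, hQ.size, Val.toNat, not_lt] at h1
    obtain rfl : Pd = Q := hPd.eq_of_length_le h1
    have hcompl : ∀ n, Derivable G n → n ∈ Pd := by
      intro n hn
      induction hn with
      | top => exact h0
      | rule g hg _ ih =>
        obtain ⟨r, hr⟩ := List.mem_iff_getElem?.1 hg
        refine hclosed r g hr fun b hb => ?_
        rcases List.mem_cons.1 hb with rfl | hb
        exacts [h0, ih b hb]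
    exact ⟨fun n => ⟨fun hn => hQ.mark n (hcompl n hn),
      fun hn => hQ.no_mark n fun h => hn (hsound n h).1⟩, hag⟩

/-! ### Output -/

theorem mem_factIds {q : P} {F : List (Fact ar K)} {n : ℕ} :
    n ∈ factIds q F ↔ ∃ k t, n = k + 1 ∧ F[k]? = some ⟨q, t⟩ := by
  classical
  simp only [factIds, List.mem_filterMap, Option.ite_none_right_eq_some, Option.some.injEq]
  constructor
  · rintro ⟨⟨⟨p, t⟩, k⟩, h, rfl, rfl⟩
    exact ⟨k, t, rfl, List.mem_zipIdx_iff_getElem?.1 h⟩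
  · rintro ⟨k, t, rfl, h⟩
    exact ⟨(⟨q, t⟩, k), List.mem_zipIdx_iff_getElem?.2 h, rfl, rfl⟩

theorem nodup_factIds (q : P) (F : List (Fact ar K)) : (factIds q F).Nodup := by
  induction F using List.reverseRecOn with
  | nil => simp [factIds]
  | append_singleton F f ih =>
    by_cases h : f.1 = q
    · rw [(factIds_append_singleton q F f).1 h, List.nodup_append]
      refine ⟨ih, by simp, ?_⟩
      intro n hn m hm e
      obtain ⟨k, t, rfl, hk⟩ := mem_factIds.1 hn
      have := (List.getElem?_eq_some_iff.1 hk).1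
      simp only [List.mem_singleton] at hm
      omega
    · rwa [(factIds_append_singleton q F f).2 h]

/-- Each fact belongs to at most one of the lists, so listing the output for all predicates takes
time linear in the number of facts. -/
theorem sum_length_factIds_le {qs : List P} (hqs : qs.Nodup) (F : List (Fact ar K)) :
    (qs.map fun q => (factIds q F).length).sum ≤ F.length := by
  classical
  induction F using List.reverseRecOn with
  | nil => simp [factIds]
  | append_singleton F f ih =>
    have : (qs.map fun q => (factIds q (F ++ [f])).length) =
        qs.map fun q => (factIds q F).length + if q = f.1 then 1 else 0 := by
      refine List.map_congr_left fun q _ => ?_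
      split_ifs with h
      · rw [(factIds_append_singleton q F f).1 h.symm]; simp
      · rw [(factIds_append_singleton q F f).2 fun e => h e.symm]; simp
    rw [this, List.sum_map_add]
    have hc : (qs.map fun q => if q = f.1 then 1 else 0).sum ≤ 1 := by
      refine le_of_eq_of_le ?_ (List.nodup_iff_count_le_one.1 hqs f.1)
      clear hqs ih this
      induction qs with
      | nil => simp
      | cons q qs ih => simp [List.count_cons, ih, add_comm]
    simp only [List.length_append, List.length_singleton]
    omega

/-- The relation listed by `L` is kept in the tables 0 to 2. -/
def Mach.Stores (s : Mach P K) (p : P) (L : List (Fin (ar p) → K)) : Prop :=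
  s.tab 0 [.pred p] = .nat L.length ∧
  (∀ (i : Fin L.length) (j : Fin (ar p)), s.tab 1 [.pred p, .nat i, .nat j] = .const (L.get i j)) ∧
  (∀ t ∈ L, s.tab 2 (Fact.addr ⟨p, t⟩) = .nat 1) ∧
  (∀ t ∉ L, s.tab 2 (Fact.addr ⟨p, t⟩) = .nat 0)

/-- Copy the fact whose number is in register `tmp 2`. -/
def Cmd.copyFact (ar : P → ℕ) (q : P) : Cmd P K :=
  .seq (.get (.tmp 4) 0 [.imm (.pred q)])
    (.seq (.seqMap (List.finRange (ar q)) fun j : Fin (ar q) =>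
        .get (.var j) 9 [.slot (.tmp 2), .imm (.nat j)])
      (.seq (.seqMap (List.finRange (ar q)) fun j : Fin (ar q) =>
          .save 1 [.imm (.pred q), .slot (.tmp 4), .imm (.nat j)] (.slot (.var j)))
        (.seq (.save 2 (.imm (.pred q) :: List.ofFn fun j : Fin (ar q) => varOpd j) (.imm (.nat 1)))
          (.seq (.incr (.tmp 4)) (.save 0 [.imm (.pred q)] (.slot (.tmp 4)))))))

/-- Numbered facts need not be derivable, as they may come from a ground rule with an underivable
body; the mark in table 14 selects those to be copied. -/
def Cmd.outputPred (ar : P → ℕ) (q : P) : Cmd P K :=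
  .seq (.get (.lim 0) 7 [.imm (.pred q)]) (.forLt (.idx 0) (.lim 0)
    (.seq (.get (.tmp 2) 8 [.slot (.idx 0), .imm (.pred q)])
      (.seq (.get (.tmp 3) 14 [.slot (.tmp 2)])
        (.ifEq (.slot (.tmp 3)) (.imm (.nat 1)) (.copyFact ar q) .skip))))

def copyRegs : Set Slot := {.tmp 2, .tmp 3, .tmp 4} ∪ Set.range Slot.var

theorem WP.copyFact {q : P} {s : Mach P K} {L : List (Fin (ar q) → K)} {n : ℕ}
    {t : Fin (ar q) → K} (hL : s.Stores q L) (hn : s.env (.tmp 2) = .nat n)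
    (h9 : ∀ j : Fin (ar q), s.tab 9 [.nat n, .nat j] = .const (t j)) (ht : t ∉ L) :
    WP (.copyFact ar q) (19 * ar q + 18) (fun s' => s'.Stores q (L ++ [t]) ∧
      (∀ q' ≠ q, ∀ L' : List (Fin (ar q') → K), s.Stores q' L' → s'.Stores q' L') ∧
      s.Agree s' {0, 1, 2} copyRegs) s := by
  set s₁ := s.set (.tmp 4) (.nat L.length) with hs₁
  have h01 : s.Agree s₁ ∅ copyRegs := Mach.Agree.set _ (by simp [copyRegs]) _
  have hload := WP.seqMap (l := List.finRange (ar q))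
    (c := fun j : Fin (ar q) => Cmd.get (P := P) (K := K) (.var j) 9 [.slot (.tmp 2), .imm
      (.nat j)])
    (fun _ => 7) (fun l₁ s' => (∀ j ∈ l₁, s'.env (.var j) = .const (t j)) ∧
      s₁.Agree s' ∅ (Set.range Slot.var)) (s := s₁) ?_ ⟨by simp, .refl _ _ _⟩
  swap
  · rintro l₁ j l₂ hl s' ⟨k1, k2⟩
    refine WP.get ⟨fun i hi => ?_, k2.trans (Mach.Agree.set _ (by simp) _)⟩
    have e : s'.tab 9 ([.slot (.tmp 2), .imm (.nat j)].map (Opd.eval s')) = .const (t j) := by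
      rw [k2.1 9 (by simp)]
      simp [k2.2 (.tmp 2) (by simp), hs₁, hn, h9]
    rw [e]
    by_cases hij : i = j
    · subst hij; simp
    · rw [Mach.env_set_of_ne _ _ (by simpa [Fin.ext_iff] using hij)]
      rcases List.mem_append.1 hi with hi | hi
      · exact k1 i hi
      · exact absurd (by simpa using hi) hij
  refine (WP.seq (u := 19 * ar q + 13) (WP.get ?_)).mono (by simp; omega) fun _ h => h
  have e1 : s.tab 0 ([.imm (.pred q)].map (Opd.eval s)) = .nat L.length := by simpa using hL.1
  rw [e1]
  refine (WP.seq (u := 12 * ar q + 13) (hload.mono le_rfl ?_)).mono (by simp; omega) fun _ h => h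
  rintro s₂ ⟨k1, k2⟩
  have h4 : s₂.env (.tmp 4) = .nat L.length := by rw [k2.2 _ (by simp)]; simp [hs₁]
  have hsave := WP.saveAll (n := 1) (m := 3) (s := s₂) (l := List.finRange (ar q))
    (fun j : Fin (ar q) => [.imm (.pred q), .slot (.tmp 4), .imm (.nat j)])
    (fun j => .slot (.var j)) (by simp) (by simp [Fin.ext_iff])
  refine (WP.seq (u := 2 * ar q + 13) (hsave.mono le_rfl ?_)).mono (by simp; omega) fun _ h => h
  rintro s₃ ⟨l1, l2, l3⟩
  have hag : s.Agree s₃ {0, 1, 2} copyRegs :=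
    ((h01.mono (by simp) le_rfl).trans (k2.mono (by simp) (by simp [copyRegs]))).trans
      (l3.mono (by simp) (by simp))
  have hs1 : s₂.tab 1 = s.tab 1 := by rw [k2.1 _ (by simp)]; simp [hs₁]
  have ht0 : s₃.tab 0 = s.tab 0 := by rw [l3.1 _ (by simp), k2.1 _ (by simp)]; simp [hs₁]
  have ht2 : s₃.tab 2 = s.tab 2 := by rw [l3.1 _ (by simp), k2.1 _ (by simp)]; simp [hs₁]
  have eaddr : (.imm (.pred q) :: List.ofFn fun j : Fin (ar q) => varOpd (P := P) (K := K) j).map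
      (Opd.eval s₃) = Fact.addr (ar := ar) ⟨q, t⟩ := by
    simp only [Fact.addr, List.map_cons, List.map_ofFn, Opd.eval_imm]
    congr 2
    funext j
    simp only [Function.comp_apply, varOpd, Opd.eval_slot]
    rw [l3.2 _ (by simp), k1 j (by simp)]
  have hent : ∀ j : Fin (ar q), s₃.tab 1 [.pred q, .nat L.length, .nat j] = .const (t j) := by
    intro j
    have := l1 j (by simp)
    simp only [List.map_cons, List.map_nil, Opd.eval_imm, Opd.eval_slot, h4, k1 j (by simp)] at this
    exact this
  have hold : ∀ (q' : P) (i j : ℕ), (q' = q → i ≠ L.length) →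
      s₃.tab 1 [.pred q', .nat i, .nat j] = s.tab 1 [.pred q', .nat i, .nat j] := by
    intro q' i j h
    rw [l2 _ fun j _ e => ?_, hs1]
    simp only [List.map_cons, List.map_nil, Opd.eval_imm, Opd.eval_slot, h4, List.cons.injEq,
      Val.pred.injEq, Val.nat.injEq] at e
    exact h e.1 e.2.1
  refine (WP.seq (t := 2 * ar q + 6) (u := 7) ((WP.save ?_).mono (by simp; omega)
    fun _ h => h)).mono
    (by omega) fun _ h => h
  rw [eaddr]
  refine WP.seq (t := 1) (u := 6) (WP.incr (WP.save ?_))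
  simp only [Mach.env_put, List.map_cons, List.map_nil, Opd.eval_imm, Opd.eval_slot,
    Mach.env_set_self, l3.2 (.tmp 4) (by simp), h4, Val.toNat]
  refine ⟨⟨by simp, fun i j => ?_, fun u hu => ?_, fun u hu => ?_⟩, fun q' hq' L' hL' =>
    ⟨?_, fun i j => ?_, fun u hu => ?_, fun u hu => ?_⟩, ?_⟩
  · simp only [ne_eq, OfNat.one_ne_ofNat, not_false_eq_true, Mach.tab_put_of_ne, Mach.tab_set,
      one_ne_zero]
    by_cases hi : (i : ℕ) = L.length
    · rw [hi, hent]
      simp [hi]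
    · have hi' : (i : ℕ) < L.length := by have := i.2; simp at this; omega
      rw [hold _ _ _ fun _ => hi, hL.2.1 ⟨i, hi'⟩ j]
      simp [hi']
  · by_cases hut : u = t
    · subst hut; simp
    · have : Fact.addr (ar := ar) ⟨q, u⟩ ≠ Fact.addr ⟨q, t⟩ := fun e => hut (by
        simpa using Fact.addr_injective e)
      simpa [Function.update_apply, this, ht2] using hL.2.2.1 u (by simpa [hut] using hu)
  · simp only [List.mem_append, List.mem_singleton, not_or] at hu
    have : Fact.addr (ar := ar) ⟨q, u⟩ ≠ Fact.addr ⟨q, t⟩ := fun e => hu.2 (by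
      simpa using Fact.addr_injective e)
    simpa [Function.update_apply, this, ht2] using hL.2.2.2 u hu.1
  · simpa [Function.update_apply, hq', ht0] using hL'.1
  · simpa [hold q' i j fun e => absurd e hq'] using hL'.2.1 i j
  · have : Fact.addr (ar := ar) ⟨q', u⟩ ≠ Fact.addr ⟨q, t⟩ := fun e => hq' (by
      simpa using congrArg Sigma.fst (Fact.addr_injective e))
    simpa [Function.update_apply, this, ht2] using hL'.2.2.1 u hu
  · have : Fact.addr (ar := ar) ⟨q', u⟩ ≠ Fact.addr ⟨q, t⟩ := fun e => hq' (by
      simpa using congrArg Sigma.fst (Fact.addr_injective e))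
    simpa [Function.update_apply, this, ht2] using hL'.2.2.2 u hu
  · exact ((hag.trans (Mach.Agree.put (n := 2) _ (by simp) _ _)).trans
      (Mach.Agree.set (r := .tmp 4) _ (by simp [copyRegs]) _)).trans
        (Mach.Agree.put (n := 0) _ (by simp) _ _)

/-- After `j` rounds the list stored for `q` consists of the marked facts among the first `j`
numbers. Numbers do not repeat in `factIds`, and different numbers belong to different facts, so the
output has no duplicates. -/
theorem WP.outputPred {q : P} {F : List (Fact ar K)} {Dv : ℕ → Prop} {s : Mach P K}
    (hF : s.HasFacts F) (hD : ∀ n, (Dv n → s.tab 14 [.nat n] = .nat 1) ∧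
      (¬ Dv n → s.tab 14 [.nat n] = .nat 0)) (hq : s.Stores q ([] : List (Fin (ar q) → K))) :
    WP (.outputPred ar q) ((factIds q F).length * (19 * ar q + 35) + 7) (fun s' =>
      (∃ L : List (Fin (ar q) → K), L.Nodup ∧
        (∀ t, t ∈ L ↔ ∃ k, F[k]? = some ⟨q, t⟩ ∧ Dv (k + 1)) ∧ s'.Stores q L) ∧
      (∀ q' ≠ q, ∀ L' : List (Fin (ar q') → K), s.Stores q' L' → s'.Stores q' L') ∧
      s.Agree s' {0, 1, 2} (copyRegs ∪ {.idx 0, .lim 0})) s := by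
  set E := copyRegs ∪ {.idx 0, .lim 0} with hE
  set l := factIds q F with hl
  have hids := hF.ids q
  set s₁ := s.set (.lim 0) (.nat l.length) with hs₁
  have hfor := WP.forLt (i := .idx 0) (l := .lim 0) (by simp) (n := l.length)
    (c := (.seq (.get (.tmp 2) 8 [.slot (.idx 0), .imm (.pred q)])
      (.seq (.get (.tmp 3) 14 [.slot (.tmp 2)])
        (.ifEq (.slot (.tmp 3)) (.imm (.nat 1)) (.copyFact ar q) .skip))))
    (fun _ => 19 * ar q + 33) (fun j s' => (∃ L : List (Fin (ar q) → K), L.Nodup ∧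
      (∀ t, t ∈ L ↔ ∃ k, F[k]? = some ⟨q, t⟩ ∧ Dv (k + 1) ∧ k + 1 ∈ l.take j) ∧ s'.Stores q L) ∧
      (∀ q' ≠ q, ∀ L' : List (Fin (ar q') → K), s.Stores q' L' → s'.Stores q' L') ∧
      s.Agree s' {0, 1, 2} E) (s := s₁) (by simp [hs₁]) ?_ ?_
  · refine (WP.seq (u := l.length * (19 * ar q + 35) + 2) (WP.get ?_)).mono (by simp; omega)
      fun _ h => h
    have e1 : s.tab 7 ([.imm (.pred q)].map (Opd.eval s)) = .nat l.length := by
      simpa using hids.1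
    rw [e1]
    refine hfor.mono (by simp) ?_
    rintro s' ⟨⟨L, h1, h2, h3⟩, h4, h5⟩
    refine ⟨⟨L, h1, fun t => ?_, h3⟩, h4, h5⟩
    rw [h2]
    refine exists_congr fun k => and_congr_right fun hk => ?_
    rw [List.take_length]
    exact and_iff_left (mem_factIds.2 ⟨k, t, rfl, hk⟩)
  · exact ⟨⟨[], by simp, by simp, hq⟩, fun _ _ _ h => h,
      (Mach.Agree.set _ (by simp [hE]) _).trans (Mach.Agree.set _ (by simp [hE]) _)⟩
  · rintro j hj s₂ hi hlim ⟨⟨L, h1, h2, h3⟩, h4, h5⟩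
    obtain ⟨k, t, hlk, hk⟩ := mem_factIds.1 (List.getElem_mem hj : l[j] ∈ factIds q F)
    have hk1 : k + 1 ∉ l.take j := by
      have := nodup_factIds q F
      rw [← hl, ← List.take_append_drop j l, List.drop_eq_getElem_cons hj,
        List.nodup_append] at this
      exact fun h => this.2.2 _ h l[j] List.mem_cons_self hlk.symm
    have htake : ∀ m, m ∈ l.take (j + 1) ↔ m ∈ l.take j ∨ m = k + 1 := by
      intro m
      rw [List.take_succ_eq_append_getElem hj, List.mem_append, List.mem_singleton, hlk]
    have e1 : s₂.tab 8 ([.slot (.idx 0), .imm (.pred q)].map (Opd.eval s₂)) = .nat (k + 1) := by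
      rw [h5.1 8 (by simp)]
      simpa [hi] using hids.2 j (.nat (k + 1)) (by
        rw [List.getElem?_map, List.getElem?_eq_getElem hj, hlk]; rfl)
    refine (WP.seq (u := 19 * ar q + 26) (WP.get ?_)).mono (by simp; omega) fun _ h => h
    rw [e1]
    refine (WP.seq (u := 19 * ar q + 21) (WP.get ?_)).mono (by simp; omega) fun _ h => h
    set s₃ := s₂.set (.tmp 2) (.nat (k + 1)) with hs₃
    have e2 : s₃.tab 14 ([.slot (.tmp 2)].map (Opd.eval s₃)) = s.tab 14 [.nat (k + 1)] := by
      simp [hs₃, h5.1 14 (by simp)]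
    rw [e2]
    set s₄ := s₃.set (.tmp 3) (s.tab 14 [.nat (k + 1)]) with hs₄
    have h24 : s₂.Agree s₄ ∅ {.tmp 2, .tmp 3} :=
      (Mach.Agree.set _ (by simp) _).trans (Mach.Agree.set _ (by simp) _)
    have hst : ∀ {s s' : Mach P K} {E : Set Slot} (_ : s.Agree s' ∅ E) (q' : P)
        {L' : List (Fin (ar q') → K)}, s.Stores q' L' → s'.Stores q' L' := by
      intro s s' E h q' L' hL'
      unfold Mach.Stores
      rw [h.1 0 (by simp), h.1 1 (by simp), h.1 2 (by simp)]
      exact hL'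
    have hset : ∀ s' : Mach P K, s'.Agree (s'.set (.idx 0) (.nat (j + 1))) ∅ {.idx 0} :=
      fun s' => Mach.Agree.set _ (by simp) _
    have h04 : s.Agree s₄ {0, 1, 2} E := h5.trans (h24.mono (by simp) (by
      rintro x (rfl | rfl) <;> simp [hE, copyRegs]))
    refine (WP.ifEq (t := 19 * ar q + 18) (fun heq => ?_) fun hne => ?_)
    · have hDk : Dv (k + 1) := by
        by_contra hb
        simp [hs₄, (hD _).2 hb] at heq
      have htL : t ∉ L := by
        intro h
        obtain ⟨k', hk', -, hk''⟩ := (h2 t).1 h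
        have := (List.getElem?_inj (List.getElem?_eq_some_iff.1 hk').1 hF.nodup).1
          (hk'.trans hk.symm)
        subst this
        exact hk1 hk''
      refine (WP.copyFact (hst h24 q h3) (n := k + 1) (t := t) (by simp [hs₄, hs₃])
        (fun i => ?_) htL).mono le_rfl ?_
      · rw [h04.1 9 (by simp)]
        exact hF.args k ⟨q, t⟩ hk i
      rintro s₅ ⟨m1, m2, m3⟩
      refine ⟨?_, ?_, ⟨L ++ [t], ?_, fun u => ?_, hst (hset _) _ m1⟩, fun q' hq' L' hL' =>
        hst (hset _) _ (m2 q' hq' _ (hst h24 _ (h4 q' hq' L' hL'))), ?_⟩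
      · rw [m3.2 _ (by simp [copyRegs]), h24.2 _ (by simp), hi]
      · rw [m3.2 _ (by simp [copyRegs]), h24.2 _ (by simp), hlim]
      · rw [List.nodup_append]
        refine ⟨h1, by simp, fun a ha b hb e => htL ?_⟩
        simp only [List.mem_singleton] at hb
        rw [← hb, ← e]; exact ha
      · rw [List.mem_append, h2, List.mem_singleton]
        constructor
        · rintro (⟨k', a1, a2, a3⟩ | rfl)
          · exact ⟨k', a1, a2, (htake _).2 (.inl a3)⟩
          · exact ⟨k, hk, hDk, (htake _).2 (.inr rfl)⟩
        · rintro ⟨k', a1, a2, a3⟩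
          rcases (htake _).1 a3 with a3 | a3
          · exact .inl ⟨k', a1, a2, a3⟩
          · obtain rfl : k' = k := by omega
            rw [hk] at a1
            right
            simpa using a1.symm
      · exact (h04.trans (m3.mono le_rfl Set.subset_union_left)).trans
          ((hset _).mono (by simp) (by simp [hE]))
    · have hDk : ¬ Dv (k + 1) := by
        intro hb
        simp [hs₄, (hD _).1 hb] at hne
      refine (WP.skip ?_).mono (Nat.zero_le _) fun _ h => h
      refine ⟨?_, ?_, ⟨L, h1, fun u => ?_, hst (hset _) _ (hst h24 _ h3)⟩, fun q' hq' L' hL' =>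
        hst (hset _) _ (hst h24 _ (h4 q' hq' L' hL')), ?_⟩
      · rw [h24.2 _ (by simp), hi]
      · rw [h24.2 _ (by simp), hlim]
      · rw [h2]
        refine exists_congr fun k' => and_congr_right fun _ => and_congr_right fun a2 => ?_
        rw [htake]
        refine (or_iff_left fun e => hDk ?_).symm
        rw [← e]; exact a2
      · exact h04.trans ((hset _).mono (by simp) (by simp [hE]))

theorem WP.output {qs : List P} (hqs : qs.Nodup) {a : ℕ} (ha : ∀ q ∈ qs, ar q ≤ a)
    {F : List (Fact ar K)} {Dv : ℕ → Prop} {s : Mach P K}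
    (hF : s.HasFacts F) (hD : ∀ n, (Dv n → s.tab 14 [.nat n] = .nat 1) ∧
      (¬ Dv n → s.tab 14 [.nat n] = .nat 0))
    (hq : ∀ q ∈ qs, s.Stores q ([] : List (Fin (ar q) → K))) :
    WP (.seqMap qs (.outputPred ar)) (F.length * (19 * a + 35) + qs.length * 7) (fun s' =>
      ∀ q ∈ qs, ∃ L : List (Fin (ar q) → K), L.Nodup ∧
        (∀ t, t ∈ L ↔ ∃ k, F[k]? = some ⟨q, t⟩ ∧ Dv (k + 1)) ∧ s'.Stores q L) s := by
  refine (WP.seqMap (fun q => (factIds q F).length * (19 * ar q + 35) + 7) (fun l₁ s' =>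
    (∀ q ∈ l₁, ∃ L : List (Fin (ar q) → K), L.Nodup ∧
        (∀ t, t ∈ L ↔ ∃ k, F[k]? = some ⟨q, t⟩ ∧ Dv (k + 1)) ∧ s'.Stores q L) ∧
      (∀ q ∈ qs, q ∉ l₁ → s'.Stores q ([] : List (Fin (ar q) → K))) ∧
      s.Agree s' {0, 1, 2} (copyRegs ∪ {.idx 0, .lim 0})) ?_ ⟨by simp, fun q h _ => hq q h,
        .refl _ _ _⟩).mono ?_ fun s' h => h.1
  · rintro l₁ q l₂ hl s' ⟨h1, h2, h3⟩
    have hql : q ∉ l₁ := by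
      rw [hl, List.nodup_append] at hqs
      exact fun h => hqs.2.2 q h q (by simp) rfl
    refine (WP.outputPred (F := F) (Dv := Dv) (hF.of_agree h3 (by simp)
      (by simp [factReg, copyRegs])) (fun n => by rw [h3.1 14 (by simp)]; exact hD n)
      (h2 q (by simp [hl]) hql)).mono le_rfl ?_
    rintro s'' ⟨k1, k2, k3⟩
    refine ⟨fun q' hq' => ?_, fun q' hq' hq'' => ?_, h3.trans k3⟩
    · rcases List.mem_append.1 hq' with hq' | hq'
      · obtain ⟨L, a1, a2, a3⟩ := h1 q' hq'
        exact ⟨L, a1, a2, k2 q' (fun e => hql (e ▸ hq')) L a3⟩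
      · simp only [List.mem_singleton] at hq'
        subst hq'
        exact k1
    · simp only [List.mem_append, List.mem_singleton, not_or] at hq''
      exact k2 q' hq''.2 _ (h2 q' hq' hq''.1)
  · rw [List.sum_map_add]
    refine Nat.add_le_add ?_ (by simp)
    refine le_trans ?_ (Nat.mul_le_mul_right _ (sum_length_factIds_le hqs F))
    rw [← List.sum_map_mul_right]
    refine List.sum_le_sum fun q hq => Nat.mul_le_mul_left _ ?_
    have := ha q hq
    omega

/-! ### Substitutions and most general unifiers -/

theorem Term.mem_vars {t : Term K} {x : ℕ} : x ∈ t.vars ↔ t = .var x := by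
  cases t <;> simp [Term.vars, eq_comm]

theorem Atom.mem_vars {A : Atom ar K} {x : ℕ} : x ∈ A.vars ↔ ∃ i, A.args i = .var x := by
  simp [Atom.vars, Term.mem_vars]

theorem WAtom.mem_vars {B : WAtom ar K} {x : ℕ} :
    x ∈ B.vars ↔ ∃ i, B.args i = some (.var x) := by
  simp only [WAtom.vars, Finset.mem_biUnion, Finset.mem_univ, true_and]
  refine exists_congr fun i => ?_
  cases B.args i <;> simp [Term.mem_vars]

theorem Atom.ext_cast {A B : Atom ar K} (h : A.pred = B.pred)
    (h' : ∀ i, A.args i = B.args (Fin.cast (congrArg ar h) i)) : A = B := by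
  obtain ⟨p, a⟩ := A
  obtain ⟨q, b⟩ := B
  cases h
  congr
  funext i
  exact h' i

theorem Atom.args_cast {A B : Atom ar K} (h : A = B) :
    ∃ h : A.pred = B.pred, ∀ i, A.args i = B.args (Fin.cast (congrArg ar h) i) := by
  subst h
  exact ⟨rfl, fun _ => rfl⟩

theorem Term.subst_subst (σ θ : ℕ → Term K) (t : Term K) :
    (t.subst σ).subst θ = t.subst fun x => (σ x).subst θ := by
  cases t <;> rfl

theorem Term.ground_subst (σ : ℕ → Term K) (α : ℕ → K) (t : Term K) :
    (t.subst σ).ground α = t.ground fun x => (σ x).ground α := by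
  cases t <;> rfl

theorem Term.subst_const (τ : ℕ → K) (t : Term K) :
    t.subst (fun x => .const (τ x)) = .const (t.ground τ) := by
  cases t <;> rfl

theorem Term.subst_congr {σ θ : ℕ → Term K} {t : Term K} (h : ∀ x ∈ t.vars, σ x = θ x) :
    t.subst σ = t.subst θ := by
  cases t with
  | var x => exact h x (by simp [Term.vars])
  | const c => rfl

theorem Term.ground_congr {α β : ℕ → K} {t : Term K} (h : ∀ x ∈ t.vars, α x = β x) :
    t.ground α = t.ground β := by
  cases t with
  | var x => exact h x (by simp [Term.vars])
  | const c => rfl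

theorem Atom.subst_subst (σ θ : ℕ → Term K) (A : Atom ar K) :
    (A.subst σ).subst θ = A.subst fun x => (σ x).subst θ := by
  simp only [Atom.subst, Term.subst_subst]

theorem WAtom.subst_subst (σ θ : ℕ → Term K) (B : WAtom ar K) :
    (B.subst σ).subst θ = B.subst fun x => (σ x).subst θ := by
  simp only [WAtom.subst, Option.map_map, WAtom.mk.injEq, heq_eq_eq, true_and]
  funext i
  cases B.args i <;> simp [Term.subst_subst]

theorem Atom.ground_subst (σ : ℕ → Term K) (α : ℕ → K) (A : Atom ar K) :
    (A.subst σ).ground α = A.ground fun x => (σ x).ground α := by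
  simp only [Atom.subst, Atom.ground, Term.ground_subst]

theorem Atom.ground_congr {α β : ℕ → K} {A : Atom ar K} (h : ∀ x ∈ A.vars, α x = β x) :
    A.ground α = A.ground β := by
  simp only [Atom.ground]
  congr
  funext i
  exact Term.ground_congr fun x hx => h x (Atom.mem_vars.2 ⟨i, Term.mem_vars.1 hx⟩)

theorem Atom.mem_vars_subst {σ : ℕ → Term K} {A : Atom ar K} {v : ℕ} :
    v ∈ (A.subst σ).vars ↔ ∃ x ∈ A.vars, σ x = .var v := by
  simp only [Atom.mem_vars]
  constructor
  · rintro ⟨i, hi⟩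
    change (A.args i).subst σ = _ at hi
    cases h : A.args i with
    | var x => rw [h] at hi; exact ⟨x, ⟨i, h⟩, hi⟩
    | const c => rw [h] at hi; cases hi
  · rintro ⟨x, ⟨i, hi⟩, hx⟩
    refine ⟨i, ?_⟩
    change (A.args i).subst σ = _
    rw [hi]
    exact hx

theorem WAtom.mem_vars_subst {σ : ℕ → Term K} {B : WAtom ar K} {v : ℕ} :
    v ∈ (B.subst σ).vars ↔ ∃ x ∈ B.vars, σ x = .var v := by
  simp only [WAtom.mem_vars]
  constructor
  · rintro ⟨i, hi⟩
    change (B.args i).map (Term.subst σ) = _ at hi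
    obtain ⟨t, ht, hv⟩ := Option.map_eq_some_iff.1 hi
    cases t with
    | var x => exact ⟨x, ⟨i, ht⟩, hv⟩
    | const c => cases hv
  · rintro ⟨x, ⟨i, hi⟩, hx⟩
    refine ⟨i, ?_⟩
    change (B.args i).map (Term.subst σ) = _
    rw [hi]
    exact congrArg some hx

/-- Idempotent most general unifiers. -/
structure IsIdemMGU (σ : ℕ → Term K) (S : Set (Atom ar K × Atom ar K)) : Prop where
  isMGU : IsMGU σ S
  factor : ∀ τ, Unifies τ S → ∀ x, (σ x).subst τ = τ x

/-- Terms contain no function symbols, so a most general unifier can be defined semantically. Call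
two terms equivalent if all unifiers identify them, and send a variable to the constant in its class
if there is one, and to the least variable of its class otherwise. The given unifier `τ₀` shows that
a class contains at most one constant. -/
theorem exists_isIdemMGU {S : Set (Atom ar K × Atom ar K)} {τ₀ : ℕ → Term K}
    (h : Unifies τ₀ S) : ∃ σ, IsIdemMGU σ S := by
  classical
  set r : Term K → Term K → Prop := fun s t => ∀ τ, Unifies τ S → s.subst τ = t.subst τ with hr
  have hrefl : ∀ t, r t t := fun t τ _ => rfl
  have hsymm : ∀ {s t}, r s t → r t s := fun h τ hτ => (h τ hτ).symm
  have htrans : ∀ {s t u}, r s t → r t u → r s u := fun h h' τ hτ => (h τ hτ).trans (h' τ hτ)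
  have hconst : ∀ {c d : K}, r (.const c) (.const d) → c = d := fun h' => by
    have := h' τ₀ h
    exact Term.const.inj this
  have hex : ∀ x, ∃ y, r (.var x) (.var y) := fun x => ⟨x, hrefl _⟩
  set σ : ℕ → Term K := fun x =>
    if h : ∃ c, r (.var x) (.const c) then .const h.choose else .var (Nat.find (hex x)) with hσ
  have hσr : ∀ x, r (σ x) (.var x) := by
    intro x
    simp only [hσ]
    split_ifs with h
    · exact hsymm h.choose_spec
    · exact hsymm (Nat.find_spec (hex x))
  have hσe : ∀ s t, r s t → s.subst σ = t.subst σ := by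
    have hvc : ∀ x c, r (.var x) (.const c) → σ x = .const c := by
      intro x c hx
      have h' : ∃ c, r (.var x) (.const c) := ⟨c, hx⟩
      simp only [hσ, dif_pos h']
      exact congrArg _ (hconst (htrans (hsymm h'.choose_spec) hx))
    intro s t hst
    cases s with
    | const c =>
      cases t with
      | const d => rw [hconst hst]
      | var y => exact (hvc y c (hsymm hst)).symm
    | var x =>
      cases t with
      | const d => exact hvc x d hst
      | var y =>
        change σ x = σ y
        by_cases hx : ∃ c, r (.var x) (.const c)
        · obtain ⟨c, hc⟩ := hx
          rw [hvc x c hc, hvc y c (htrans (hsymm hst) hc)]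
        · have hy : ¬ ∃ c, r (.var y) (.const c) := fun ⟨c, hc⟩ => hx ⟨c, htrans hst hc⟩
          simp only [hσ, dif_neg hx, dif_neg hy]
          congr 1
          refine le_antisymm (Nat.find_min' _ (htrans hst (Nat.find_spec (hex y))))
            (Nat.find_min' _ (htrans (hsymm hst) (Nat.find_spec (hex x))))
  have hfac : ∀ τ, Unifies τ S → ∀ x, (σ x).subst τ = τ x := fun τ hτ x => hσr x τ hτ
  refine ⟨σ, ⟨?_, fun τ hτ => ⟨τ, fun x => (hfac τ hτ x).symm⟩⟩, hfac⟩
  intro q hq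
  obtain ⟨hp, -⟩ := Atom.args_cast (h q hq)
  refine Atom.ext_cast hp fun i => hσe _ _ fun τ hτ => ?_
  exact (Atom.args_cast (hτ q hq)).choose_spec i

theorem Atom.subst_congr {σ θ : ℕ → Term K} {A : Atom ar K} (h : ∀ x ∈ A.vars, σ x = θ x) :
    A.subst σ = A.subst θ := by
  simp only [Atom.subst]
  congr
  funext i
  exact Term.subst_congr fun x hx => h x (Atom.mem_vars.2 ⟨i, Term.mem_vars.1 hx⟩)

/-- Variables that do not occur in the pairs are left alone by an idempotent most general
unifier. -/
theorem IsIdemMGU.eq_var {σ : ℕ → Term K} {S : Set (Atom ar K × Atom ar K)} (h : IsIdemMGU σ S)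
    {x : ℕ} (hx : ∀ q ∈ S, x ∉ q.1.vars ∧ x ∉ q.2.vars) :
    σ x = .var x ∧ ∀ y, σ y = .var x → y = x := by
  -- Since `x` is absent from the pairs, its value is free: changing `σ` at `x` gives a unifier
  -- again. By `factor` this unifier is reproduced after `σ`, which fails for a suitable `t` if `σ`
  -- links `x` to another variable or to a constant.
  have hupd : ∀ t : Term K, Unifies (Function.update σ x t) S := by
    intro t q hq
    have e : ∀ A : Atom ar K, x ∉ A.vars → A.subst (Function.update σ x t) = A.subst σ :=
      fun A hA => Atom.subst_congr fun y hy => Function.update_of_ne (fun (e : y = x) => hA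
        (e ▸ hy)) _ _
    rw [e _ (hx q hq).1, e _ (hx q hq).2, h.isMGU.1 q hq]
  have hne : ∀ s : Term K, ∃ t, t ≠ s := by
    intro s
    by_cases hs : s = .var 0
    · exact ⟨.var 1, by simp [hs]⟩
    · exact ⟨.var 0, fun e => hs e.symm⟩
  have key : ∀ y z, σ y = .var z → (y = x ∨ z = x) → y = z := by
    intro y z hyz h'
    by_contra hne'
    obtain ⟨t, ht⟩ := hne (σ (if y = x then z else y))
    have := h.factor _ (hupd t) y
    rw [hyz] at this
    change Function.update σ x t z = _ at this
    rcases h' with rfl | rfl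
    · rw [Function.update_of_ne (Ne.symm hne'), Function.update_self] at this
      simp [this] at ht
    · rw [Function.update_of_ne hne', Function.update_self] at this
      simp [hne', this] at ht
  refine ⟨?_, fun y hy => key y x hy (.inr rfl)⟩
  cases hs : σ x with
  | var z => rw [key x z hs (.inl rfl)]
  | const c =>
    have := h.factor _ (hupd (.var 0)) x
    rw [hs, Function.update_self] at this
    cases this

/-- The constants of an atom belong to `C`. -/
def Atom.ConstIn (C : Set K) (A : Atom ar K) : Prop := ∀ i c, A.args i = .const c → c ∈ C

/-- Replacing a constant that does not occur in the pairs by a variable turns `σ` into another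
unifier; but this one cannot factor through `σ`, because substitutions fix constants. The argument
applies to arbitrary most general unifiers, as the adorned program admits all of them. -/
theorem IsMGU.const_mem {σ : ℕ → Term K} {S : Set (Atom ar K × Atom ar K)} (h : IsMGU σ S)
    {C : Set K} (hC : ∀ q ∈ S, q.1.ConstIn C ∧ q.2.ConstIn C) {x : ℕ} {c : K}
    (hx : σ x = .const c) : c ∈ C := by
  classical
  by_contra hc
  set φ : Term K → Term K := fun t => if t = .const c then .var 0 else t with hφ
  have hs : ∀ A : Atom ar K, A.ConstIn C → ∀ i,
      (A.args i).subst (fun x => φ (σ x)) = φ ((A.args i).subst σ) := by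
    intro A hA i
    cases hi : A.args i with
    | var y => rfl
    | const d =>
      have : d ≠ c := fun e => hc (e ▸ hA i d hi)
      simp [Term.subst, hφ, this]
  have hu : Unifies (fun x => φ (σ x)) S := by
    intro q hq
    obtain ⟨hp, ha⟩ := Atom.args_cast (h.1 q hq)
    refine Atom.ext_cast hp fun i => ?_
    change (q.1.args i).subst _ = (q.2.args _).subst _
    exact (hs _ (hC q hq).1 i).trans ((congrArg φ (ha i)).trans (hs _ (hC q hq).2 _).symm)
  obtain ⟨θ, hθ⟩ := h.2 _ hu
  have := hθ x
  simp [hx, hφ, Term.subst] at this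

/-! ### Adornments of derivable facts -/

theorem WAtom.hide_args {W : Finset ℕ} {B : WAtom ar K} {i : Fin (ar B.pred)} {t : Term K} :
    (B.hide W).args i = some t ↔ B.args i = some t ∧ ∃ x ∈ W, t = .var x := by
  classical
  change (if ∃ x ∈ W, B.args i = some (.var x) then B.args i else none) = some t ↔ _
  split_ifs with h
  · obtain ⟨x, hx, h⟩ := h
    rw [h]
    constructor
    · rintro ⟨⟩
      exact ⟨rfl, x, hx, rfl⟩
    · exact fun h => h.1
  · simp only [false_iff, not_and]
    rintro ht ⟨x, hx, rfl⟩
    exact h ⟨x, hx, ht⟩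

theorem WAtom.mem_vars_hide {W : Finset ℕ} {B : WAtom ar K} {v : ℕ} :
    v ∈ (B.hide W).vars ↔ v ∈ B.vars ∧ v ∈ W := by
  rw [mem_vars, mem_vars]
  constructor
  · rintro ⟨i, hi⟩
    obtain ⟨h, x, hx, ⟨⟩⟩ := hide_args.1 hi
    exact ⟨⟨i, h⟩, hx⟩
  · rintro ⟨⟨i, hi⟩, hv⟩
    exact ⟨i, hide_args.2 ⟨hi, v, hv, rfl⟩⟩

theorem WAtom.LessRestrictive.refl (B : WAtom ar K) : B.LessRestrictive B :=
  ⟨rfl, fun _ => .inr rfl⟩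

theorem WAtom.LessRestrictive.trans {A B C : WAtom ar K} (h : A.LessRestrictive B)
    (h' : B.LessRestrictive C) : A.LessRestrictive C := by
  obtain ⟨p, a⟩ := A
  obtain ⟨q, b⟩ := B
  obtain ⟨r, c⟩ := C
  obtain ⟨hp, h⟩ := h
  obtain ⟨hq, h'⟩ := h'
  change p = q at hp
  change q = r at hq
  subst hp hq
  refine ⟨rfl, fun i => ?_⟩
  have h1 : a i = none ∨ a i = b i := h i
  have h2 : b i = none ∨ b i = c i := h' i
  change a i = none ∨ a i = c i
  rcases h1 with h1 | h1
  · exact .inl h1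
  · rw [h1]; exact h2

/-- The number of arguments that are not wildcards. -/
def WAtom.size (B : WAtom ar K) : ℕ := (Finset.univ.filter fun i => (B.args i).isSome).card

/-- The number of proper arguments is a rank for the order of restrictiveness: it increases along
the order, and comparable atoms of equal rank coincide. It serves to find maximal atoms. -/
theorem WAtom.LessRestrictive.size_le {B C : WAtom ar K} (h : B.LessRestrictive C) :
    B.size ≤ C.size ∧ (C.size ≤ B.size → C = B) := by
  obtain ⟨p, b⟩ := B
  obtain ⟨q, c⟩ := C
  obtain ⟨hp, h⟩ := h
  change p = q at hp
  subst hp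
  replace h : ∀ i, b i = none ∨ b i = c i := h
  have hsub : (Finset.univ.filter fun i => (b i).isSome) ⊆
      Finset.univ.filter fun i => (c i).isSome := by
    intro i hi
    simp only [Finset.mem_filter, Finset.mem_univ, true_and] at hi ⊢
    rcases h i with h | h
    · simp [h] at hi
    · rwa [← h]
  refine ⟨Finset.card_le_card hsub, fun hle => ?_⟩
  have heq := Finset.eq_of_subset_of_card_le hsub hle
  congr
  funext i
  rcases h i with h | h
  · have : i ∉ Finset.univ.filter fun i => (b i).isSome := by simp [h]
    rw [heq] at this
    simp only [Finset.mem_filter, Finset.mem_univ, true_and, Option.not_isSome_iff_eq_none] at this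
    exact this.trans h.symm
  · exact h.symm

theorem WAtom.LessRestrictive.vars_subset {B C : WAtom ar K} (h : B.LessRestrictive C) :
    B.vars ⊆ C.vars := by
  intro v hv
  obtain ⟨i, hi⟩ := mem_vars.1 hv
  obtain ⟨hp, h⟩ := h
  rcases h i with h | h
  · simp [h] at hi
  · exact mem_vars.2 ⟨_, h.symm.trans hi⟩

theorem Adornment.mem_gOut {ρ : Adornment ar K} {B : WAtom ar K} (hB : B ∈ ρ.gOut.body) :
    (∃ C ∈ ρ.body, B = C.hide ρ.head.vars) ∧ ∃ i, B.args i ≠ none := by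
  classical
  simp only [gOut, Finset.mem_filter, Finset.mem_image] at hB
  obtain ⟨⟨C, hC, rfl⟩, h, -⟩ := hB
  exact ⟨⟨C, hC, rfl⟩, h⟩

/-- Among the atoms at least as restrictive as the hidden form of `C`, one with the most proper
arguments survives the removal of redundant atoms, and it still contains `v`. Thus removal never
uncovers a head variable. -/
theorem Adornment.exists_mem_gOut {ρ : Adornment ar K} {v : ℕ} (hv : v ∈ ρ.head.vars)
    {C : WAtom ar K} (hC : C ∈ ρ.body) (hvC : v ∈ C.vars) : ∃ B ∈ ρ.gOut.body, v ∈ B.vars := by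
  classical
  set I := ρ.body.image (WAtom.hide ρ.head.vars) with hI
  set C₀ := C.hide ρ.head.vars with hC₀
  have hC₀I : C₀ ∈ I := Finset.mem_image_of_mem _ hC
  obtain ⟨B, hB, hmax⟩ := (I.filter fun B => C₀.LessRestrictive B).exists_max_image WAtom.size
    ⟨C₀, by simp [hC₀I, WAtom.LessRestrictive.refl]⟩
  rw [Finset.mem_filter] at hB
  have hvB : v ∈ B.vars := hB.2.vars_subset (WAtom.mem_vars_hide.2 ⟨hvC, hv⟩)
  refine ⟨B, ?_, hvB⟩
  simp only [gOut, Finset.mem_filter]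
  refine ⟨hB.1, ?_, fun C' hC' hle => ?_⟩
  · obtain ⟨i, hi⟩ := WAtom.mem_vars.1 hvB
    exact ⟨i, by simp [hi]⟩
  · exact hle.size_le.2 (hmax C' (Finset.mem_filter.2 ⟨hC', hB.2.trans hle⟩))

theorem mem_inline {prog : Program ar K} {R : Rule ar K} {ρ : Fin R.body.length → Adornment ar K}
    {σ : ℕ → Term K} {C : WAtom ar K} : C ∈ (inline prog R ρ σ).body ↔
      ∃ i, (IsIDB prog (R.body.get i).pred ∧ ∃ B ∈ (ρ i).body, C = B.subst σ) ∨
        (¬ IsIDB prog (R.body.get i).pred ∧ C = ((R.body.get i).subst σ).toWAtom) := by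
  classical
  simp only [inline, Finset.mem_biUnion, Finset.mem_univ, true_and]
  refine exists_congr fun i => ?_
  split_ifs with h
  · simp only [Adornment.subst, Finset.mem_image, h, true_and, not_true_eq_false, false_and,
      or_false, eq_comm]
  · simp only [Finset.mem_singleton, h, false_and, not_false_eq_true, true_and, false_or]

/-- Constants that occur in the program. -/
def programConstants (prog : Program ar K) : Set K :=
  {c | ∃ R ∈ prog, ∃ A ∈ R.head :: R.body, ∃ i, A.args i = .const c}

/-- Properties of all adornments computed from a program. -/
structure Adornment.Shaped (prog : Program ar K) (ρ : Adornment ar K) : Prop where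
  head_pred : ∃ R ∈ prog, R.head.pred = ρ.head.pred
  head_const : ρ.head.ConstIn (programConstants prog)
  covered : ∀ x ∈ ρ.head.vars, ∃ B ∈ ρ.body, x ∈ B.vars
  args : ∀ B ∈ ρ.body, ∀ i t, B.args i = some t → ∃ x ∈ ρ.head.vars, t = .var x
  ne_none : ∀ B ∈ ρ.body, ∃ i, B.args i ≠ none
  edb : ∀ B ∈ ρ.body, IsEDBOf prog B.pred

theorem Adornment.mem_rename_body {ρ : Adornment ar K} {π : Equiv.Perm ℕ} {B : WAtom ar K} :
    B ∈ (ρ.rename π).body ↔ ∃ C ∈ ρ.body, B = C.subst fun x => .var (π x) := by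
  classical
  simp [rename, subst, eq_comm]

theorem Adornment.mem_vars_rename_head {ρ : Adornment ar K} {π : Equiv.Perm ℕ} {v : ℕ} :
    v ∈ (ρ.rename π).head.vars ↔ ∃ x ∈ ρ.head.vars, π x = v := by
  change v ∈ (ρ.head.subst _).vars ↔ _
  rw [Atom.mem_vars_subst]
  simp

theorem Adornment.Shaped.rename {prog : Program ar K} {ρ : Adornment ar K} (h : ρ.Shaped prog)
    (π : Equiv.Perm ℕ) : (ρ.rename π).Shaped prog := by
  refine ⟨h.head_pred, fun i c hc => ?_, fun v hv => ?_, fun B hB i t ht => ?_, fun B hB => ?_,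
    fun B hB => ?_⟩
  · change (ρ.head.args i).subst _ = _ at hc
    cases hi : ρ.head.args i with
    | var x => rw [hi] at hc; cases hc
    | const d => rw [hi] at hc; cases hc; exact h.head_const i c hi
  · obtain ⟨x, hx, rfl⟩ := mem_vars_rename_head.1 hv
    obtain ⟨B, hB, hxB⟩ := h.covered x hx
    exact ⟨_, mem_rename_body.2 ⟨B, hB, rfl⟩, WAtom.mem_vars_subst.2 ⟨x, hxB, rfl⟩⟩
  · obtain ⟨C, hC, rfl⟩ := mem_rename_body.1 hB
    obtain ⟨s, hs, rfl⟩ := Option.map_eq_some_iff.1 ht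
    obtain ⟨x, hx, rfl⟩ := h.args C hC i s hs
    exact ⟨π x, mem_vars_rename_head.2 ⟨x, hx, rfl⟩, rfl⟩
  · obtain ⟨C, hC, rfl⟩ := mem_rename_body.1 hB
    obtain ⟨i, hi⟩ := h.ne_none C hC
    exact ⟨i, fun h => hi (Option.map_eq_none_iff.1 h)⟩
  · obtain ⟨C, hC, rfl⟩ := mem_rename_body.1 hB
    exact h.edb C hC

/-- The essential clause is the covering of head variables. By safety a head variable occurs in the
body of the rule. If it occurs in an extensional atom, that atom is inlined. If it occurs in an
intensional atom, unification identifies its image with that of a head variable of an earlier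
adornment, which is covered by induction. -/
theorem AdornedProgram.shaped {prog : Program ar K}
    (hprog : WellFormed prog) {R' : AdornedRule ar K}
    (h : AdornedProgram prog R') : R'.ρ.Shaped prog := by
  induction h with
  | propagate R hR R' hR' π apart apart' σ hσ ih =>
  set ρ := fun i => (R' i).ρ.rename (π i) with hρ
  have ih' : ∀ i, IsIDB prog (R.body.get i).pred → (ρ i).Shaped prog := fun i hi =>
    (ih i hi).rename _
  have hR0 : R.head.ConstIn (programConstants prog) := fun i c hc => ⟨R, hR, _, by simp, i, hc⟩
  have hbody : ∀ A ∈ R.body, A.ConstIn (programConstants prog) :=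
    fun A hA i c hc => ⟨R, hR, A, by simp [hA], i, hc⟩
  have hS : ∀ q ∈ unificationPairs prog R ρ, q.1.ConstIn (programConstants prog) ∧
      q.2.ConstIn (programConstants prog) := by
    rintro q ⟨i, hi, rfl⟩
    exact ⟨hbody _ (List.get_mem _ _), (ih' i hi).head_const⟩
  refine ⟨⟨R, hR, rfl⟩, fun i c hc => ?_, fun v hv => ?_, fun B hB i t ht => ?_, fun B hB => ?_,
    fun B hB => ?_⟩
  · change (R.head.args i).subst σ = _ at hc
    cases hi : R.head.args i with
    | var x => rw [hi] at hc; exact hσ.const_mem hS hc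
    | const d => rw [hi] at hc; cases hc; exact hR0 i c hi
  · obtain ⟨x, hx, hxv⟩ := Atom.mem_vars_subst.1 (show v ∈ (R.head.subst σ).vars from hv)
    obtain ⟨A, hA, hxA⟩ := hprog.safe R hR x hx
    obtain ⟨i, rfl⟩ := List.mem_iff_get.1 hA
    have hvA : v ∈ ((R.body.get i).subst σ).vars := Atom.mem_vars_subst.2 ⟨x, hxA, hxv⟩
    by_cases hi : IsIDB prog (R.body.get i).pred
    · have hu := hσ.1 _ ⟨i, hi, rfl⟩
      rw [hu] at hvA
      obtain ⟨z, hz, hzv⟩ := Atom.mem_vars_subst.1 hvA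
      obtain ⟨B, hB, hzB⟩ := (ih' i hi).covered z hz
      exact Adornment.exists_mem_gOut hv (mem_inline.2 ⟨i, .inl ⟨hi, B, hB, rfl⟩⟩)
        (WAtom.mem_vars_subst.2 ⟨z, hzB, hzv⟩)
    · refine Adornment.exists_mem_gOut hv (mem_inline.2 ⟨i, .inr ⟨hi, rfl⟩⟩) ?_
      obtain ⟨j, hj⟩ := Atom.mem_vars.1 hvA
      exact WAtom.mem_vars.2 ⟨j, congrArg some hj⟩
  · obtain ⟨⟨C, -, rfl⟩, -⟩ := Adornment.mem_gOut hB
    exact (WAtom.hide_args.1 ht).2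
  · exact (Adornment.mem_gOut hB).2
  · obtain ⟨⟨C, hC, rfl⟩, -⟩ := Adornment.mem_gOut hB
    obtain ⟨i, ⟨hi, B, hB', rfl⟩ | ⟨hi, rfl⟩⟩ := mem_inline.1 hC
    · exact (ih' i hi).edb B hB'
    · exact ⟨hi, R, hR, _, List.get_mem _ _, rfl⟩

/-! ### Private variables and the generation of adornments -/

/-- `A` is an extensional body atom of `R` and `x` a head variable in no other body atom. -/
structure Rule.Private (prog : Program ar K) (R : Rule ar K) (A : Atom ar K) (x : ℕ) : Prop where
  mem : A ∈ R.body
  edb : ¬ IsIDB prog A.pred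
  mem_vars : x ∈ A.vars
  mem_head : x ∈ R.head.vars
  notMem : ∀ B ∈ R.body, B ≠ A → x ∉ B.vars

/-- `ρ` is generated from the rule `R` with the unifier `σ`. -/
structure Generates (prog : Program ar K) (R : Rule ar K) (ρ : Adornment ar K)
    (σ : ℕ → Term K) : Prop where
  shaped : ρ.Shaped prog
  head : ρ.head = R.head.subst σ
  private_var : ∀ A x, R.Private prog A x → ∃ v, σ x = .var v ∧ ∀ B ∈ ρ.body, v ∈ B.vars →
    ∃ h : B.pred = A.pred, ∀ i w, B.args i = some (.var w) →
      (A.args (Fin.cast (congrArg ar h) i)).subst σ = .var w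
  unique : ∀ A x A' x' v v', R.Private prog A x → R.Private prog A' x' → σ x = .var v →
    σ x' = .var v' → ∀ B ∈ ρ.body, v ∈ B.vars → v' ∈ B.vars → A = A'

/-- Only one adornment of each class is given a plan, so the information about private variables has
to be carried along renamings. -/
theorem Generates.rename {prog : Program ar K} {R : Rule ar K} {ρ : Adornment ar K}
    {σ : ℕ → Term K} (h : Generates prog R ρ σ) (π : Equiv.Perm ℕ) :
    Generates prog R (ρ.rename π) fun x => (σ x).subst fun x => .var (π x) := by
  have hvar : ∀ {t : Term K} {v : ℕ}, (t.subst fun x => .var (π x)) = .var v →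
      ∃ w, t = .var w ∧ π w = v := by
    intro t v ht
    cases t with
    | var w => exact ⟨w, rfl, by simpa [Term.subst] using ht⟩
    | const c => cases ht
  have hmem : ∀ {B : WAtom ar K} {v : ℕ}, π v ∈ (B.subst fun x => .var
    (π x)).vars → v ∈ B.vars := by
    intro B v hv
    obtain ⟨w, hw, e⟩ := WAtom.mem_vars_subst.1 hv
    rwa [← π.injective (Term.var.inj e)]
  refine ⟨h.shaped.rename π, ?_, fun A x hA => ?_, ?_⟩
  · change ρ.head.subst _ = _
    rw [h.head, Atom.subst_subst]
  · obtain ⟨v, hv, hB⟩ := h.private_var A x hA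
    refine ⟨π v, by rw [hv]; rfl, fun B hB' hvB => ?_⟩
    obtain ⟨C, hC, rfl⟩ := Adornment.mem_rename_body.1 hB'
    obtain ⟨e, he⟩ := hB C hC (hmem hvB)
    refine ⟨e, fun i w hw => ?_⟩
    obtain ⟨t, ht, hw⟩ := Option.map_eq_some_iff.1 hw
    obtain ⟨w', rfl, rfl⟩ := hvar hw
    rw [← Term.subst_subst]
    rw [show (A.args (Fin.cast _ i)).subst σ = .var w' from he i w' ht]
    rfl
  · intro A x A' x' v v' hA hA' hv hv' B hB hvB hvB'
    obtain ⟨w, hw, rfl⟩ := hvar hv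
    obtain ⟨w', hw', rfl⟩ := hvar hv'
    obtain ⟨C, hC, rfl⟩ := Adornment.mem_rename_body.1 hB
    exact h.unique A x A' x' w w' hA hA' hw hw' C hC (hmem hvB) (hmem hvB')

/-- The restriction imposed by an atom with wildcards holds in the database. -/
def WAtom.Sat (D : Database ar K) (α : ℕ → K) (B : WAtom ar K) : Prop :=
  ∃ t ∈ D.rel B.pred, ∀ i s, B.args i = some s → s.ground α = t i

/-- Swap the first `m` numbers with the `(k + 1)`-st block of `m` numbers. -/
def blockSwap (m k : ℕ) : Equiv.Perm ℕ :=
  Function.Involutive.toPerm (fun z => if z < m then z + (k + 1) * m else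
    if (k + 1) * m ≤ z ∧ z < (k + 1) * m + m then z - (k + 1) * m else z) (by
      intro z
      have : m ≤ (k + 1) * m := Nat.le_mul_of_pos_left m (by omega)
      dsimp only
      split_ifs <;> omega)

theorem blockSwap_of_lt {m k z : ℕ} (h : z < m) : blockSwap m k z = z + (k + 1) * m := by
  change (if z < m then _ else _) = _
  rw [if_pos h]

/-- The adornments chosen for the body facts are renamed into disjoint blocks of variables, so their
assignments and `τ` combine to a single assignment `β`. It unifies the body atoms with the renamed
heads and hence factors through the most general unifier `σ`, which makes the inlined body, and so
also its relaxation, true under `β`. -/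
theorem exists_generates {prog : Program ar K} (hprog : WellFormed prog) {D : Database ar K}
    {R : Rule ar K} (hR : R ∈ prog) {τ : ℕ → K} (R' : Fin R.body.length → AdornedRule ar K)
    (α : Fin R.body.length → ℕ → K)
    (hidb : ∀ i, IsIDB prog (R.body.get i).pred → AdornedProgram prog (R' i) ∧
      (R' i).ρ.head.ground (α i) = (R.body.get i).ground τ ∧ ∀ B ∈ (R' i).ρ.body, B.Sat D (α i))
    (hedb : ∀ i, ¬ IsIDB prog (R.body.get i).pred →
      ((R.body.get i).ground τ).2 ∈ D.rel (R.body.get i).pred) :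
    ∃ ρ σ β, ρ ∈ adornments prog ∧ Generates prog R ρ σ ∧
      (∀ x, R.HasVar x → τ x = (σ x).ground β) ∧ ∀ B ∈ ρ.body, B.Sat D β := by
  classical
  set X : Finset ℕ := R.head.vars ∪ R.body.toFinset.biUnion Atom.vars ∪
    Finset.univ.biUnion fun i => (R' i).ρ.head.vars with hX
  set m := X.sup id + 1 with hm
  have hXm : ∀ x ∈ X, x < m := fun x hx => Nat.lt_succ_of_le (Finset.le_sup (f := id) hx)
  have hRm : ∀ x, R.HasVar x → x < m := by
    rintro x (hx | ⟨B, hB, hx⟩)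
    · exact hXm x (by simp [hX, hx])
    · exact hXm x (by simp only [hX, Finset.mem_union, Finset.mem_biUnion, List.mem_toFinset]
                      exact .inl (.inr ⟨B, hB, hx⟩))
  have hR'm : ∀ i, ∀ x ∈ (R' i).ρ.head.vars, x < m := fun i x hx => hXm x (by
    simp only [hX, Finset.mem_union, Finset.mem_biUnion]
    exact .inr ⟨i, by simp, hx⟩)
  have hm0 : 0 < m := Nat.succ_pos _
  set π : Fin R.body.length → Equiv.Perm ℕ := fun i => blockSwap m i with hπ
  set ρ' := fun i => (R' i).ρ.rename (π i) with hρ'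
  have hhead : ∀ i, ∀ z ∈ (ρ' i).head.vars, z / m = i + 1 ∧
      ∃ x ∈ (R' i).ρ.head.vars, π i x = z ∧ z % m = x := by
    intro i z hz
    obtain ⟨x, hx, rfl⟩ := Adornment.mem_vars_rename_head.1 hz
    have hxm := hR'm i x hx
    have e : π i x = x + (i + 1) * m := blockSwap_of_lt hxm
    refine ⟨?_, x, hx, rfl, ?_⟩
    · rw [e, Nat.add_mul_div_right _ _ hm0, Nat.div_eq_of_lt hxm, zero_add]
    · rw [e, Nat.add_mul_mod_self_right, Nat.mod_eq_of_lt hxm]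
  have apart : ∀ i, IsIDB prog (R.body.get i).pred → ∀ x ∈ (ρ' i).head.vars, ¬ R.HasVar x := by
    intro i _ x hx h
    have := (hhead i x hx).1
    rw [Nat.div_eq_of_lt (hRm x h)] at this
    omega
  have apart' : ∀ i j, IsIDB prog (R.body.get i).pred → IsIDB prog (R.body.get j).pred → i ≠ j →
      Disjoint (ρ' i).head.vars (ρ' j).head.vars := by
    intro i j _ _ hij
    rw [Finset.disjoint_left]
    intro x hi hj
    have h1 := (hhead i x hi).1
    have h2 := (hhead j x hj).1
    exact hij (Fin.ext (by omega))
  -- Numbers below `m` are variables of the rule; quotient and remainder modulo `m` recover the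
  -- position of the body atom, shifted by 1, and the original variable of its adornment.
  set β : ℕ → K := fun z => if h : z / m ≠ 0 ∧ z / m - 1 < R.body.length then
    α ⟨z / m - 1, h.2⟩ (z % m) else τ z with hβ
  have hβR : ∀ x, R.HasVar x → β x = τ x := by
    intro x hx
    simp only [hβ]
    rw [dif_neg]
    rw [Nat.div_eq_of_lt (hRm x hx)]
    exact fun h => h.1 rfl
  have hβ' : ∀ i, ∀ x ∈ (R' i).ρ.head.vars, β (π i x) = α i x := by
    intro i x hx
    obtain ⟨h1, y, -, -, h2⟩ := hhead i (π i x) (Adornment.mem_vars_rename_head.2 ⟨x, hx, rfl⟩)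
    have hxm := hR'm i x hx
    have e : π i x % m = x := by
      rw [show π i x = x + (i + 1) * m from blockSwap_of_lt hxm, Nat.add_mul_mod_self_right,
        Nat.mod_eq_of_lt hxm]
    have h3 : π i x / m - 1 = i := by omega
    have h4 : π i x / m ≠ 0 ∧ π i x / m - 1 < R.body.length := ⟨by omega, by rw [h3]; exact i.2⟩
    simp only [hβ]
    rw [dif_pos h4, e]
    rw [show (⟨π i x / m - 1, h4.2⟩ : Fin R.body.length) = i from Fin.ext h3]
  have hconst : ∀ (A B : Atom ar K), A.ground β = B.ground β →
      A.subst (fun x => .const (β x)) = B.subst fun x => .const (β x) := by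
    rintro ⟨p, a⟩ ⟨q, b⟩ h
    obtain ⟨rfl, h⟩ := Sigma.mk.inj_iff.1 h
    simp only [Atom.subst, Term.subst_const]
    congr
    funext i
    exact congrArg _ (congrFun (eq_of_heq h) i)
  have hbody : ∀ i, (R.body.get i).ground β = (R.body.get i).ground τ := fun i =>
    Atom.ground_congr fun x hx => hβR x (.inr ⟨_, List.get_mem _ _, hx⟩)
  have hu : Unifies (fun x => .const (β x)) (unificationPairs prog R ρ') := by
    rintro q ⟨i, hi, rfl⟩
    refine hconst _ _ ?_
    rw [hbody, ← (hidb i hi).2.1]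
    change _ = ((R' i).ρ.head.subst _).ground β
    rw [Atom.ground_subst]
    exact Atom.ground_congr fun x hx => (hβ' i x hx).symm
  obtain ⟨σ, hσ⟩ := exists_isIdemMGU hu
  -- For an idempotent most general unifier, a unifier factors through `σ` by itself, so the same
  -- `β` can be evaluated before and after `σ`.
  have hσβ : ∀ x, (σ x).ground β = β x := by
    intro x
    have := hσ.factor _ hu x
    rw [Term.subst_const] at this
    exact Term.const.inj this
  have hA := AdornedProgram.propagate R hR R' (fun i hi => (hidb i hi).1) π apart apart' σ hσ.isMGU
  have hsh : ∀ i, IsIDB prog (R.body.get i).pred → (ρ' i).Shaped prog :=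
    fun i hi => ((hidb i hi).1.shaped hprog).rename _
  -- A private variable occurs in no intensional body atom, and the heads of the adornments have
  -- been renamed apart from the rule.
  have hpriv : ∀ A x, R.Private prog A x → σ x = .var x ∧ ∀ y, σ y = .var x → y = x := by
    intro A x hx
    refine hσ.eq_var ?_
    rintro q ⟨i, hi, rfl⟩
    refine ⟨hx.notMem _ (List.get_mem _ _) fun e => hx.edb (e ▸ hi), fun h => ?_⟩
    exact apart i hi x h (.inl hx.mem_head)
  -- Each atom of the new adornment stems from one inlined atom `C`. If it contains a private
  -- variable, `C` cannot come from an earlier adornment, whose variables avoid the rule; so `C` is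
  -- the extensional atom that owns the variable.
  have horigin : ∀ B ∈ (inline prog R ρ' σ).gOut.body, ∃ C, B = WAtom.hide (R.head.subst σ).vars C ∧
      ∀ A x, R.Private prog A x → x ∈ B.vars → C = (A.subst σ).toWAtom ∧
        ∃ i : Fin R.body.length, A = R.body.get i ∧ C ∈ (inline prog R ρ' σ).body ∧
          ∀ A' x', R.Private prog A' x' → x' ∈ B.vars → A' = A := by
    intro B hB
    obtain ⟨⟨C, hC, rfl⟩, -⟩ := Adornment.mem_gOut hB
    refine ⟨C, rfl, ?_⟩
    obtain ⟨i, ⟨hi, B, hB', rfl⟩ | ⟨hi, rfl⟩⟩ := mem_inline.1 hC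
    · intro A x hx hxB
      obtain ⟨z, hz, hzx⟩ := WAtom.mem_vars_subst.1 (WAtom.mem_vars_hide.1 hxB).1
      rw [(hpriv A x hx).2 z hzx] at hz
      obtain ⟨j, hj⟩ := WAtom.mem_vars.1 hz
      obtain ⟨y, hy, ⟨⟩⟩ := (hsh i hi).args B hB' j _ hj
      exact absurd (.inl hx.mem_head) (apart i hi x hy)
    · have key : ∀ A x, R.Private prog A x →
          x ∈ (WAtom.hide (R.head.subst σ).vars ((R.body.get i).subst σ).toWAtom).vars →
          A = R.body.get i := by
        intro A x hx hxB
        obtain ⟨j, hj⟩ := WAtom.mem_vars.1 (WAtom.mem_vars_hide.1 hxB).1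
        obtain ⟨z, hz, hzx⟩ := Atom.mem_vars_subst.1
          ((Atom.mem_vars (A := (R.body.get i).subst σ)).2 ⟨j, Option.some.inj hj⟩)
        rw [(hpriv A x hx).2 z hzx] at hz
        by_contra hne
        exact hx.notMem _ (List.get_mem _ _) (Ne.symm hne) hz
      intro A x hx hxB
      obtain rfl := key A x hx hxB
      exact ⟨rfl, i, rfl, hC, fun A' x' hx' hxB' => key A' x' hx' hxB'⟩
  refine ⟨_, σ, β, ⟨_, hA, rfl⟩, ⟨hA.shaped hprog, rfl, fun A x hx => ?_, ?_⟩,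
    fun x hx => by rw [hσβ, hβR x hx], fun B hB => ?_⟩
  · refine ⟨x, (hpriv A x hx).1, fun B hB hxB => ?_⟩
    obtain ⟨C, rfl, h⟩ := horigin B hB
    obtain ⟨rfl, -⟩ := h A x hx hxB
    refine ⟨rfl, fun i w hw => ?_⟩
    exact Option.some.inj (WAtom.hide_args.1 hw).1
  · intro A x A' x' v v' hx hx' hv hv' B hB hvB hvB'
    obtain ⟨C, -, h⟩ := horigin B hB
    rw [(hpriv A x hx).1] at hv
    rw [(hpriv A' x' hx').1] at hv'
    cases hv
    cases hv'
    obtain ⟨-, i, -, -, h⟩ := h A x hx hvB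
    exact (h A' x' hx' hvB').symm
  · obtain ⟨⟨C, hC, rfl⟩, -⟩ := Adornment.mem_gOut hB
    obtain ⟨i, ⟨hi, B', hB', rfl⟩ | ⟨hi, rfl⟩⟩ := mem_inline.1 hC
    · obtain ⟨B₀, hB₀, rfl⟩ := Adornment.mem_rename_body.1 hB'
      obtain ⟨t, ht, h⟩ := (hidb i hi).2.2 B₀ hB₀
      refine ⟨t, ht, fun j s hs => ?_⟩
      obtain ⟨hs, -⟩ := WAtom.hide_args.1 hs
      obtain ⟨s₁, hs₁, rfl⟩ := Option.map_eq_some_iff.1 hs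
      obtain ⟨s₂, hs₂, rfl⟩ := Option.map_eq_some_iff.1 hs₁
      obtain ⟨x, hx, rfl⟩ := ((hidb i hi).1.shaped hprog).args B₀ hB₀ j s₂ hs₂
      rw [← h j _ hs₂, Term.ground_subst, Term.ground_subst]
      change (σ (π i x)).ground β = α i x
      rw [hσβ, hβ' i x hx]
    · refine ⟨_, hedb i hi, fun j s hs => ?_⟩
      obtain ⟨hs, -⟩ := WAtom.hide_args.1 hs
      obtain rfl := Option.some.inj hs
      change (((R.body.get i).args j).subst σ).ground β = ((R.body.get i).args j).ground τ
      rw [Term.ground_subst]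
      refine Term.ground_congr fun x hx => ?_
      rw [hσβ, hβR]
      exact .inr ⟨_, List.get_mem _ _, Atom.mem_vars.2 ⟨j, Term.mem_vars.1 hx⟩⟩

/-- Every derivable intensional fact is an instance of an adornment that holds. -/
theorem Holds.exists_adornment {prog : Program ar K} (hprog : WellFormed prog) {D : Database ar K}
    {f : Fact ar K} (hf : Holds prog D f) : (¬ IsIDB prog f.1 → f.2 ∈ D.rel f.1) ∧
      (IsIDB prog f.1 → ∃ R', AdornedProgram prog R' ∧ ∃ α, R'.ρ.head.ground α = f ∧
        ∀ B ∈ R'.ρ.body, B.Sat D α) := by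
  induction hf with
  | edb p t hp ht => exact ⟨fun _ => ht, fun h => absurd h hp⟩
  | rule R hR τ h ih =>
    refine ⟨fun h => absurd (hprog.head_idb R hR) h, fun _ => ?_⟩
    have hex : ∀ i : Fin R.body.length, ∃ (R' : AdornedRule ar K) (α : ℕ → K),
        IsIDB prog (R.body.get i).pred → AdornedProgram prog R' ∧
          R'.ρ.head.ground α = (R.body.get i).ground τ ∧ ∀ B ∈ R'.ρ.body, B.Sat D α := by
      intro i
      by_cases hi : IsIDB prog (R.body.get i).pred
      · obtain ⟨R', h1, α, h2⟩ := (ih _ (List.get_mem _ i)).2 hi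
        exact ⟨R', α, fun _ => ⟨h1, h2⟩⟩
      · exact ⟨⟨⟨R.head, ∅⟩, []⟩, τ, fun h => absurd h hi⟩
    choose R' α hR' using hex
    obtain ⟨ρ, σ, β, ⟨R'', h1, rfl⟩, h2, h3, h4⟩ := exists_generates hprog hR R' α hR'
      fun i hi => (ih _ (List.get_mem _ i)).1 hi
    refine ⟨R'', h1, β, ?_, h4⟩
    rw [h2.head, Atom.ground_subst]
    exact Atom.ground_congr fun x hx => (h3 x (.inl hx)).symm

/-- Grounding requires the rule and the unifier of the last derivation step, which
`Holds.exists_adornment` does not return. -/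
theorem exists_generates_of_holds {prog : Program ar K} (hprog : WellFormed prog)
    {D : Database ar K} {R : Rule ar K} (hR : R ∈ prog) {τ : ℕ → K}
    (h : ∀ B ∈ R.body, Holds prog D (B.ground τ)) :
    ∃ ρ σ β, ρ ∈ adornments prog ∧ Generates prog R ρ σ ∧
      (∀ x, R.HasVar x → τ x = (σ x).ground β) ∧ ∀ B ∈ ρ.body, B.Sat D β := by
  have hex : ∀ i : Fin R.body.length, ∃ (R' : AdornedRule ar K) (α : ℕ → K),
      IsIDB prog (R.body.get i).pred → AdornedProgram prog R' ∧
        R'.ρ.head.ground α = (R.body.get i).ground τ ∧ ∀ B ∈ R'.ρ.body, B.Sat D α := by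
    intro i
    by_cases hi : IsIDB prog (R.body.get i).pred
    · obtain ⟨R', h1, α, h2⟩ := ((h _ (List.get_mem _ i)).exists_adornment hprog).2 hi
      exact ⟨R', α, fun _ => ⟨h1, h2⟩⟩
    · exact ⟨⟨⟨R.head, ∅⟩, []⟩, τ, fun h => absurd h hi⟩
  choose R' α hR' using hex
  exact exists_generates hprog hR R' α hR' fun i hi =>
    ((h _ (List.get_mem _ i)).exists_adornment hprog).1 hi

/-! ### Finiteness of the set of adornments, and their widths -/

theorem Term.subst_var (t : Term K) : t.subst .var = t := by cases t <;> rfl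

theorem WAtom.subst_var (B : WAtom ar K) : B.subst .var = B := by
  obtain ⟨p, b⟩ := B
  simp only [WAtom.subst]
  congr
  funext i
  cases b i <;> simp [Term.subst_var]

theorem Adornment.rename_rename (ρ : Adornment ar K) (π π' : Equiv.Perm ℕ) :
    (ρ.rename π).rename π' = ρ.rename (π' * π) := by
  classical
  simp only [rename, subst, Atom.subst_subst, Finset.image_image, Function.comp_def,
    WAtom.subst_subst]
  rfl

theorem Adornment.rename_one (ρ : Adornment ar K) : ρ.rename 1 = ρ := by
  classical
  obtain ⟨⟨p, a⟩, b⟩ := ρ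
  simp only [rename, subst, Atom.subst, Equiv.Perm.coe_one, id]
  congr
  · funext i
    exact Term.subst_var _
  · ext B
    simp only [Finset.mem_image]
    constructor
    · rintro ⟨C, hC, rfl⟩
      rwa [show (C.subst fun x => .var x) = C from C.subst_var]
    · exact fun h => ⟨B, h, B.subst_var⟩

theorem Adornment.mem_renamings_self (ρ : Adornment ar K) : ρ ∈ ρ.renamings := ⟨1, ρ.rename_one⟩

theorem Adornment.renamings_rename (ρ : Adornment ar K) (π : Equiv.Perm ℕ) :
    (ρ.rename π).renamings = ρ.renamings := by
  ext ρ'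
  constructor
  · rintro ⟨π', rfl⟩
    exact ⟨π' * π, (rename_rename ρ π π').symm⟩
  · rintro ⟨π', rfl⟩
    refine ⟨π' * π⁻¹, ?_⟩
    dsimp only
    rw [rename_rename, inv_mul_cancel_right]

/-- An embedding of `X` into the numbers below `n` is extended to a permutation of a finite initial
segment and then by the identity. -/
theorem exists_perm_mapsTo {X : Finset ℕ} {n : ℕ} (h : X.card ≤ n) :
    ∃ π : Equiv.Perm ℕ, ∀ x ∈ X, π x < n := by
  classical
  set m := n + X.sup id + 1 with hm
  have hX : X ⊆ Finset.range m := fun x hx => by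
    have := Finset.le_sup (f := id) hx
    simp only [id, Finset.mem_range] at *
    omega
  obtain ⟨e⟩ : Nonempty (X ↪ Finset.range n) := Function.Embedding.nonempty_of_card_le (by simpa)
  set f : X → Finset.range m := fun x => ⟨e x, by
    have := (e x).2
    simp only [Finset.mem_range] at *
    omega⟩ with hf
  obtain ⟨g, hg⟩ := Equiv.Perm.exists_extending_pair
    (fun x : X => (⟨x, hX x.2⟩ : Finset.range m)) f
    (fun x y h => Subtype.ext (congrArg (fun z : Finset.range m => (z : ℕ)) h))
      (fun x y h => e.injective (Subtype.ext
      (congrArg (fun z : Finset.range m => (z : ℕ)) h)))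
  refine ⟨Equiv.Perm.ofSubtype g, fun x hx => ?_⟩
  have h1 := Equiv.Perm.ofSubtype_apply_coe g ⟨x, hX hx⟩
  rw [h1, hg ⟨x, hx⟩]
  exact Finset.mem_range.1 (e ⟨x, hx⟩).2

theorem Set.Finite.atoms {S : Set P} {T : Set (Term K)} (hS : S.Finite) (hT : T.Finite) :
    {A : Atom ar K | A.pred ∈ S ∧ ∀ i, A.args i ∈ T}.Finite := by
  refine (hS.biUnion fun p _ => (Set.Finite.pi' fun _ : Fin (ar p) => hT).image
    fun f => (⟨p, f⟩ : Atom ar K)).subset ?_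
  rintro ⟨p, a⟩ ⟨hp, ha⟩
  exact Set.mem_biUnion hp ⟨a, ha, rfl⟩

theorem Set.Finite.watoms {S : Set P} {T : Set (Option (Term K))} (hS : S.Finite) (hT : T.Finite) :
    {A : WAtom ar K | A.pred ∈ S ∧ ∀ i, A.args i ∈ T}.Finite := by
  refine (hS.biUnion fun p _ => (Set.Finite.pi' fun _ : Fin (ar p) => hT).image
    fun f => (⟨p, f⟩ : WAtom ar K)).subset ?_
  rintro ⟨p, a⟩ ⟨hp, ha⟩
  exact Set.mem_biUnion hp ⟨a, ha, rfl⟩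

theorem finite_programConstants (prog : Program ar K) : (programConstants prog).Finite := by
  have : (⋃ R ∈ prog, ⋃ A ∈ {A | A ∈ R.head :: R.body},
      Set.range fun i : Fin (ar A.pred) => A.args i).Finite :=
    prog.finite_toSet.biUnion fun R _ => (List.finite_toSet _).biUnion fun A _ =>
      Set.finite_range _
  refine (this.preimage (f := Term.const) fun _ _ _ _ h => Term.const.inj h).subset ?_
  rintro c ⟨R, hR, A, hA, i, hi⟩
  simp only [Set.mem_preimage, Set.mem_iUnion]
  exact ⟨R, hR, A, hA, i, hi⟩

theorem le_maxArity {prog : Program ar K} {R : Rule ar K} (hR : R ∈ prog) {A : Atom ar K}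
    (hA : A ∈ R.head :: R.body) : ar A.pred ≤ maxArity prog := by
  refine le_trans ?_ (Finset.le_sup (f := fun R : Rule ar K =>
    (R.head :: R.body).foldr (fun A m => max (ar A.pred) m) 0) hR)
  generalize R.head :: R.body = l at hA
  induction l with
  | nil => simp at hA
  | cons B l ih =>
    rcases List.mem_cons.1 hA with rfl | hA
    · exact le_max_left _ _
    · exact (ih hA).trans (le_max_right _ _)

theorem Atom.card_vars_le (A : Atom ar K) : A.vars.card ≤ ar A.pred := by
  refine Finset.card_biUnion_le.trans ?_
  refine (Finset.sum_le_card_nsmul _ _ 1 fun i _ => ?_).trans (by simp)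
  cases A.args i <;> simp [Term.vars]

theorem Adornment.Shaped.card_vars_le {prog : Program ar K} {ρ : Adornment ar K}
    (h : ρ.Shaped prog) : ρ.head.vars.card ≤ maxArity prog := by
  obtain ⟨R, hR, hp⟩ := h.head_pred
  refine ρ.head.card_vars_le.trans ?_
  rw [← hp]
  exact le_maxArity hR (by simp)

/-- Up to renaming, the head variables lie below the maximal arity. Constants and predicates come
from the program, and body arguments are head variables or wildcards, so only finitely many atoms
are possible. -/
theorem finite_renamings {prog : Program ar K} (hprog : WellFormed prog) :
    {O | ∃ ρ ∈ adornments prog, O = ρ.renamings}.Finite := by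
  classical
  set T : Set (Term K) := Term.var '' (Finset.range (maxArity prog)) ∪
    Term.const '' programConstants prog with hT
  have hTf : T.Finite := ((Finset.finite_toSet _).image _).union
    ((finite_programConstants prog).image _)
  have hS : {p : P | ∃ R ∈ prog, ∃ A ∈ R.head :: R.body, A.pred = p}.Finite := by
    refine (prog.finite_toSet.biUnion fun R _ =>
      ((List.finite_toSet (R.head :: R.body)).image Atom.pred)).subset ?_
    rintro p ⟨R, hR, A, hA, rfl⟩
    exact Set.mem_biUnion hR ⟨A, hA, rfl⟩
  set heads := {A : Atom ar K | A.pred ∈ {p : P | ∃ R ∈ prog, ∃ A ∈ R.head :: R.body, A.pred = p} ∧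
    ∀ i, A.args i ∈ T} with hheads
  have hheadsf : heads.Finite := Set.Finite.atoms hS hTf
  set atoms := {A : WAtom ar K | A.pred ∈ {p : P | ∃ R ∈ prog, ∃ A ∈ R.head :: R.body, A.pred = p} ∧
    ∀ i, A.args i ∈ insert none (some '' T)} with hatoms
  have hatomsf : atoms.Finite := Set.Finite.watoms hS ((hTf.image _).insert _)
  have hfin : {ρ : Adornment ar K | ρ.head ∈ heads ∧ ∀ B ∈ ρ.body, B ∈ atoms}.Finite := by
    refine ((hheadsf.prod hatomsf.toFinset.powerset.finite_toSet).image
      fun x => (⟨x.1, x.2⟩ : Adornment ar K)).subset ?_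
    rintro ⟨A, b⟩ ⟨h1, h2⟩
    refine ⟨(A, b), ⟨h1, ?_⟩, rfl⟩
    simpa using show (b : Set (WAtom ar K)) ⊆ atoms from h2
  refine (hfin.image Adornment.renamings).subset ?_
  rintro O ⟨ρ, ⟨R', hR', rfl⟩, rfl⟩
  have h := hR'.shaped hprog
  obtain ⟨π, hπ⟩ := exists_perm_mapsTo h.card_vars_le
  have h' := h.rename π
  have hvT : ∀ v ∈ (R'.ρ.rename π).head.vars, Term.var v ∈ T := by
    intro v hv
    obtain ⟨x, hx, rfl⟩ := Adornment.mem_vars_rename_head.1 hv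
    exact .inl ⟨_, by simpa using hπ x hx, rfl⟩
  refine ⟨R'.ρ.rename π, ⟨⟨?_, fun i => ?_⟩, fun B hB => ⟨?_, fun i => ?_⟩⟩,
    Adornment.renamings_rename _ _⟩
  · obtain ⟨R, hR, hp⟩ := h'.head_pred
    exact ⟨R, hR, R.head, by simp, hp⟩
  · cases hi : (R'.ρ.rename π).head.args i with
    | var v => exact hvT v (Atom.mem_vars.2 ⟨i, hi⟩)
    | const c => exact .inr ⟨c, h'.head_const i c hi, rfl⟩
  · obtain ⟨-, R, hR, A, hA, hp⟩ := h'.edb B hB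
    exact ⟨R, hR, A, by simp [hA], hp⟩
  · cases hi : B.args i with
    | none => exact .inl rfl
    | some t =>
      obtain ⟨v, hv, rfl⟩ := h'.args B hB i t hi
      exact .inr ⟨_, hvT v hv, rfl⟩

/-! ### Hyperedges and widths of adornments -/

/-- Hyperedges are sets of head variables. An adornment may have many body atoms, but one atom for
each hyperedge is enough for the join, so the number of tries depends on the arity only. -/
theorem Adornment.Shaped.card_edges_le {prog : Program ar K} {ρ : Adornment ar K}
    (h : ρ.Shaped prog) : ρ.edges.card ≤ 2 ^ maxArity prog := by
  classical
  have : ρ.edges ⊆ ρ.head.vars.powerset := by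
    intro e he
    obtain ⟨B, hB, rfl⟩ := Finset.mem_image.1 he
    rw [Finset.mem_powerset]
    intro v hv
    obtain ⟨i, hi⟩ := WAtom.mem_vars.1 hv
    obtain ⟨x, hx, ⟨⟩⟩ := h.args B hB i _ hi
    exact hx
  refine (Finset.card_le_card this).trans ?_
  rw [Finset.card_powerset]
  exact Nat.pow_le_pow_right (by omega) h.card_vars_le

theorem Adornment.Shaped.isFractionalCover_one {prog : Program ar K} {ρ : Adornment ar K}
    (h : ρ.Shaped prog) : ρ.IsFractionalCover fun _ => 1 := by
  classical
  refine ⟨fun e _ => by norm_num, fun x hx => ?_⟩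
  obtain ⟨B, hB, hxB⟩ := h.covered x hx
  rw [Finset.sum_const, nsmul_eq_mul, mul_one, Nat.one_le_cast, Nat.one_le_iff_ne_zero,
    Finset.card_ne_zero]
  exact ⟨B.vars, Finset.mem_filter.2 ⟨Finset.mem_image_of_mem _ hB, hxB⟩⟩

theorem Adornment.bddBelow_covers (ρ : Adornment ar K) :
    BddBelow {s | ∃ w, ρ.IsFractionalCover w ∧ s = ∑ e ∈ ρ.edges, w e} := by
  refine ⟨0, ?_⟩
  rintro s ⟨w, hw, rfl⟩
  exact Finset.sum_nonneg fun e he => (hw.1 e he).1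

theorem Adornment.Shaped.width_le {prog : Program ar K} {ρ : Adornment ar K}
    (h : ρ.Shaped prog) : ρ.width ≤ 2 ^ maxArity prog := by
  refine (csInf_le ρ.bddBelow_covers ⟨_, h.isFractionalCover_one, rfl⟩).trans ?_
  simp only [Finset.sum_const, nsmul_eq_mul, mul_one]
  exact_mod_cast h.card_edges_le

theorem width_le_edgeCoverWidth {prog : Program ar K} (hprog : WellFormed prog)
    {ρ : Adornment ar K} (hρ : ρ ∈ adornments prog) : ρ.width ≤ edgeCoverWidth prog := by
  -- The supremum is an upper bound only for sets that are bounded above, so a bound uniform in the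
  -- adornment is needed.
  refine le_csSup ⟨2 ^ maxArity prog, ?_⟩ ⟨ρ, hρ, rfl⟩
  rintro s ⟨ρ', ⟨R', hR', rfl⟩, rfl⟩
  exact (hR'.shaped hprog).width_le

/-- A hyperedge contains a head variable, because body atoms are not all wildcards, and covering
this variable already needs weight 1. -/
theorem Adornment.Shaped.one_le_width {prog : Program ar K} {ρ : Adornment ar K}
    (h : ρ.Shaped prog) (he : ρ.edges.Nonempty) : 1 ≤ ρ.width := by
  classical
  obtain ⟨e, he⟩ := he
  obtain ⟨B, hB, rfl⟩ := Finset.mem_image.1 he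
  obtain ⟨i, hi⟩ := h.ne_none B hB
  obtain ⟨t, ht⟩ := Option.ne_none_iff_exists'.1 hi
  obtain ⟨x, hx, rfl⟩ := h.args B hB i t ht
  refine le_csInf ⟨_, _, h.isFractionalCover_one, rfl⟩ ?_
  rintro s ⟨w, hw, rfl⟩
  exact (hw.2 x hx).trans (Finset.sum_le_sum_of_subset_of_nonneg (Finset.filter_subset _ _)
    fun e he _ => (hw.1 e he).1)

/-- The function `s ↦ c * N ^ s` is monotone and continuous and so commutes with the infimum over
covers; no optimal cover has to be exhibited. -/
theorem Adornment.Shaped.le_mul_rpow_width {prog : Program ar K} {ρ : Adornment ar K}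
    (h : ρ.Shaped prog) {N : ℕ} (hN : 1 ≤ N) {a c : ℝ} (hc : 0 ≤ c)
    (hle : ∀ w, ρ.IsFractionalCover w → a ≤ c * (N : ℝ) ^ ∑ e ∈ ρ.edges, w e) :
    a ≤ c * (N : ℝ) ^ ρ.width := by
  have hN' : (1 : ℝ) ≤ N := by exact_mod_cast hN
  have hmono : Monotone fun s : ℝ => c * (N : ℝ) ^ s := fun s t hst =>
    mul_le_mul_of_nonneg_left (Real.rpow_le_rpow_of_exponent_le hN' hst) hc
  have hcont : Continuous fun s : ℝ => c * (N : ℝ) ^ s :=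
    continuous_const.mul (Real.continuous_const_rpow (by positivity))
  have hne : {s | ∃ w, ρ.IsFractionalCover w ∧ s = ∑ e ∈ ρ.edges, w e}.Nonempty :=
    ⟨_, _, h.isFractionalCover_one, rfl⟩
  have := hmono.map_csInf_of_continuousAt hcont.continuousAt hne ρ.bddBelow_covers
  rw [show c * (N : ℝ) ^ ρ.width = _ from this]
  refine le_csInf (hne.image _) ?_
  rintro _ ⟨s, ⟨w, hw, rfl⟩, rfl⟩
  exact hle w hw

/-! ### The join queries of the adorned rules -/

open Classical in
noncomputable def Rule.allVars (R : Rule ar K) : Finset ℕ :=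
  R.head.vars ∪ R.body.toFinset.biUnion Atom.vars

theorem Rule.mem_allVars {R : Rule ar K} {x : ℕ} : x ∈ R.allVars ↔ R.HasVar x := by
  classical
  simp only [allVars, Finset.mem_union, Finset.mem_biUnion, List.mem_toFinset]
  rfl

theorem Rule.card_allVars_le {prog : Program ar K} {R : Rule ar K} (hR : R ∈ prog) :
    R.allVars.card ≤ (maxBody prog + 1) * maxArity prog := by
  classical
  have h1 : R.head.vars.card ≤ maxArity prog := R.head.card_vars_le.trans (le_maxArity hR (by simp))
  have h2 : (R.body.toFinset.biUnion Atom.vars).card ≤ R.body.toFinset.card * maxArity prog :=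
    Finset.card_biUnion_le_card_mul _ _ _ fun A hA =>
      A.card_vars_le.trans (le_maxArity hR (by simp [List.mem_toFinset.1 hA]))
  have h3 : R.body.toFinset.card ≤ maxBody prog :=
    (List.toFinset_card_le _).trans (Finset.le_sup (f := fun R : Rule ar K => R.body.length) hR)
  refine (Finset.card_union_le _ _).trans ?_
  have := Nat.mul_le_mul_right (maxArity prog) h3
  rw [add_mul]
  omega

open Classical in
/-- The variables of the join query: those of the rule whose value is not fixed by `σ`. -/
noncomputable def Rule.joinVars (R : Rule ar K) (σ : ℕ → Term K) : Finset ℕ :=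
  R.allVars.filter fun y => ¬ (y ∈ R.head.vars ∧ ∃ c, σ y = .const c)

-- A head variable sent to a constant leaves no variable in the adornment, and no cover accounts for
-- it. Its register is therefore set before the search.
open Classical in
noncomputable def Rule.fixedVars (R : Rule ar K) (σ : ℕ → Term K) : Finset ℕ :=
  R.allVars.filter fun y => y ∈ R.head.vars ∧ ∃ c, σ y = .const c

/-- The argument `i` of the body atom `B` of an adornment generated from `R` with `σ` determines
the variable `y` of `R`. -/
def Determines (prog : Program ar K) (R : Rule ar K) (σ : ℕ → Term K) (B : WAtom ar K) (y : ℕ)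
    (i : Fin (ar B.pred)) : Prop :=
  (y ∈ R.head.vars ∧ ∃ v, σ y = .var v ∧ B.args i = some (.var v)) ∨
  (y ∉ R.head.vars ∧ ∃ A x v, R.Private prog A x ∧ σ x = .var v ∧ v ∈ B.vars ∧
    ∃ h : B.pred = A.pred, A.args (Fin.cast (congrArg ar h) i) = .var y)

-- If several arguments determine `y`, one of them is chosen. Conditions lost in this way only add
-- candidates, which the exact test of the extensional atoms removes.
open Classical in
noncomputable def WAtom.joinEdge (prog : Program ar K) (R : Rule ar K) (σ : ℕ → Term K)
    (B : WAtom ar K) : JoinEdge ar :=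
  ⟨B.pred, fun y => if h : ∃ i, Determines prog R σ B y i then some h.choose else none⟩

theorem WAtom.joinEdge_col {prog : Program ar K} {R : Rule ar K} {σ : ℕ → Term K}
    {B : WAtom ar K} {y : ℕ} : ((B.joinEdge prog R σ).col y ≠ none ↔ ∃ i,
      Determines prog R σ B y i) ∧
      ∀ i, (B.joinEdge prog R σ).col y = some i → Determines prog R σ B y i := by
  classical
  by_cases h : ∃ i, Determines prog R σ B y i
  · have e : (B.joinEdge prog R σ).col y = some h.choose := dif_pos h
    rw [e]
    refine ⟨⟨fun _ => h, fun _ => Option.some_ne_none _⟩, fun i hi => ?_⟩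
    rw [← Option.some.inj hi]
    exact h.choose_spec
  · simp [joinEdge, h]

/-- Here groundability is used. For a head variable, `v` is its image under `σ`. Any other variable
occurs in an extensional atom `A`, by condition (2) if it is found in an intensional one. As `A` has
a variable outside the head, condition (1) provides a private variable of `A`, and its image serves
as `v`: atoms of `ρ` containing `v` are relaxations of `A`. -/
theorem Generates.exists_determines {prog : Program ar K} (hg : AdornmentGroundable prog)
    {R : Rule ar K} (hR : R ∈ prog) {ρ : Adornment ar K} {σ : ℕ → Term K}
    (h : Generates prog R ρ σ) {y : ℕ} (hy : y ∈ R.joinVars σ) :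
    ∃ v ∈ ρ.head.vars, ∀ B ∈ ρ.body, v ∈ B.vars → ∃ i, Determines prog R σ B y i := by
  classical
  obtain ⟨hy, hyσ⟩ := Finset.mem_filter.1 hy
  rw [Rule.mem_allVars] at hy
  by_cases hyh : y ∈ R.head.vars
  · cases hs : σ y with
    | const c => exact absurd ⟨hyh, c, hs⟩ hyσ
    | var v =>
      refine ⟨v, ?_, fun B hB hvB => ?_⟩
      · rw [h.head, Atom.mem_vars_subst]
        exact ⟨y, hyh, hs⟩
      · obtain ⟨i, hi⟩ := WAtom.mem_vars.1 hvB
        exact ⟨i, .inl ⟨hyh, v, hs, hi⟩⟩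
  · have hA : ∃ A ∈ R.body, ¬ IsIDB prog A.pred ∧ y ∈ A.vars := by
      obtain ⟨A, hA, hyA⟩ := hy.resolve_left hyh
      by_cases hi : IsIDB prog A.pred
      · exact ((hg R hR).2 A hA hi y hyA).resolve_left hyh
      · exact ⟨A, hA, hi, hyA⟩
    obtain ⟨A, hA, hi, hyA⟩ := hA
    obtain ⟨x, hxA, hxh, hx⟩ := ((hg R hR).1 A hA hi).resolve_right fun h => hyh (h hyA)
    have hp : R.Private prog A x := ⟨hA, hi, hxA, hxh, hx⟩
    obtain ⟨v, hv, hB⟩ := h.private_var A x hp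
    refine ⟨v, ?_, fun B hB' hvB => ?_⟩
    · rw [h.head, Atom.mem_vars_subst]
      exact ⟨x, hxh, hv⟩
    · obtain ⟨e, -⟩ := hB B hB' hvB
      obtain ⟨j, hj⟩ := Atom.mem_vars.1 hyA
      exact ⟨Fin.cast (congrArg ar e.symm) j, .inr ⟨hyh, A, x, v, hp, hv, hvB, e,
        by simpa using hj⟩⟩

/-- Both unifiers turn the head of the rule into the same atom. This allows a plan to fix one
unifier in advance, although the instances it has to find arise from others. -/
theorem Generates.eq_of_mem_head {prog : Program ar K} {R : Rule ar K} {ρ : Adornment ar K}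
    {σ σ' : ℕ → Term K} (h : Generates prog R ρ σ) (h' : Generates prog R ρ σ') {x : ℕ}
    (hx : x ∈ R.head.vars) : σ x = σ' x := by
  obtain ⟨i, hi⟩ := Atom.mem_vars.1 hx
  have : (R.head.args i).subst σ = (R.head.args i).subst σ' :=
    (Atom.args_cast (h.head.symm.trans h'.head)).choose_spec i
  rwa [hi] at this

/-- True instances of a rule satisfy the join query of one of its adornments. -/
theorem Generates.exists_tuple {prog : Program ar K} {D : Database ar K}
    {R : Rule ar K} {ρ : Adornment ar K} {σ σ' : ℕ → Term K} (h : Generates prog R ρ σ)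
    (h' : Generates prog R ρ σ') {τ β : ℕ → K} (hτ : ∀ x, R.HasVar x → τ x = (σ' x).ground β)
    (hsat : ∀ B ∈ ρ.body, B.Sat D β)
    (hedb : ∀ A ∈ R.body, ¬ IsIDB prog A.pred → A.InData D τ) {B : WAtom ar K} (hB : B ∈ ρ.body) :
    ∃ t ∈ D.rel B.pred, ∀ y i, Determines prog R σ B y i → τ y = t i := by
  have hhead : ∀ {y : ℕ} {i : Fin (ar B.pred)} {t : Fin (ar B.pred) → K},
      (∀ w, B.args i = some (.var w) → β w = t i) → y ∈ R.head.vars →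
      (∃ v, σ y = .var v ∧ B.args i = some (.var v)) → τ y = t i := by
    rintro y i t ht hy ⟨v, hv, hi⟩
    rw [← ht v hi, hτ y (.inl hy), ← h.eq_of_mem_head h' hy, hv]
    rfl
  -- If `B` contains the image of a private variable of `A`, the tuple is that of `A` under `τ`,
  -- which also fits the variables of `A` outside the head. Otherwise `B` determines head variables
  -- only, and any tuple that satisfies `B` under `β` will do.
  by_cases hex : ∃ A x v, R.Private prog A x ∧ σ x = .var v ∧ v ∈ B.vars
  · obtain ⟨A, x, v, hp, hv, hvB⟩ := hex
    obtain ⟨v', hv', hA⟩ := h'.private_var A x hp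
    rw [← h.eq_of_mem_head h' hp.mem_head, hv] at hv'
    cases hv'
    obtain ⟨e, hA⟩ := hA B hB hvB
    have hd := hedb A hp.mem hp.edb
    have hdet : ∀ y i, Determines prog R σ B y i →
        τ y = (A.args (Fin.cast (congrArg ar e) i)).ground τ := by
      rintro y i (⟨hy, h1⟩ | ⟨hy, A', x', v', hp', hv', hvB', e', hi⟩)
      · refine hhead (t := fun i => (A.args (Fin.cast (congrArg ar e) i)).ground τ)
          (fun w hw => ?_) hy h1
        have := congrArg (Term.ground β) (hA i w hw)
        rw [Term.ground_subst] at this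
        rw [show β w = (Term.var w : Term K).ground β from rfl, ← this]
        refine Term.ground_congr fun x hx => (hτ x (.inr ⟨A, hp.mem, ?_⟩)).symm
        exact Atom.mem_vars.2 ⟨_, Term.mem_vars.1 hx⟩
      · obtain rfl := h.unique A x A' x' v v' hp hp' hv hv' B hB hvB hvB'
        rw [hi]
        rfl
    clear hA hhead
    obtain ⟨p, b⟩ := B
    obtain ⟨q, a⟩ := A
    cases e
    exact ⟨_, hd, hdet⟩
  · obtain ⟨t, ht, hs⟩ := hsat B hB
    refine ⟨t, ht, ?_⟩
    rintro y i (⟨hy, h1⟩ | ⟨hy, A, x, v, hp, hv, hvB, -⟩)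
    · exact hhead (fun w hw => hs i _ hw) hy h1
    · exact absurd ⟨A, x, v, hp, hv, hvB⟩ hex

/-- A rule of a program, an adornment generated from it, and the unifier. -/
abbrev Plan (ar : P → ℕ) (K : Type v) := Rule ar K × Adornment ar K × (ℕ → Term K)

/-- A list of adornments, one for each class, of the rules of the adorned program. -/
theorem exists_adorned_rules {prog : Program ar K} (hprog : WellFormed prog) :
    ∃ L : List (Plan ar K),
      L.length ≤ prog.card * adornmentCoeff prog ∧
      (∀ p ∈ L, p.1 ∈ prog ∧ p.2.1 ∈ adornments prog ∧ Generates prog p.1 p.2.1 p.2.2) ∧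
      ∀ R ∈ prog, ∀ ρ ∈ adornments prog, ∀ σ, Generates prog R ρ σ →
        ∃ p ∈ L, p.1 = R ∧ p.2.1 ∈ ρ.renamings := by
  classical
  set X : Rule ar K → Set (Set (Adornment ar K)) := fun R =>
    {O | ∃ ρ ∈ adornments prog, ∃ σ, Generates prog R ρ σ ∧ O = ρ.renamings} with hX
  have hXf : ∀ R, (X R).Finite := fun R => (finite_renamings hprog).subset (by
    rintro O ⟨ρ, h, σ, -, rfl⟩
    exact ⟨ρ, h, rfl⟩)
  -- Adornments generated from `R` have its head predicate, so their classes are among those counted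
  -- for this predicate.
  have hXc : ∀ R ∈ prog, (hXf R).toFinset.card ≤ adornmentCoeff prog := by
    intro R hR
    refine le_trans ?_ (Finset.le_sup (f := fun R : Rule ar K => numAdornments prog R.head.pred) hR)
    rw [← Set.ncard_eq_toFinset_card _ (hXf R)]
    refine Set.ncard_le_ncard ?_ ((finite_renamings hprog).subset ?_)
    · rintro O ⟨ρ, h, σ, hσ, rfl⟩
      exact ⟨ρ, h, by rw [hσ.head]; rfl, rfl⟩
    · rintro O ⟨ρ, h, -, rfl⟩
      exact ⟨ρ, h, rfl⟩
  have hpick : ∀ R, ∀ O, ∃ p : Rule ar K × Adornment ar K × (ℕ → Term K), p.1 = R ∧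
      (O ∈ X R → p.2.1 ∈ adornments prog ∧ Generates prog p.1 p.2.1 p.2.2 ∧ O = p.2.1.renamings)
        := by
    intro R O
    by_cases hO : O ∈ X R
    · obtain ⟨ρ, h, σ, hσ, rfl⟩ := hO
      exact ⟨⟨R, ρ, σ⟩, rfl, fun _ => ⟨h, hσ, rfl⟩⟩
    · exact ⟨⟨R, ⟨R.head, ∅⟩, .var⟩, rfl, fun h => absurd h hO⟩
  choose pick hpick1 hpick2 using hpick
  refine ⟨prog.toList.flatMap fun R => (hXf R).toFinset.toList.map (pick R), ?_, ?_, ?_⟩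
  · rw [List.length_flatMap, ← Finset.length_toList, ← smul_eq_mul,
      ← List.length_map (as := prog.toList) fun R =>
        ((hXf R).toFinset.toList.map (pick R)).length]
    refine List.sum_le_card_nsmul _ _ ?_
    intro n hn
    obtain ⟨R, hR, rfl⟩ := List.mem_map.1 hn
    simpa using hXc R (Finset.mem_toList.1 hR)
  · intro p hp
    simp only [List.mem_flatMap, Finset.mem_toList, List.mem_map, Set.Finite.mem_toFinset] at hp
    obtain ⟨R, hR, O, hO, rfl⟩ := hp
    obtain ⟨h1, h2, -⟩ := hpick2 R O hO
    exact ⟨by rwa [hpick1], h1, h2⟩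
  · intro R hR ρ hρ σ hσ
    have hO : ρ.renamings ∈ X R := ⟨ρ, hρ, σ, hσ, rfl⟩
    obtain ⟨-, -, h3⟩ := hpick2 R _ hO
    refine ⟨pick R ρ.renamings, ?_, hpick1 _ _, ?_⟩
    · simp only [List.mem_flatMap, Finset.mem_toList, List.mem_map, Set.Finite.mem_toFinset]
      exact ⟨R, hR, _, hO, rfl⟩
    · have := Adornment.mem_renamings_self (pick R ρ.renamings).2.1
      rwa [← h3] at this

/-- A true instance of a rule satisfies the join query of the chosen representative of an
adornment. -/
theorem exists_representative {prog : Program ar K} (hprog : WellFormed prog)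
    {L : List (Plan ar K)}
    (hL : ∀ R ∈ prog, ∀ ρ ∈ adornments prog, ∀ σ, Generates prog R ρ σ →
        ∃ p ∈ L, p.1 = R ∧ p.2.1 ∈ ρ.renamings) {D : Database ar K} {R : Rule ar K}
    (hR : R ∈ prog) {τ : ℕ → K} (h : ∀ B ∈ R.body, Holds prog D (B.ground τ)) :
    ∃ p ∈ L, p.1 = R ∧ ∃ σ β, Generates prog R p.2.1 σ ∧
      (∀ x, R.HasVar x → τ x = (σ x).ground β) ∧ ∀ B ∈ p.2.1.body, B.Sat D β := by
  obtain ⟨ρ, σ, β, h1, h2, h3, h4⟩ := exists_generates_of_holds hprog hR h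
  obtain ⟨p, hp, rfl, π, hπ⟩ := hL R hR ρ h1 σ h2
  dsimp only at hπ
  refine ⟨p, hp, rfl, fun x => (σ x).subst fun x => .var (π x), fun v => β (π.symm v), ?_, ?_, ?_⟩
  · rw [← hπ]
    exact h2.rename π
  · intro x hx
    rw [h3 x hx, Term.ground_subst]
    simp [Term.ground]
  · intro B hB
    rw [← hπ] at hB
    obtain ⟨C, hC, rfl⟩ := Adornment.mem_rename_body.1 hB
    obtain ⟨t, ht, hs⟩ := h4 C hC
    refine ⟨t, ht, fun i s hs' => ?_⟩
    obtain ⟨s, hs'', rfl⟩ := Option.map_eq_some_iff.1 hs'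
    rw [← hs i s hs'', Term.ground_subst]
    simp [Term.ground]

/-! ### Ground instances and the least fixpoint -/

open Classical in
noncomputable def Rule.edbAtoms (prog : Program ar K) (R : Rule ar K) : List (Atom ar K) :=
  R.body.filter fun A => ¬ IsIDB prog A.pred

open Classical in
noncomputable def Rule.idbAtoms (prog : Program ar K) (R : Rule ar K) : List (Atom ar K) :=
  R.body.filter fun A => IsIDB prog A.pred

theorem Rule.mem_edbAtoms {prog : Program ar K} {R : Rule ar K} {A : Atom ar K} :
    A ∈ R.edbAtoms prog ↔ A ∈ R.body ∧ ¬ IsIDB prog A.pred := by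
  simp [edbAtoms]

theorem Rule.mem_idbAtoms {prog : Program ar K} {R : Rule ar K} {A : Atom ar K} :
    A ∈ R.idbAtoms prog ↔ A ∈ R.body ∧ IsIDB prog A.pred := by
  simp [idbAtoms]

theorem Rule.length_edbAtoms_add (prog : Program ar K) (R : Rule ar K) :
    (R.edbAtoms prog).length + (R.idbAtoms prog).length = R.body.length := by
  classical
  rw [edbAtoms, idbAtoms, add_comm, List.length_eq_length_filter_add (l := R.body)
    fun A => IsIDB prog A.pred]
  congr 3
  funext A
  simp

/-- The instance of `R` under `τ`, in terms of the numbers of facts. -/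
noncomputable def Rule.instanceIds (prog : Program ar K) (F : List (Fact ar K)) (R : Rule ar K)
    (τ : ℕ → K) : ℕ × List ℕ :=
  (factId F (R.head.ground τ), (R.idbAtoms prog).map fun B => factId F (B.ground τ))

/-- The facts of the instance of `R` under `τ` are listed. -/
def Rule.Listed (prog : Program ar K) (F : List (Fact ar K)) (R : Rule ar K) (τ : ℕ → K) : Prop :=
  ∀ A ∈ R.head :: R.idbAtoms prog, A.ground τ ∈ F

/-- The instance of `R` under `τ` is recorded. -/
def Recorded (prog : Program ar K) (a : List (Fact ar K) × List (ℕ × List ℕ)) (R : Rule ar K)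
    (τ : ℕ → K) : Prop :=
  R.Listed prog a.1 τ ∧ R.instanceIds prog a.1 τ ∈ a.2

/-- Only instances of rules whose extensional atoms are true are recorded. -/
def OnlyInstances (prog : Program ar K) (D : Database ar K)
    (a : List (Fact ar K) × List (ℕ × List ℕ)) : Prop :=
  ∀ g ∈ a.2, ∃ R ∈ prog, ∃ τ, (∀ A ∈ R.edbAtoms prog, A.InData D τ) ∧ R.Listed prog a.1 τ ∧
    g = R.instanceIds prog a.1 τ

theorem Rule.Listed.of_prefix {prog : Program ar K} {F F' : List (Fact ar K)} {R : Rule ar K}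
    {τ : ℕ → K} (h : R.Listed prog F τ) (hF : F <+: F') :
    R.Listed prog F' τ ∧ R.instanceIds prog F' τ = R.instanceIds prog F τ := by
  refine ⟨fun A hA => hF.subset (h A hA), ?_⟩
  rw [instanceIds, instanceIds, factId_of_prefix hF (h _ (by simp))]
  congr 1
  exact List.map_congr_left fun B hB => factId_of_prefix hF (h B (by simp [hB]))

theorem Recorded.of_prefix {prog : Program ar K} {a a' : List (Fact ar K) × List (ℕ × List ℕ)}
    {R : Rule ar K} {τ : ℕ → K} (h : Recorded prog a R τ) (h1 : a.1 <+: a'.1) (h2 : a.2 <+: a'.2) :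
    Recorded prog a' R τ := by
  obtain ⟨k1, k2⟩ := h.1.of_prefix h1
  refine ⟨k1, ?_⟩
  rw [k2]
  exact h2.subset h.2

theorem Recorded.congr {prog : Program ar K} {a : List (Fact ar K) × List (ℕ × List ℕ)}
    {R : Rule ar K} {τ τ' : ℕ → K} (h : Recorded prog a R τ) (h' : ∀ x, R.HasVar x → τ x = τ' x) :
    Recorded prog a R τ' := by
  have hA : ∀ A ∈ R.head :: R.idbAtoms prog, A.ground τ' = A.ground τ := by
    intro A hA
    refine Atom.ground_congr fun x hx => (h' x ?_).symm
    rcases List.mem_cons.1 hA with rfl | hA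
    · exact .inl hx
    · exact .inr ⟨A, (Rule.mem_idbAtoms.1 hA).1, hx⟩
  have e : R.instanceIds prog a.1 τ' = R.instanceIds prog a.1 τ := by
    rw [Rule.instanceIds, Rule.instanceIds, hA _ (by simp)]
    congr 1
    exact List.map_congr_left fun B hB => by rw [hA B (by simp [hB])]
  refine ⟨fun A hA' => ?_, ?_⟩
  · rw [hA A hA']
    exact h.1 A hA'
  · rw [e]
    exact h.2

theorem register_spec {prog : Program ar K} {D : Database ar K} {R : Rule ar K} (hR : R ∈ prog)
    (a : List (Fact ar K) × List (ℕ × List ℕ)) (α : ℕ → K)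
    {a' : List (Fact ar K) × List (ℕ × List ℕ)}
    (ha' : a' = register D (R.edbAtoms prog) R.head (R.idbAtoms prog) a α) :
    a.1 <+: a'.1 ∧ a.2 <+: a'.2 ∧ a'.1.length ≤ a.1.length + (R.body.length + 1) ∧
      a'.2.length ≤ a.2.length + 1 ∧ (OnlyInstances prog D a → OnlyInstances prog D a') ∧
      ((∀ A ∈ R.edbAtoms prog, A.InData D α) → Recorded prog a' R α) := by
  by_cases h : ∀ A ∈ R.edbAtoms prog, A.InData D α
  · rw [register, if_pos h] at ha'
    subst ha'
    set l := (R.head :: R.idbAtoms prog).map (Atom.ground α) with hl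
    have hpre : a.1 <+: l.foldl addFact a.1 := prefix_foldl_addFact _ _
    have hlisted : R.Listed prog (l.foldl addFact a.1) α := fun A hA =>
      mem_foldl_addFact.2 (.inr (List.mem_map_of_mem hA))
    refine ⟨hpre, List.prefix_append _ _, ?_, by simp, fun ho g hg => ?_, fun _ => ⟨hlisted, ?_⟩⟩
    · refine (length_foldl_addFact_le _ _).trans ?_
      have := R.length_edbAtoms_add prog
      simp only [hl, List.length_map, List.length_cons]
      omega
    · rcases List.mem_append.1 hg with hg | hg
      · obtain ⟨R', hR', τ, h1, h2, rfl⟩ := ho g hg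
        obtain ⟨k1, k2⟩ := h2.of_prefix hpre
        exact ⟨R', hR', τ, h1, k1, k2.symm⟩
      · exact ⟨R, hR, α, h, hlisted, List.mem_singleton.1 hg⟩
    · exact List.mem_append_right _ (List.mem_singleton.2 rfl)
  · rw [register, if_neg h] at ha'
    subst ha'
    exact ⟨List.prefix_rfl, List.prefix_rfl, by omega, by omega, id, fun h' => absurd h' h⟩

theorem foldl_register_spec {prog : Program ar K} {D : Database ar K} {R : Rule ar K}
    (hR : R ∈ prog) (αs : List (ℕ → K)) : ∀ (a a' : List (Fact ar K) × List (ℕ × List ℕ)),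
    a' = αs.foldl (register D (R.edbAtoms prog) R.head (R.idbAtoms prog)) a →
    a.1 <+: a'.1 ∧ a.2 <+: a'.2 ∧
      a'.1.length ≤ a.1.length + αs.length * (R.body.length + 1) ∧
      a'.2.length ≤ a.2.length + αs.length ∧ (OnlyInstances prog D a → OnlyInstances prog D a') ∧
      ∀ α ∈ αs, (∀ A ∈ R.edbAtoms prog, A.InData D α) → Recorded prog a' R α := by
  induction αs with
  | nil =>
    rintro a a' rfl
    exact ⟨List.prefix_rfl, List.prefix_rfl, by simp, by simp, id, by simp⟩
  | cons α αs ih =>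
    intro a a' ha'
    obtain ⟨h1, h2, h3, h4, h5, h6⟩ := register_spec (D := D) hR a α rfl
    obtain ⟨k1, k2, k3, k4, k5, k6⟩ := ih _ a' ha'
    refine ⟨h1.trans k1, h2.trans k2, ?_, ?_, fun h => k5 (h5 h), ?_⟩
    · rw [List.length_cons, add_mul, one_mul]
      omega
    · rw [List.length_cons]
      omega
    · intro β hβ hd
      rcases List.mem_cons.1 hβ with rfl | hβ
      · exact (h6 hd).of_prefix k1 k2
      · exact k6 β hβ hd

/-- Soundness: a recorded ground rule is an instance of a program rule whose extensional atoms lie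
in the database, so propagation stays inside the least fixpoint. -/
theorem holds_of_derivable {prog : Program ar K} {D : Database ar K}
    {a : List (Fact ar K) × List (ℕ × List ℕ)} (h : OnlyInstances prog D a) {n : ℕ}
    (hn : Derivable a.2 n) : ∀ k f, n = k + 1 → a.1[k]? = some f → Holds prog D f := by
  induction hn with
  | top => intro k f hk; cases hk
  | rule g hg _ ih =>
    intro k f hk hf
    obtain ⟨R, hR, τ, h1, h2, rfl⟩ := h g hg
    have hid : ∀ A ∈ R.head :: R.idbAtoms prog, a.1[factId a.1 (A.ground τ) - 1]? =
        some (A.ground τ) := fun A hA => getElem?_factId (h2 A hA)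
    have e : factId a.1 (R.head.ground τ) - 1 = k := by
      have : factId a.1 (R.head.ground τ) = k + 1 := hk
      omega
    have h3 := hid R.head (by simp)
    rw [e, hf] at h3
    obtain rfl := Option.some.inj h3
    refine Holds.rule R hR τ fun B hB => ?_
    by_cases hi : IsIDB prog B.pred
    · have hB' := Rule.mem_idbAtoms.2 ⟨hB, hi⟩
      exact ih _ (List.mem_map_of_mem hB') _ _ (by simp [factId]) (hid B (by simp [hB']))
    · exact Holds.edb _ _ hi (h1 B (Rule.mem_edbAtoms.2 ⟨hB, hi⟩))

/-- Completeness: a derivation uses only instances whose bodies hold, and just these are assumed to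
be recorded. -/
theorem derivable_of_holds {prog : Program ar K} {D : Database ar K}
    {a : List (Fact ar K) × List (ℕ × List ℕ)}
    (h : ∀ R ∈ prog, ∀ τ, (∀ B ∈ R.body, Holds prog D (B.ground τ)) → Recorded prog a R τ)
    {f : Fact ar K} (hf : Holds prog D f) (hi : IsIDB prog f.1) :
    f ∈ a.1 ∧ Derivable a.2 (factId a.1 f) := by
  induction hf with
  | edb p t hp ht => exact absurd hi hp
  | rule R hR τ hB ih =>
    obtain ⟨h1, h2⟩ := h R hR τ hB
    refine ⟨h1 _ (by simp), Derivable.rule _ h2 fun b hb => ?_⟩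
    obtain ⟨B, hB', rfl⟩ := List.mem_map.1 hb
    obtain ⟨hB₁, hB₂⟩ := Rule.mem_idbAtoms.1 hB'
    exact (ih B hB₁ hB₂).2

theorem holds_iff_derivable {prog : Program ar K} {D : Database ar K}
    {a : List (Fact ar K) × List (ℕ × List ℕ)} (h : OnlyInstances prog D a)
    (h' : ∀ R ∈ prog, ∀ τ, (∀ B ∈ R.body, Holds prog D (B.ground τ)) → Recorded prog a R τ)
    {f : Fact ar K} (hi : IsIDB prog f.1) :
    Holds prog D f ↔ ∃ k, a.1[k]? = some f ∧ Derivable a.2 (k + 1) := by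
  constructor
  · intro hf
    obtain ⟨h1, h2⟩ := derivable_of_holds h' hf hi
    exact ⟨_, getElem?_factId h1, by simpa [factId] using h2⟩
  · rintro ⟨k, hk, hd⟩
    exact holds_of_derivable h hd k f rfl hk

theorem Holds.inData {prog : Program ar K} (hprog : WellFormed prog) {D : Database ar K}
    {A : Atom ar K} {τ : ℕ → K} (h : Holds prog D (A.ground τ)) (hA : ¬ IsIDB prog A.pred) :
    A.InData D τ :=
  (h.exists_adornment hprog).1 hA

/-! ### Evaluation of a rule of the adorned program -/

noncomputable def Plan.vars (p : Plan ar K) : List ℕ := (p.1.joinVars p.2.2).toList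

theorem Plan.nodup_vars (p : Plan ar K) : p.vars.Nodup := Finset.nodup_toList _

theorem Plan.length_vars_le {prog : Program ar K} {p : Plan ar K} (hp : p.1 ∈ prog) :
    p.vars.length ≤ (maxBody prog + 1) * maxArity prog := by
  classical
  rw [vars, Finset.length_toList]
  exact (Finset.card_le_card (Finset.filter_subset _ _)).trans (Rule.card_allVars_le hp)

open Classical in
/-- The `n`-th edge of the join query. -/
noncomputable def Plan.edge (prog : Program ar K) (p : Plan ar K) (n : ℕ) : JoinEdge ar :=
  if h : ∃ B ∈ p.2.1.body, B.vars = p.2.1.edges.toList.getD n ∅ then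
    h.choose.joinEdge prog p.1 p.2.2
  else ⟨p.1.head.pred, fun _ => none⟩

theorem Plan.exists_edge {prog : Program ar K} {p : Plan ar K} {n : ℕ} (hn : n < p.2.1.edges.card) :
    ∃ B ∈ p.2.1.body, B.vars = p.2.1.edges.toList.getD n ∅ ∧
      p.edge prog n = B.joinEdge prog p.1 p.2.2 := by
  classical
  have h : ∃ B ∈ p.2.1.body, B.vars = p.2.1.edges.toList.getD n ∅ := by
    rw [← Finset.length_toList] at hn
    have := List.getElem_mem hn
    rw [Finset.mem_toList] at this
    obtain ⟨B, hB, e⟩ := Finset.mem_image.1 this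
    exact ⟨B, hB, by rw [e, List.getD_eq_getElem _ _ hn]⟩
  exact ⟨h.choose, h.choose_spec.1, h.choose_spec.2, dif_pos h⟩

/-- The numbers of the edges of the `i`-th plan. -/
noncomputable def Plan.edgeIds (p : Plan ar K) (i : ℕ) : List ℕ :=
  (List.range p.2.1.edges.card).map (Nat.pair i)

theorem Plan.mem_edgeIds {p : Plan ar K} {i k : ℕ} :
    k ∈ p.edgeIds i ↔ k.unpair.1 = i ∧ k.unpair.2 < p.2.1.edges.card := by
  simp only [edgeIds, List.mem_map, List.mem_range]
  constructor
  · rintro ⟨j, hj, rfl⟩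
    simpa using hj
  · rintro ⟨rfl, h⟩
    exact ⟨_, h, Nat.pair_unpair k⟩

/-- The search refers to edges by number and covers refer to them as sets of variables; weights are
carried over through the enumeration of the edges. -/
theorem Plan.sum_edgeIds (p : Plan ar K) (i : ℕ) (g : Finset ℕ → ℝ) :
    ∑ k ∈ (p.edgeIds i).toFinset, g (p.2.1.edges.toList.getD k.unpair.2 ∅) =
      ∑ e ∈ p.2.1.edges, g e := by
  have hnd : (p.edgeIds i).Nodup := List.nodup_range.map fun a b h => by
    simpa using congrArg (fun n => n.unpair.2) h
  rw [List.sum_toFinset _ hnd, ← Finset.sum_map_toList, edgeIds, List.map_map]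
  congr 1
  refine List.ext_getElem (by simp) fun n h1 h2 => ?_
  have hn : n < p.2.1.edges.toList.length := by simpa using h2
  simp [List.getElem?_eq_getElem hn]

/-- The numbers `k` of the edges of the `i`-th plan `p` stand for its edges. -/
def Plan.HasEdges (prog : Program ar K) (p : Plan ar K) (i : ℕ) (J : ℕ → JoinEdge ar) : Prop :=
  ∀ k ∈ p.edgeIds i, J k = p.edge prog k.unpair.2

/-- `p` is a plan for a rule of the adorned program. -/
structure Plan.Valid (prog : Program ar K) (p : Plan ar K) : Prop where
  mem : p.1 ∈ prog
  mem_adornments : p.2.1 ∈ adornments prog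
  generates : Generates prog p.1 p.2.1 p.2.2

theorem Plan.HasEdges.rel {prog : Program ar K} {p : Plan ar K} {i : ℕ} {J : ℕ → JoinEdge ar}
    (hJ : p.HasEdges prog i J) (hp : p.Valid prog) {k : ℕ} (hk : k ∈ p.edgeIds i) :
    IsEDBOf prog (J k).rel := by
  obtain ⟨B, hB, -, e⟩ := Plan.exists_edge (prog := prog) (Plan.mem_edgeIds.1 hk).2
  rw [hJ k hk, e]
  exact hp.generates.shaped.edb B hB

theorem Plan.HasEdges.col {prog : Program ar K} (hg : AdornmentGroundable prog) {p : Plan ar K}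
    {i : ℕ} {J : ℕ → JoinEdge ar} (hJ : p.HasEdges prog i J) (hp : p.Valid prog) {x : ℕ}
    (hx : x ∈ p.vars) : ∃ v ∈ p.2.1.head.vars, ∀ k ∈ p.edgeIds i,
      v ∈ p.2.1.edges.toList.getD k.unpair.2 ∅ → (J k).col x ≠ none := by
  obtain ⟨v, hv, h⟩ := hp.generates.exists_determines hg hp.mem (Finset.mem_toList.1 hx)
  refine ⟨v, hv, fun k hk hvk => ?_⟩
  obtain ⟨B, hB, e1, e2⟩ := Plan.exists_edge (prog := prog) (Plan.mem_edgeIds.1 hk).2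
  rw [hJ k hk, e2, WAtom.joinEdge_col.1]
  exact h B hB (by rwa [e1])

theorem Plan.HasEdges.exists_col {prog : Program ar K} (hg : AdornmentGroundable prog)
    {p : Plan ar K} {i : ℕ} {J : ℕ → JoinEdge ar} (hJ : p.HasEdges prog i J) (hp : p.Valid prog)
    {x : ℕ} (hx : x ∈ p.vars) : ∃ k ∈ p.edgeIds i, (J k).col x ≠ none := by
  classical
  obtain ⟨v, hv, h⟩ := hJ.col hg hp hx
  obtain ⟨B, hB, hvB⟩ := hp.generates.shaped.covered v hv
  have he : B.vars ∈ p.2.1.edges.toList := Finset.mem_toList.2 (Finset.mem_image_of_mem _ hB)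
  obtain ⟨n, hn, e⟩ := List.getElem_of_mem he
  have hk : Nat.pair i n ∈ p.edgeIds i := Plan.mem_edgeIds.2 (by simpa using hn)
  refine ⟨_, hk, h _ hk ?_⟩
  rw [Nat.unpair_pair, List.getD_eq_getElem _ _ hn, e]
  exact hvB

/-- Let `w` be a cover of the adornment. A join variable `x` is attached to a head variable `v`, and
all edges containing `v` have a column for `x`; so the weights available at `x` include those at `v`
and sum to at least 1. The bound thus holds for each cover, and passes to the infimum. -/
theorem Plan.joinWork_le {prog : Program ar K} (hprog : WellFormed prog)
    (hg : AdornmentGroundable prog) {D : Database ar K} {N : ℕ} (hN : 1 ≤ N)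
    (hD : ∀ p, IsEDBOf prog p → (D.rel p).length ≤ N) {p : Plan ar K} (hp : p.Valid prog) {i : ℕ}
    {J : ℕ → JoinEdge ar} (hJ : p.HasEdges prog i J) (α : ℕ → K) :
    (joinWork J D (p.edgeIds i).toFinset [] p.vars α : ℝ) ≤
      (2 * ((maxBody prog + 1) * maxArity prog) + 1) * (N : ℝ) ^ edgeCoverWidth prog := by
  classical
  have hN' : (1 : ℝ) ≤ N := by exact_mod_cast hN
  have hcov : ∀ w, p.2.1.IsFractionalCover w →
      (joinWork J D (p.edgeIds i).toFinset [] p.vars α : ℝ) ≤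
        (2 * p.vars.length + 1) * (N : ℝ) ^ ∑ e ∈ p.2.1.edges, w e := by
    intro w hw
    have hmem : ∀ k ∈ p.edgeIds i, p.2.1.edges.toList.getD k.unpair.2 ∅ ∈ p.2.1.edges := by
      intro k hk
      have hn := (Plan.mem_edgeIds.1 hk).2
      rw [← Finset.length_toList] at hn
      rw [List.getD_eq_getElem _ _ hn]
      exact Finset.mem_toList.1 (List.getElem_mem hn)
    rw [← p.sum_edgeIds i w]
    refine joinWork_le_rpow (w := fun k => w (p.2.1.edges.toList.getD k.unpair.2 ∅))
      (fun k hk => (hw.1 _ (hmem k (List.mem_toFinset.1 hk))).1) p.nodup_vars (fun x hx => ?_) hN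
      (fun k hk => hD _ (hJ.rel hp (List.mem_toFinset.1 hk))) α
    obtain ⟨v, hv, h⟩ := hJ.col hg hp hx
    refine (hw.2 v hv).trans ?_
    rw [Finset.sum_filter, ← p.sum_edgeIds i fun e => if v ∈ e then w e else 0, ← Finset.sum_filter]
    refine Finset.sum_le_sum_of_subset_of_nonneg (fun k hk => ?_) fun k hk _ => ?_
    · rw [Finset.mem_filter, List.mem_toFinset] at *
      exact ⟨hk.1, h k hk.1 hk.2⟩
    · rw [Finset.mem_filter, List.mem_toFinset] at hk
      exact (hw.1 _ (hmem k hk.1)).1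
  refine (hp.generates.shaped.le_mul_rpow_width hN (by positivity) hcov).trans ?_
  refine mul_le_mul ?_ (Real.rpow_le_rpow_of_exponent_le hN'
    (width_le_edgeCoverWidth hprog hp.mem_adornments)) (by positivity) (by positivity)
  have : (p.vars.length : ℝ) ≤ ((maxBody prog + 1) * maxArity prog : ℕ) := by
    exact_mod_cast Plan.length_vars_le hp.mem
  push_cast at this
  linarith

/-- Building a trie takes time proportional to the size of the relation. This does not exceed the
claimed bound, because a plan with an edge has width at least 1. -/
theorem Plan.le_rpow {prog : Program ar K} (hprog : WellFormed prog) {N : ℕ} (hN : 1 ≤ N)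
    {p : Plan ar K} (hp : p.Valid prog) {i k : ℕ} (hk : k ∈ p.edgeIds i) :
    (N : ℝ) ≤ (N : ℝ) ^ edgeCoverWidth prog := by
  have hN' : (1 : ℝ) ≤ N := by exact_mod_cast hN
  have hne : p.2.1.edges.Nonempty := Finset.card_pos.1 (by
    have := (Plan.mem_edgeIds.1 hk).2
    omega)
  calc (N : ℝ) = (N : ℝ) ^ (1 : ℝ) := (Real.rpow_one _).symm
    _ ≤ _ := Real.rpow_le_rpow_of_exponent_le hN' ((hp.generates.shaped.one_le_width hne).trans
      (width_le_edgeCoverWidth hprog hp.mem_adornments))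

noncomputable def Plan.cmd (prog : Program ar K) (J : ℕ → JoinEdge ar) (p : Plan ar K) (i : ℕ) :
    Cmd P K :=
  .seq (.seqMap (p.1.fixedVars p.2.2).toList fun y => .assign (.var y) (p.2.2 y).opd)
    (.search J (p.edgeIds i)
      (.register (p.1.edbAtoms prog) p.1.head (p.1.idbAtoms prog)) [] p.vars)

theorem Plan.mem_vars_or_fixedVars {p : Plan ar K} {y : ℕ} (hy : y ∈ p.1.allVars) :
    y ∈ p.vars ∨ y ∈ p.1.fixedVars p.2.2 := by
  classical
  simp only [vars, Finset.mem_toList, Rule.joinVars, Rule.fixedVars, Finset.mem_filter, hy,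
    true_and]
  tauto

/-- The starting assignment has to be right on the fixed variables only, where `σ` gives constants;
the arbitrary element of `K` fills the rest. Instances that fit the join agree, on the variables of
the rule, with an assignment for which the leaf was run. -/
theorem WP.plan [Nonempty K] {prog : Program ar K} (hg : AdornmentGroundable prog)
    {D : Database ar K} {p : Plan ar K} (hp : p.Valid prog) {i : ℕ} {J : ℕ → JoinEdge ar}
    (hJ : p.HasEdges prog i J) {m : ℕ}
    (hm : ∀ α : ℕ → K, joinWork J D (p.edgeIds i).toFinset [] p.vars α ≤ m) {s : Mach P K}
    {a : List (Fact ar K) × List (ℕ × List ℕ)} (hs : s.HasTries J D p.vars (p.edgeIds i))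
    (ha : s.HasInstances D {q | ¬ IsIDB prog q} a) :
    WP (p.cmd prog J i) ((maxBody prog + 1) * maxArity prog + ((2 ^ maxArity prog + 1) *
        (4 * ((maxBody prog + 1) * maxArity prog) + 20) +
          (maxBody prog + 1) * (22 * maxArity prog + 100)) * m)
      (fun s' => s.Agree s' (Set.Ioo 5 14) Set.univ ∧ ∃ αs : List (ℕ → K),
        s'.HasInstances D {q | ¬ IsIDB prog q} (αs.foldl
          (register D (p.1.edbAtoms prog) p.1.head (p.1.idbAtoms prog)) a) ∧ αs.length ≤ m ∧
        ∀ τ : ℕ → K, (∀ k ∈ p.edgeIds i, ∃ t ∈ D.rel (J k).rel, (J k).Fits τ p.vars t) →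
          (∀ y ∈ p.1.fixedVars p.2.2, p.2.2 y = .const (τ y)) →
            ∃ α ∈ αs, ∀ x, p.1.HasVar x → α x = τ x) s := by
  classical
  set α₀ : ℕ → K := fun y => (p.2.2 y).ground fun _ => Classical.arbitrary K with hα₀
  have hfix : ∀ y ∈ p.1.fixedVars p.2.2, ∃ c, p.2.2 y = .const c := fun y hy =>
    (Finset.mem_filter.1 hy).2.2
  have hassign := WP.seqMap (s := s) (l := (p.1.fixedVars p.2.2).toList)
    (c := fun y => Cmd.assign (P := P) (.var y) (p.2.2 y).opd) (fun _ => 1)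
    (fun l₁ s' => (∀ y ∈ l₁, s'.env (.var y) = .const (α₀ y)) ∧
      s.Agree s' ∅ (Set.range Slot.var)) ?_ ⟨by simp, .refl _ _ _⟩
  swap
  · rintro l₁ y l₂ hl s' ⟨h1, h2⟩
    refine WP.assign ⟨fun z hz => ?_, h2.trans (Mach.Agree.set _ (by simp) _)⟩
    obtain ⟨c, hc⟩ := hfix y (Finset.mem_toList.1 (by rw [hl]; simp))
    have e : (p.2.2 y).opd.eval s' = .const (α₀ y) := by
      simp only [hα₀, hc]
      rfl
    rw [e]
    by_cases hzy : z = y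
    · subst hzy; simp
    · rw [Mach.env_set_of_ne _ _ (by simpa using hzy)]
      exact h1 z (by simpa [hzy] using hz)
  have hleaf : LeafSpec (Cmd.register (p.1.edbAtoms prog) p.1.head (p.1.idbAtoms prog))
      ((maxBody prog + 1) * (22 * maxArity prog + 100)) p.1.allVars.toList (Set.Ioo 5 14)
      (Set.range Slot.tmp) (Mach.HasInstances D {q | ¬ IsIDB prog q})
      (register D (p.1.edbAtoms prog) p.1.head (p.1.idbAtoms prog)) := by
    have hmem : ∀ A ∈ p.1.head :: (p.1.edbAtoms prog ++ p.1.idbAtoms prog),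
        A ∈ p.1.head :: p.1.body := by
      intro A hA
      simp only [List.mem_cons, List.mem_append, Rule.mem_edbAtoms, Rule.mem_idbAtoms] at hA ⊢
      tauto
    refine LeafSpec.register (fun A hA => (Rule.mem_edbAtoms.1 hA).2) (fun A hA y hy => ?_)
      (fun A hA => le_maxArity hp.mem (hmem A hA)) ?_
    · rw [Finset.mem_toList, Rule.mem_allVars]
      rcases List.mem_cons.1 (hmem A hA) with rfl | hA
      exacts [.inl hy, .inr ⟨A, hA, hy⟩]
    · rw [Rule.length_edbAtoms_add]
      exact Finset.le_sup (f := fun R : Rule ar K => R.body.length) hp.mem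
  refine (WP.seq (hassign.mono le_rfl ?_)).mono (t := ((p.1.fixedVars p.2.2).toList.map fun _ =>
    1).sum + ((2 ^ maxArity prog + 1) * (4 * ((maxBody prog + 1) * maxArity prog) + 20) +
      (maxBody prog + 1) * (22 * maxArity prog + 100)) * m) ?_ fun _ h => h
  · rintro s₁ ⟨h1, h2⟩
    have hs₁ : s₁.HasTries J D p.vars (p.edgeIds i) := hs.of_agree h2 (by simp)
    have ha₁ : s₁.HasInstances D {q | ¬ IsIDB prog q} a :=
      ⟨ha.1.of_agree h2 (by simp) (by simp [factReg]),
        ha.2.1.of_agree h2 (by simp) (by simp [ruleReg]), fun q hq t => by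
          rw [h2.1 2 (by simp)]; exact ha.2.2 q hq t⟩
    have hsearch := WP.search (J := J) (D := D) (es := p.edgeIds i) p.nodup_vars
      (W := p.1.allVars.toList)
      (fun y hy => Finset.mem_toList.2 (Finset.mem_filter.1 (Finset.mem_toList.1 hy)).1)
      (fun x hx => hJ.exists_col hg hp hx) hleaf p.vars [] α₀ a s₁ rfl hs₁
      (fun y hy hyV => h1 y (Finset.mem_toList.2
        ((Plan.mem_vars_or_fixedVars (Finset.mem_toList.1 hy)).resolve_left hyV))) ha₁
    refine hsearch.mono ?_ ?_
    · refine Nat.mul_le_mul ?_ (hm α₀)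
      have hlen : (p.edgeIds i).length ≤ 2 ^ maxArity prog := by
        simpa [Plan.edgeIds] using hp.generates.shaped.card_edges_le
      have := Plan.length_vars_le hp.mem
      gcongr
    · rintro s' ⟨k1, αs, k2, k3, k4⟩
      refine ⟨(h2.mono (by simp) (Set.subset_univ _)).trans (k1.mono le_rfl (Set.subset_univ _)),
        αs, k2, k3.trans (hm α₀), fun τ hτ hτ' => ?_⟩
      -- The search enumerates assignments that equal `α₀` off the join variables, so `τ` is cut
      -- down accordingly; on the fixed variables both have the value given by `σ`.
      refine ⟨fun y => if y ∈ p.vars then τ y else α₀ y, k4 _ (fun y hy => if_neg hy) ?_, ?_⟩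
      · intro k hk
        obtain ⟨t, ht, hf⟩ := hτ k hk
        refine ⟨t, ht, fun y hy j hj => ?_⟩
        exact (if_pos hy).trans (hf y hy j hj)
      · intro x hx
        by_cases hxV : x ∈ p.vars
        · exact if_pos hxV
        · have hxf := (Plan.mem_vars_or_fixedVars (Rule.mem_allVars.2 hx)).resolve_left hxV
          simp only [if_neg hxV, hα₀, hτ' x hxf]
          rfl
  · have : (p.1.fixedVars p.2.2).card ≤ (maxBody prog + 1) * maxArity prog :=
      (Finset.card_le_card (Finset.filter_subset _ _)).trans (Rule.card_allVars_le hp.mem)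
    simpa using this

/-- True instances of rules satisfy the join query of some plan. -/
theorem exists_plan_fits {prog : Program ar K} (hprog : WellFormed prog) {L : List (Plan ar K)}
    (hL : ∀ p ∈ L, p.Valid prog)
    (hL' : ∀ R ∈ prog, ∀ ρ ∈ adornments prog, ∀ σ, Generates prog R ρ σ →
        ∃ p ∈ L, p.1 = R ∧ p.2.1 ∈ ρ.renamings) {D : Database ar K} {R : Rule ar K}
    (hR : R ∈ prog) {τ : ℕ → K} (h : ∀ B ∈ R.body, Holds prog D (B.ground τ)) :
    ∃ p ∈ L, p.1 = R ∧ (∀ y ∈ p.1.fixedVars p.2.2, p.2.2 y = .const (τ y)) ∧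
      ∀ (i : ℕ) (J : ℕ → JoinEdge ar), p.HasEdges prog i J →
        ∀ k ∈ p.edgeIds i, ∃ t ∈ D.rel (J k).rel, (J k).Fits τ p.vars t := by
  classical
  obtain ⟨p, hp, rfl, σ, β, h1, h2, h3⟩ := exists_representative hprog hL' hR h
  have hg := (hL p hp).generates
  refine ⟨p, hp, rfl, fun y hy => ?_, fun i J hJ k hk => ?_⟩
  · obtain ⟨hy, hyh, c, hc⟩ := Finset.mem_filter.1 hy
    rw [h2 y (Rule.mem_allVars.1 hy), ← hg.eq_of_mem_head h1 hyh, hc]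
    rfl
  · obtain ⟨B, hB, -, e⟩ := Plan.exists_edge (prog := prog) (Plan.mem_edgeIds.1 hk).2
    obtain ⟨t, ht, hf⟩ := hg.exists_tuple h1 h2 h3
      (fun A hA hi => Holds.inData hprog (h A hA) hi) hB
    rw [hJ k hk, e]
    exact ⟨t, ht, fun y _ j hj => hf y j (WAtom.joinEdge_col.2 j hj)⟩

/-! ### Evaluation of a program -/

theorem WP.buildTries {J : ℕ → JoinEdge ar} {V : ℕ → List ℕ} {D : Database ar K} {N v : ℕ}
    {ids : List ℕ} (hids : ids.Nodup) (hV : ∀ n ∈ ids, (V n).Nodup ∧ (V n).length ≤ v)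
    (hN : ∀ n ∈ ids, (D.rel (J n).rel).length ≤ N) {s : Mach P K}
    (h0 : ∀ n ∈ ids, s.tab 0 [.pred (J n).rel] = .nat (D.rel (J n).rel).length)
    (h1 : ∀ n ∈ ids, ∀ (j : Fin (D.rel (J n).rel).length) (i : Fin (ar (J n).rel)),
      s.tab 1 [.pred (J n).rel, .nat j, .nat i] = .const ((D.rel (J n).rel).get j i))
    (hs : ∀ n ∈ ids, s.HasTrie n ∅) :
    WP (.seqMap ids fun n => .buildTrie n (J n) (V n))
      (ids.length * (N * (v * (10 * v + 59) + 2) + 7))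
      (fun s' => (∀ n ∈ ids, s'.HasTrie n ((J n).words (V n) (D.rel (J n).rel))) ∧
        s.Agree s' {3, 4, 5} ({.tmp 0, .tmp 1, .idx 0, .lim 0} ∪ Set.range Slot.var)) s := by
  refine (WP.seqMap (fun n => (D.rel (J n).rel).length *
    ((V n).length * (10 * (V n).length + 59) + 2) + 7) (fun l₁ s' =>
      (∀ n ∈ l₁, s'.HasTrie n ((J n).words (V n) (D.rel (J n).rel))) ∧
      (∀ n ∈ ids, n ∉ l₁ → s'.HasTrie n ∅) ∧
      s.Agree s' {3, 4, 5} ({.tmp 0, .tmp 1, .idx 0, .lim 0} ∪ Set.range Slot.var)) ?_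
      ⟨by simp, fun n hn _ => hs n hn, .refl _ _ _⟩).mono ?_ fun s' h => ⟨h.1, h.2.2⟩
  · rintro l₁ n l₂ hl s' ⟨k1, k2, k3⟩
    have hn : n ∈ ids := by simp [hl]
    have hnl : n ∉ l₁ := by
      rw [hl, List.nodup_append] at hids
      exact fun h => hids.2.2 n h n (by simp) rfl
    refine (WP.buildTrie (hV n hn).1 (by rw [k3.1 0 (by simp)]; exact h0 n hn)
      (by rw [k3.1 1 (by simp)]; exact h1 n hn) (k2 n hn hnl)).mono le_rfl ?_
    rintro s'' ⟨l1, l2, l3⟩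
    refine ⟨fun n' hn' => ?_, fun n' hn' hn'' => ?_, k3.trans l3⟩
    · rcases List.mem_append.1 hn' with hn' | hn'
      · exact l2 n' (fun e => hnl (e ▸ hn')) _ (k1 n' hn')
      · simp only [List.mem_singleton] at hn'
        subst hn'
        exact l1
    · simp only [List.mem_append, List.mem_singleton, not_or] at hn''
      exact l2 n' hn''.2 _ (k2 n' hn' hn''.1)
  · rw [← List.length_map (as := ids) fun n => (D.rel (J n).rel).length *
      ((V n).length * (10 * (V n).length + 59) + 2) + 7, ← smul_eq_mul]
    refine List.sum_le_card_nsmul _ _ fun k hk => ?_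
    obtain ⟨n, hn, rfl⟩ := List.mem_map.1 hk
    have h1 := hN n hn
    have h2 := (hV n hn).2
    gcongr

/-- Later plans only extend the lists of facts and of ground rules, so what one plan has recorded is
preserved by the following ones. -/
theorem WP.plans [Nonempty K] {prog : Program ar K} (hg : AdornmentGroundable prog)
    {D : Database ar K} {L : List (Plan ar K)} (hL : ∀ p ∈ L, p.Valid prog)
    {J : ℕ → JoinEdge ar} (hJ : ∀ (i : ℕ) (p : Plan ar K),
      L[i]? = some p → p.HasEdges prog i J) {m : ℕ}
    (hm : ∀ (i : ℕ) (p : Plan ar K), L[i]? = some p → ∀ α : ℕ → K,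
      joinWork J D (p.edgeIds i).toFinset [] p.vars α ≤ m) {s : Mach P K}
    (hs : ∀ (i : ℕ) (p : Plan ar K), L[i]? = some p → s.HasTries J D p.vars (p.edgeIds i))
    (ha : s.HasInstances D {q | ¬ IsIDB prog q} (([] : List (Fact ar K)), [])) :
    WP (.seqMap L.zipIdx fun x => x.1.cmd prog J x.2)
      (L.length * ((maxBody prog + 1) * maxArity prog + ((2 ^ maxArity prog + 1) *
        (4 * ((maxBody prog + 1) * maxArity prog) + 20) +
          (maxBody prog + 1) * (22 * maxArity prog + 100)) * m))
      (fun s' => s.Agree s' (Set.Ioo 5 14) Set.univ ∧ ∃ a : List (Fact ar K) × List (ℕ × List ℕ),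
        s'.HasInstances D {q | ¬ IsIDB prog q} a ∧ OnlyInstances prog D a ∧
        a.1.length ≤ L.length * (m * (maxBody prog + 1)) ∧ a.2.length ≤ L.length * m ∧
        ∀ (i : ℕ) (p : Plan ar K), L[i]? = some p → ∀ τ : ℕ → K,
          (∀ k ∈ p.edgeIds i, ∃ t ∈ D.rel (J k).rel, (J k).Fits τ p.vars t) →
          (∀ y ∈ p.1.fixedVars p.2.2, p.2.2 y = .const (τ y)) →
          (∀ A ∈ p.1.edbAtoms prog, A.InData D τ) → Recorded prog a p.1 τ) s := by
  set t := (maxBody prog + 1) * maxArity prog + ((2 ^ maxArity prog + 1) *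
        (4 * ((maxBody prog + 1) * maxArity prog) + 20) +
          (maxBody prog + 1) * (22 * maxArity prog + 100)) * m with ht
  refine (WP.seqMap (fun _ => t) (fun l₁ s' => s.Agree s' (Set.Ioo 5 14) Set.univ ∧
    ∃ a : List (Fact ar K) × List (ℕ × List ℕ),
        s'.HasInstances D {q | ¬ IsIDB prog q} a ∧ OnlyInstances prog D a ∧
        a.1.length ≤ l₁.length * (m * (maxBody prog + 1)) ∧ a.2.length ≤ l₁.length * m ∧
        ∀ x ∈ l₁, ∀ τ : ℕ → K,
          (∀ k ∈ x.1.edgeIds x.2, ∃ t ∈ D.rel (J k).rel, (J k).Fits τ x.1.vars t) →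
          (∀ y ∈ x.1.1.fixedVars x.1.2.2, x.1.2.2 y = .const (τ y)) →
          (∀ A ∈ x.1.1.edbAtoms prog, A.InData D τ) → Recorded prog a x.1.1 τ) ?_
    ⟨.refl _ _ _, _, ha, by simp [OnlyInstances], by simp, by simp, by simp⟩).mono (by simp) ?_
  · rintro l₁ ⟨p, i⟩ l₂ hl s' ⟨k1, a, k2, k3, k4, k5, k6⟩
    have hLi : L[i]? = some p :=
      List.mem_zipIdx_iff_getElem?.1 (show (p, i) ∈ L.zipIdx by rw [hl]; simp)
    have hp : p.Valid prog := hL p (List.mem_of_getElem? hLi)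
    refine (WP.plan hg hp (hJ i p hLi) (hm i p hLi) ((hs i p hLi).of_agree k1
      fun n h => h.1) k2).mono
      le_rfl ?_
    rintro s'' ⟨l1, αs, l2, l3, l4⟩
    obtain ⟨r1, r2, r3, r4, r5, r6⟩ := foldl_register_spec (D := D) hp.mem αs a _ rfl
    have hb : p.1.body.length ≤ maxBody prog :=
      Finset.le_sup (f := fun R : Rule ar K => R.body.length) hp.mem
    refine ⟨k1.trans l1, _, l2, r5 k3, r3.trans ?_, r4.trans ?_, fun x hx τ h1 h2 h3 => ?_⟩
    · have : αs.length * (p.1.body.length + 1) ≤ m * (maxBody prog + 1) :=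
        Nat.mul_le_mul l3 (by omega)
      simp only [List.length_append, List.length_singleton, add_mul, one_mul] at *
      omega
    · simp only [List.length_append, List.length_singleton, add_mul, one_mul]
      omega
    · rcases List.mem_append.1 hx with hx | hx
      · exact (k6 x hx τ h1 h2 h3).of_prefix r1 r2
      · simp only [List.mem_singleton] at hx
        subst hx
        obtain ⟨α, hα, hατ⟩ := l4 τ h1 h2
        refine (r6 α hα fun A hA => ?_).congr hατ
        have : A.ground α = A.ground τ := Atom.ground_congr fun x hx =>
          hατ x (.inr ⟨A, (Rule.mem_edbAtoms.1 hA).1, hx⟩)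
        exact (congrArg (fun f : Fact ar K => f.2 ∈ D.rel f.1) this).mpr (h3 A hA)
  · rintro s' ⟨k1, a, k2, k3, k4, k5, k6⟩
    refine ⟨k1, a, k2, k3, by simpa using k4, by simpa using k5, fun i p hi => ?_⟩
    exact k6 (p, i) (List.mem_zipIdx_iff_getElem?.2 hi)

noncomputable def initMach (prog : Program ar K) (D : Database ar K) : Mach P K :=
  ⟨fun _ => .nat 0, fun n a => (initState prog D).mem (.nat n :: a)⟩

theorem represents_initMach (prog : Program ar K) (D : Database ar K) :
    Represents (initState prog D) (initMach prog D) := ⟨fun _ => rfl, fun _ _ => rfl⟩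

theorem tab_initMach {prog : Program ar K} {D : Database ar K} {n : ℕ} (hn : 2 < n)
    (a : List (Val P K)) : (initMach prog D).tab n a = .nat 0 := by
  obtain ⟨k, rfl⟩ : ∃ k, n = k + 3 := ⟨n - 3, by omega⟩
  rcases a with _ | ⟨x, _ | ⟨y, _ | ⟨z, _ | ⟨w, a⟩⟩⟩⟩ <;> rfl

theorem hasInstances_initMach (prog : Program ar K) (D : Database ar K) :
    (initMach prog D).HasInstances D {q | ¬ IsIDB prog q} (([] : List (Fact ar K)), []) := by
  classical
  refine ⟨⟨by simp, rfl, by simp, fun f _ => tab_initMach (by omega) _, fun q => ⟨?_, ?_⟩, by simp⟩,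
    ⟨rfl, by simp, fun r i => ?_, fun n => ⟨?_, ?_⟩⟩, fun p hp t => ?_⟩
  · rw [tab_initMach (by omega)]
    simp [factIds]
  · simp [factIds]
  · rw [tab_initMach (by omega)]
    simp [bodyAt]
  · rw [tab_initMach (by omega)]
    simp [watchers]
  · simp [watchers]
  · have e : (initMach prog D).tab 2 (Fact.addr ⟨p, t⟩) =
        if ¬ IsIDB prog p ∧ ∃ t' ∈ D.rel p, (List.ofFn fun j => Val.const (P := P) (t j)) =
          List.ofFn fun j => .const (t' j) then .nat 1 else .nat 0 := rfl
    have hp : ¬ IsIDB prog p := hp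
    have hex : (∃ t' ∈ D.rel p, (List.ofFn fun j => Val.const (P := P) (t j)) =
          List.ofFn fun j => .const (t' j)) ↔ t ∈ D.rel p := by
      constructor
      · rintro ⟨t', ht', h⟩
        have : t = t' := funext fun j => Val.const.inj (congrFun (List.ofFn_injective h) j)
        rwa [this]
      · exact fun h => ⟨t, h, rfl⟩
    rw [e]
    exact ⟨fun h => if_pos ⟨hp, hex.2 h⟩, fun h => if_neg fun h' => h (hex.1 h'.2)⟩

theorem stores_initMach {prog : Program ar K} (D : Database ar K) {q : P} (hq : IsIDB prog q) :
    (initMach prog D).Stores q ([] : List (Fin (ar q) → K)) := by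
  classical
  refine ⟨?_, by simp, by simp, fun t _ => ?_⟩
  · have e : (initMach prog D).tab 0 [.pred q] =
        if IsIDB prog q then .nat 0 else .nat (D.rel q).length := rfl
    rw [e, if_pos hq]
    rfl
  · have e : (initMach prog D).tab 2 (Fact.addr ⟨q, t⟩) =
        if ¬ IsIDB prog q ∧ ∃ t' ∈ D.rel q, (List.ofFn fun j => Val.const (P := P) (t j)) =
          List.ofFn fun j => .const (t' j) then .nat 1 else .nat 0 := rfl
    rw [e, if_neg fun h => h.1 hq]

theorem relation_initMach {prog : Program ar K} (D : Database ar K) {q : P}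
    (hq : ¬ IsIDB prog q) : (initMach prog D).tab 0 [.pred q] = .nat (D.rel q).length ∧
      ∀ (j : Fin (D.rel q).length) (i : Fin (ar q)),
        (initMach prog D).tab 1 [.pred q, .nat j, .nat i] = .const ((D.rel q).get j i) := by
  classical
  constructor
  · have e : (initMach prog D).tab 0 [.pred q] =
        if IsIDB prog q then .nat 0 else .nat (D.rel q).length := rfl
    rw [e, if_neg hq]
  · intro j i
    have e : (initMach prog D).tab 1 [.pred q, .nat j, .nat i] =
        if h : ¬ IsIDB prog q ∧ (j : ℕ) < (D.rel q).length ∧ (i : ℕ) < ar q then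
          .const ((D.rel q).get ⟨j, h.2.1⟩ ⟨i, h.2.2⟩) else .nat 0 := rfl
    rw [e, dif_pos ⟨hq, j.2, i.2⟩]

theorem hasTrie_initMach (prog : Program ar K) (D : Database ar K) (n : ℕ) :
    (initMach prog D).HasTrie n (∅ : Set (List K)) := by
  intro k
  refine ⟨⟨[], by simp, by simp, ?_, by simp⟩, by simp, fun _ => ?_⟩
  · rw [tab_initMach (by omega)]
    rfl
  · exact tab_initMach (by omega) _

theorem Mach.Stores.of_tab {s s' : Mach P K} {p : P} {L : List (Fin (ar p) → K)}
    (h : s.Stores p L) (hs : ∀ n < 3, s'.tab n = s.tab n) : s'.Stores p L := by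
  unfold Mach.Stores at *
  rwa [hs 0 (by omega), hs 1 (by omega), hs 2 (by omega)]

theorem Mach.Stores.state {S : State P K} {s : Mach P K} (hS : Represents S s) {p : P}
    {L : List (Fin (ar p) → K)} (h : s.Stores p L) : S.Stores p L := by
  obtain ⟨h1, h2, h3, h4⟩ := h
  refine ⟨?_, fun i j => ?_, fun t ht => ?_, fun t ht => ?_⟩
  · rw [hS.2]; exact h1
  · rw [hS.2]; exact h2 i j
  · rw [hS.2]; exact h3 t ht
  · rw [hS.2]; exact h4 t ht

theorem OnlyInstances.bounds {prog : Program ar K} {D : Database ar K}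
    {a : List (Fact ar K) × List (ℕ × List ℕ)} (h : OnlyInstances prog D a) :
    ∀ g ∈ a.2, g.2.length ≤ maxBody prog ∧ g.1 < a.1.length + 1 := by
  classical
  intro g hg
  obtain ⟨R, hR, τ, -, h2, rfl⟩ := h g hg
  refine ⟨?_, ?_⟩
  · have h1 := Rule.length_edbAtoms_add prog R
    have h2 : R.body.length ≤ maxBody prog :=
      Finset.le_sup (f := fun R : Rule ar K => R.body.length) hR
    rw [Rule.instanceIds, List.length_map]
    omega
  · have := List.idxOf_lt_length_of_mem (h2 R.head (by simp))
    simp only [Rule.instanceIds, factId]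
    omega

/-- Evaluate a program by means of the plans in `L`: index the relations, carry out the plans,
propagate the derivable facts along the ground rules found, and list them. -/
noncomputable def Cmd.evaluate (prog : Program ar K) (L : List (Plan ar K)) (J : ℕ → JoinEdge ar)
    (V : ℕ → List ℕ) (ids : List ℕ) (qs : List P) : Cmd P K :=
  .seq (.seqMap ids fun n => .buildTrie n (J n) (V n))
    (.seq (.seqMap L.zipIdx fun x => x.1.cmd prog J x.2)
      (.seq (.propagate (maxBody prog)) (.seqMap qs (.outputPred ar))))

/-- The names `a`, `b`, `v`, `F`, `G` with their equations only keep the time bound short and free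
of unfolded definitions. -/
theorem WP.evaluate [Nonempty K] {prog : Program ar K} (hprog : WellFormed prog)
    (hg : AdornmentGroundable prog) {D : Database ar K} {L : List (Plan ar K)}
    (hL : ∀ p ∈ L, p.Valid prog)
    (hL' : ∀ R ∈ prog, ∀ ρ ∈ adornments prog, ∀ σ, Generates prog R ρ σ →
        ∃ p ∈ L, p.1 = R ∧ p.2.1 ∈ ρ.renamings)
    {J : ℕ → JoinEdge ar} {V : ℕ → List ℕ}
    (hJ : ∀ (i : ℕ) (p : Plan ar K), L[i]? = some p →
      p.HasEdges prog i J ∧ ∀ k ∈ p.edgeIds i, V k = p.vars)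
    {ids : List ℕ} (hids : ids.Nodup)
    (hids' : ∀ k, k ∈ ids ↔ ∃ (i : ℕ) (p : Plan ar K), L[i]? = some p ∧ k ∈ p.edgeIds i)
    {N m : ℕ} (hN : ∀ p, IsEDBOf prog p → (D.rel p).length ≤ N)
    (hm : ∀ (i : ℕ) (p : Plan ar K), L[i]? = some p → ∀ α : ℕ → K,
      joinWork J D (p.edgeIds i).toFinset [] p.vars α ≤ m)
    {qs : List P} (hqs : qs.Nodup) (hqs' : ∀ q, q ∈ qs ↔ IsIDB prog q) {a b v F G : ℕ}
    (ha : maxArity prog = a) (hb : maxBody prog = b) (hv : (b + 1) * a = v)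
    (hF : L.length * (m * (b + 1)) = F) (hG : L.length * m = G) :
    WP (.evaluate prog L J V ids qs)
      (ids.length * (N * (v * (10 * v + 59) + 2) + 7) +
        (L.length * (v + ((2 ^ a + 1) * (4 * v + 20) + (b + 1) * (22 * a + 100)) * m) +
          ((14 * (F + 1) + (15 * b + 35) * (G * (b + 1)) + 15) +
            (F * (19 * a + 35) + qs.length * 7))))
      (fun s' => ∀ q, IsIDB prog q → ∃ L : List (Fin (ar q) → K), L.Nodup ∧
        (∀ t, t ∈ L ↔ Holds prog D ⟨q, t⟩) ∧ s'.Stores q L) (initMach prog D) := by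
  have hplan : ∀ k ∈ ids, ∃ (i : ℕ) (p : Plan ar K), L[i]? = some p ∧ k ∈ p.edgeIds i ∧
      p.Valid prog ∧ IsEDBOf prog (J k).rel ∧ V k = p.vars := by
    intro k hk
    obtain ⟨i, p, hi, hk⟩ := (hids' k).1 hk
    have hp := hL p (List.mem_of_getElem? hi)
    exact ⟨i, p, hi, hk, hp, (hJ i p hi).1.rel hp hk, (hJ i p hi).2 k hk⟩
  refine WP.seq ((WP.buildTries (D := D) (N := N) (v := v) hids (fun k hk => ?_) (fun k hk => ?_)
    (fun k hk => ?_) (fun k hk => ?_) fun k _ => hasTrie_initMach prog D k).mono le_rfl ?_)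
  · obtain ⟨i, p, -, -, hp, -, e⟩ := hplan k hk
    rw [e, ← hv, ← hb, ← ha]
    exact ⟨p.nodup_vars, Plan.length_vars_le hp.mem⟩
  · obtain ⟨i, p, -, -, -, hk, -⟩ := hplan k hk
    exact hN _ hk
  · obtain ⟨i, p, -, -, -, hk, -⟩ := hplan k hk
    exact (relation_initMach D hk.1).1
  · obtain ⟨i, p, -, -, -, hk, -⟩ := hplan k hk
    exact (relation_initMach D hk.1).2
  rintro s₁ ⟨h1, k1⟩
  have ha₁ : s₁.HasInstances D {q | ¬ IsIDB prog q} (([] : List (Fact ar K)), []) := by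
    obtain ⟨i1, i2, i3⟩ := hasInstances_initMach prog D
    refine ⟨i1.of_agree k1 (by simp) (by simp [factReg]), i2.of_agree k1 (by simp)
      (by simp [ruleReg]), fun q hq t => ?_⟩
    rw [k1.1 2 (by simp)]
    exact i3 q hq t
  have hs₁ : ∀ (i : ℕ) (p : Plan ar K), L[i]? = some p → s₁.HasTries J D p.vars (p.edgeIds i) := by
    intro i p hi k hk
    rw [← (hJ i p hi).2 k hk]
    exact h1 k ((hids' k).2 ⟨i, p, hi, hk⟩)
  have hplans := WP.plans hg hL (fun i p hi => (hJ i p hi).1) hm hs₁ ha₁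
  simp only [ha, hb, hv] at hplans
  refine WP.seq (hplans.mono le_rfl ?_)
  rintro s₂ ⟨k2, A, hA, hA1, hA2, hA3, hA4⟩
  rw [hF] at hA2
  rw [hG] at hA3
  have hinst : ∀ R ∈ prog, ∀ τ, (∀ B ∈ R.body, Holds prog D (B.ground τ)) →
      Recorded prog A R τ := by
    intro R hR τ h
    obtain ⟨p, hp, rfl, hfix, hfit⟩ := exists_plan_fits hprog hL hL' hR h
    obtain ⟨i, hi⟩ := List.mem_iff_getElem?.1 hp
    refine hA4 i p hi τ (hfit i J (hJ i p hi).1) hfix fun B hB => ?_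
    obtain ⟨hB1, hB2⟩ := Rule.mem_edbAtoms.1 hB
    exact Holds.inData hprog (h B hB1) hB2
  rw [hb]
  refine WP.seq ((WP.propagate (B := A.1.length + 1) hA.2.1 (fun g hg => ?_)
    (fun g hg => (hA1.bounds g hg).2) (by omega) fun n => ?_).mono (by gcongr) ?_)
  · rw [← hb]
    exact (hA1.bounds g hg).1
  · rw [k2.1 14 (by simp), k1.1 14 (by simp)]
    exact tab_initMach (by omega) _
  rintro s₃ ⟨h3, k3⟩
  refine (WP.output hqs (a := a) (fun q hq => ?_) (hA.1.of_agree k3 (by simp) (by simp [factReg]))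
    h3 fun q hq => (stores_initMach D ((hqs' q).1 hq)).of_tab fun n hn => ?_).mono (by gcongr) ?_
  · obtain ⟨R, hR, rfl, -⟩ := (hqs' q).1 hq
    rw [← ha]
    exact le_maxArity hR (by simp)
  · rw [k3.1 n (by simp; omega), k2.1 n (by simp; omega), k1.1 n (by simp; omega)]
  · intro s₄ h4 q hq
    obtain ⟨M, hM, hM', hM''⟩ := h4 q ((hqs' q).2 hq)
    exact ⟨M, hM, fun t => (hM' t).trans (holds_iff_derivable hA1 hinst (f := ⟨q, t⟩) hq).symm,
      hM''⟩

/-! ### The total running time -/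

/-- The constant in the running time of the evaluation of a program with at most `b` atoms in the
rule bodies and predicates of arity at most `a`. -/
def evaluationConstant (b a : ℕ) : ℕ :=
  let v := (b + 1) * a
  (2 ^ a * (v * (10 * v + 59) + 9) + (v + ((2 ^ a + 1) * (4 * v + 20) + (b + 1) * (22 * a + 100))) +
    (14 * (b + 2) + (15 * b + 35) * (b + 1) + 15) + ((b + 1) * (19 * a + 35) + 7)) * (2 * v + 1)

/-- Each summand is at most a constant times `w * m`, where `w` bounds the number of plans and `m`
the work of a single join. The factor `2 * v + 1` on the left is later cancelled against the one
contained in `m`. The inequality `N ≤ m` is needed only if some relation is indexed. -/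
theorem evaluation_time_le {a b v w n e q N m : ℕ} (hv : (b + 1) * a = v) (hn : n ≤ w)
    (he : e ≤ n * 2 ^ a) (hq : q ≤ w) (hw : 1 ≤ w) (hm : 1 ≤ m) (hN : e ≠ 0 → N ≤ m) :
    (e * (N * (v * (10 * v + 59) + 2) + 7) +
        (n * (v + ((2 ^ a + 1) * (4 * v + 20) + (b + 1) * (22 * a + 100)) * m) +
          ((14 * (n * (m * (b + 1)) + 1) + (15 * b + 35) * (n * m * (b + 1)) + 15) +
            (n * (m * (b + 1)) * (19 * a + 35) + q * 7)))) * (2 * v + 1) ≤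
      evaluationConstant b a * (w * m) := by
  have h1 : e * (N * (v * (10 * v + 59) + 2) + 7) ≤ w * m * (2 ^ a * (v * (10 * v + 59) + 9)) := by
    rcases eq_or_ne e 0 with rfl | h0
    · simp
    calc e * (N * (v * (10 * v + 59) + 2) + 7)
        ≤ (w * 2 ^ a) * (m * (v * (10 * v + 59) + 2) + m * 7) := by
          have := hN h0
          have := he.trans (Nat.mul_le_mul_right _ hn)
          have : 7 ≤ m * 7 := by omega
          gcongr
      _ = _ := by ring
  have hnm : n * m ≤ w * m := Nat.mul_le_mul_right _ hn
  have hnw : n ≤ w * m := hn.trans (Nat.le_mul_of_pos_right _ hm)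
  have hqw : q ≤ w * m := hq.trans (Nat.le_mul_of_pos_right _ hm)
  have h0 : 1 ≤ w * m := Nat.mul_pos hw hm
  set z := w * m
  set c₂ := (2 ^ a + 1) * (4 * v + 20) + (b + 1) * (22 * a + 100)
  have h2 : n * (v + c₂ * m) ≤ z * (v + c₂) := by
    calc n * (v + c₂ * m) = n * v + n * m * c₂ := by ring
      _ ≤ z * v + z * c₂ := by gcongr
      _ = _ := by ring
  have h3 : n * (m * (b + 1)) ≤ z * (b + 1) := by
    rw [← mul_assoc]; gcongr
  have h4 : 14 * (n * (m * (b + 1)) + 1) + (15 * b + 35) * (n * m * (b + 1)) + 15 ≤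
      z * (14 * (b + 2) + (15 * b + 35) * (b + 1) + 15) := by
    calc _ ≤ 14 * (z * (b + 1) + z) + (15 * b + 35) * (z * (b + 1)) + 15 * z := by
          have : 15 ≤ 15 * z := by omega
          gcongr
      _ = _ := by ring
  have h5 : n * (m * (b + 1)) * (19 * a + 35) + q * 7 ≤ z * ((b + 1) * (19 * a + 35) + 7) := by
    calc _ ≤ z * (b + 1) * (19 * a + 35) + z * 7 := by gcongr
      _ = _ := by ring
  calc _ ≤ (z * (2 ^ a * (v * (10 * v + 59) + 9)) + (z * (v + c₂) +
        (z * (14 * (b + 2) + (15 * b + 35) * (b + 1) + 15) +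
          z * ((b + 1) * (19 * a + 35) + 7)))) * (2 * v + 1) := by gcongr
    _ = _ := by
      simp only [evaluationConstant, hv]
      ring

/-- With these two lower bounds, costs that occur once for the whole program or once for a predicate
are absorbed by the product. -/
theorem one_le_adornmentCoeff {prog : Program ar K} (hprog : WellFormed prog)
    {ρ : Adornment ar K} (hρ : ρ ∈ adornments prog) :
    1 ≤ adornmentCoeff prog ∧ 1 ≤ prog.card := by
  obtain ⟨R', hR', e⟩ := hρ
  obtain ⟨R, hR, hR2⟩ := (hR'.shaped hprog).head_pred
  rw [e] at hR2
  refine ⟨le_trans ?_ (Finset.le_sup (f := fun R : Rule ar K => numAdornments prog R.head.pred) hR),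
    Finset.card_pos.2 ⟨R, hR⟩⟩
  refine (Set.ncard_pos ((finite_renamings hprog).subset ?_)).2 ⟨_, ρ, ⟨R', hR', e⟩, hR2.symm, rfl⟩
  rintro O ⟨ρ, hρ, -, e⟩
  exact ⟨ρ, hρ, e⟩

/-- Without adornments no intensional fact is derivable, and the initial memory already stores the
empty relation for every intensional predicate. -/
theorem isResult_initState {prog : Program ar K} (hprog : WellFormed prog)
    (h : adornments prog = ∅) (D : Database ar K) : (initState prog D).IsResult prog D := by
  refine fun q hq => ⟨[], List.nodup_nil, fun t => ⟨by simp, fun ht => ?_⟩,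
    (stores_initMach D hq).state (represents_initMach prog D)⟩
  obtain ⟨R', hR', -⟩ := (ht.exists_adornment hprog).2 hq
  exact (h ▸ (⟨R', hR', rfl⟩ : R'.ρ ∈ adornments prog) : R'.ρ ∈ (∅ : Set (Adornment ar K))).elim

/-- The evaluation of a program with at least one adornment. -/
theorem exists_evaluation [Nonempty K] {prog : Program ar K} (hprog : WellFormed prog)
    (hg : AdornmentGroundable prog) {ρ₀ : Adornment ar K} (hρ₀ : ρ₀ ∈ adornments prog) :
    ∃ c : Cmd P K, ∀ (D : Database ar K) (N : ℕ), 1 ≤ N →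
      (∀ p, IsEDBOf prog p → (D.rel p).length ≤ N) →
      ∃ (t : ℕ) (S : State P K), Exec c (initState prog D) t S ∧ S.IsResult prog D ∧
        (t : ℝ) ≤ evaluationConstant (maxBody prog) (maxArity prog) *
          (adornmentCoeff prog * prog.card * (N : ℝ) ^ edgeCoverWidth prog) := by
  classical
  obtain ⟨L, hLn, hL, hL'⟩ := exists_adorned_rules hprog
  obtain ⟨hf, hc⟩ := one_le_adornmentCoeff hprog hρ₀
  obtain ⟨R₀, -⟩ := Finset.card_pos.1 hc
  have hval : ∀ p ∈ L, Plan.Valid prog p := fun p hp => ⟨(hL p hp).1, (hL p hp).2.1, (hL p hp).2.2⟩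
  -- Only a default for `getD`; the numbers in `ids` always refer to plans in `L`.
  set p₀ : Plan ar K := ⟨R₀, ρ₀, .var⟩
  set J : ℕ → JoinEdge ar := fun n => (L.getD n.unpair.1 p₀).edge prog n.unpair.2 with hJdef
  set V : ℕ → List ℕ := fun n => (L.getD n.unpair.1 p₀).vars with hVdef
  set ids : List ℕ := (L.zipIdx.flatMap fun x => Plan.edgeIds x.1 x.2).dedup with hidsdef
  set qs : List P := (prog.image fun R => R.head.pred).toList with hqsdef
  have hJ : ∀ (i : ℕ) (p : Plan ar K), L[i]? = some p →
      p.HasEdges prog i J ∧ ∀ k ∈ p.edgeIds i, V k = p.vars := by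
    intro i p hi
    have hk : ∀ k ∈ p.edgeIds i, L.getD k.unpair.1 p₀ = p := fun k hk => by
      rw [(Plan.mem_edgeIds.1 hk).1, List.getD_eq_getElem?_getD, hi]
      rfl
    exact ⟨fun k h => by simp only [hJdef, hk k h], fun k h => by simp only [hVdef, hk k h]⟩
  have hids' : ∀ k, k ∈ ids ↔ ∃ (i : ℕ) (p : Plan ar K), L[i]? = some p ∧ k ∈ p.edgeIds i := by
    intro k
    rw [hidsdef, List.mem_dedup, List.mem_flatMap]
    constructor
    · rintro ⟨⟨p, i⟩, hp, hk⟩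
      exact ⟨i, p, List.mem_zipIdx_iff_getElem?.1 hp, hk⟩
    · rintro ⟨i, p, hi, hk⟩
      exact ⟨(p, i), List.mem_zipIdx_iff_getElem?.2 hi, hk⟩
  have hidsn : ids.length ≤ L.length * 2 ^ maxArity prog := by
    refine (List.dedup_sublist _).length_le.trans ?_
    rw [List.length_flatMap, ← List.length_zipIdx (l := L), ← List.length_map (as := L.zipIdx)
      fun x => (Plan.edgeIds x.1 x.2).length, ← smul_eq_mul]
    refine List.sum_le_card_nsmul _ _ fun k hk => ?_
    obtain ⟨⟨p, i⟩, hp, rfl⟩ := List.mem_map.1 hk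
    have hp := hval p (List.mem_of_getElem? (List.mem_zipIdx_iff_getElem?.1 hp))
    simpa [Plan.edgeIds] using hp.generates.shaped.card_edges_le
  have hqs' : ∀ q, q ∈ qs ↔ IsIDB prog q := by
    intro q
    simp only [hqsdef, Finset.mem_toList, Finset.mem_image]
    constructor
    · rintro ⟨R, hR, rfl⟩
      exact hprog.head_idb R hR
    · rintro ⟨R, hR, e, -⟩
      exact ⟨R, hR, e⟩
  have hqsn : qs.length ≤ prog.card := by
    rw [hqsdef, Finset.length_toList]
    exact Finset.card_image_le
  refine ⟨.evaluate prog L J V ids qs, fun D N hN hD => ?_⟩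
  set X : ℝ := (N : ℝ) ^ edgeCoverWidth prog with hX
  set v := (maxBody prog + 1) * maxArity prog with hv
  have hX1 : 1 ≤ X := by
    refine Real.one_le_rpow (by exact_mod_cast hN) ?_
    refine le_trans (Real.sInf_nonneg ?_) (width_le_edgeCoverWidth hprog hρ₀)
    rintro s ⟨w, hw, rfl⟩
    exact Finset.sum_nonneg fun e he => (hw.1 e he).1
  -- The bound of `Plan.joinWork_le`, rounded down to a natural number; nothing is lost because
  -- `joinWork` is a natural number.
  set m : ℕ := ⌊(2 * v + 1) * X⌋₊ with hmdef
  have hmX : (m : ℝ) ≤ (2 * v + 1) * X := Nat.floor_le (by positivity)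
  have hXm : X ≤ (2 * v + 1) * X := by
    have : 0 ≤ (v : ℝ) * X := by positivity
    linarith
  have hm1 : 1 ≤ m := Nat.le_floor (by simpa using hX1.trans hXm)
  have hm : ∀ (i : ℕ) (p : Plan ar K), L[i]? = some p → ∀ α : ℕ → K,
      joinWork J D (p.edgeIds i).toFinset [] p.vars α ≤ m := by
    intro i p hi α
    refine Nat.le_floor ?_
    have := Plan.joinWork_le hprog hg hN hD (hval p (List.mem_of_getElem? hi)) (hJ i p hi).1 α
    rw [hv]
    push_cast
    exact this
  have hNm : ids.length ≠ 0 → N ≤ m := by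
    intro h
    obtain ⟨k, hk⟩ := List.exists_mem_of_length_pos (Nat.pos_of_ne_zero h)
    obtain ⟨i, p, hi, hk⟩ := (hids' k).1 hk
    exact Nat.le_floor ((Plan.le_rpow hprog hN (hval p (List.mem_of_getElem? hi)) hk).trans hXm)
  obtain ⟨t, S, s, h1, h2, h3, h4⟩ := WP.evaluate hprog hg hval hL' hJ (List.nodup_dedup _) hids' hD
    hm (Finset.nodup_toList _) hqs' rfl rfl rfl rfl rfl _ (represents_initMach prog D)
  refine ⟨t, S, h1, fun q hq => ?_, ?_⟩
  · obtain ⟨M, hM, hM', hM''⟩ := h4 q hq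
    exact ⟨M, hM, hM', hM''.state h3⟩
  · have hw : prog.card ≤ prog.card * adornmentCoeff prog := Nat.le_mul_of_pos_right _ hf
    have key := (Nat.mul_le_mul_right (2 * v + 1) h2).trans (evaluation_time_le rfl hLn hidsn
      (hqsn.trans hw) (hc.trans hw) hm1 hNm)
    have key' : (t : ℝ) * (2 * v + 1) ≤ evaluationConstant (maxBody prog) (maxArity prog) *
        (prog.card * adornmentCoeff prog * m) := by exact_mod_cast key
    have hpos : (0 : ℝ) < 2 * v + 1 := by positivity
    refine le_of_mul_le_mul_right (key'.trans ?_) hpos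
    calc _ ≤ (evaluationConstant (maxBody prog) (maxArity prog) : ℝ) *
          (prog.card * adornmentCoeff prog * ((2 * v + 1) * X)) := by gcongr
      _ = _ := by ring

end

end Datalog

/-! ### The main theorem -/

theorem mainTheorem9 :
    ∃ C : ℕ → ℕ → ℕ, ∀ (P : Type u) (ar : P → ℕ) (K : Type v) [Nonempty K]
      (prog : Datalog.Program ar K),
      Datalog.WellFormed prog → Datalog.AdornmentGroundable prog →
      ∃ c : Datalog.Cmd P K, ∀ (D : Datalog.Database ar K) (N : ℕ), 1 ≤ N →
        (∀ p, Datalog.IsEDBOf prog p → (D.rel p).length ≤ N) →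
        ∃ (t : ℕ) (S : Datalog.State P K),
          Datalog.Exec c (Datalog.initState prog D) t S ∧ S.IsResult prog D ∧
          (t : ℝ) ≤ (C (Datalog.maxBody prog) (Datalog.maxArity prog) : ℝ) *
            ((Datalog.adornmentCoeff prog : ℝ) * (prog.card : ℝ) *
              (N : ℝ) ^ Datalog.edgeCoverWidth prog) := by
  refine ⟨Datalog.evaluationConstant, fun P ar K _ prog hprog hg => ?_⟩
  rcases (Datalog.adornments prog).eq_empty_or_nonempty with h | ⟨ρ, hρ⟩
  -- Here the coefficient `f` is 0 and so is the time bound; the machine must halt without taking a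
  -- step.
  · exact ⟨.skip, fun D N _ _ => ⟨0, _, .skip _, Datalog.isResult_initState hprog h D,
      by push_cast; positivity⟩⟩
  · exact Datalog.exists_evaluation hprog hg hρ
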